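/- Let $c_1,c_2$ be real numbers with $0<c_1<c_2\le 2$ and $c_1^{-1}-c_2^{-1}\le 1$, and put $m_1=c_1^{-1}$. Let $c:\mathbb{R}\to\mathbb{R}$ satisfy (C1) $c_1<\inf_{x} c(x)\le \sup_{x} c(x)<c_2$, and at least one of the following two conditions: (C2) $c\in W^{N,\infty}(\mathbb{R})$ for some $N\in\mathbb{N}$ with $N>\frac32+c_1^{-1}$ and $N\ge 1+\lceil c_1^{-1}\rceil$; (C2') there are $c_0\in(c_1,c_2)$ and a real $s>\frac32+c_1^{-1}$ with $s\ge 1+\lceil c_1^{-1}\rceil$ such that $c-c_0\in H^s(\mathbb{R})$ and $c^{-1}-c_0^{-1}\in H^s(\mathbb{R})$. Define the symbols $$d(x,\xi)=\frac{|\xi|}{1+c(x)|\xi|},\qquad p(x,\xi)=(1+c(x)|\xi|)^{1/c(x)},\qquad p^{-1}(x,\xi)=\frac1{p(x,\xi)}.$$ With $\widehat f(\xi)=\int_{\mathbb{R}} e^{-2\pi i x\xi}f(x)\,dx$, the semiclassical quantization of a symbol $a$ with parameter $t\in(0,1]$ is $$a(x,tD)f(x)=\int_{\mathbb{R}} e^{2\pi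 i x\xi}\,a(x,t\xi)\,\widehat f(\xi)\,d\xi .$$ Let $H^{\sigma}_t(\mathbb{R})$ be the space of tempered distributions $u$ with $(1+it\xi)^{\sigma}\,\widehat u\in L^2(\mathbb{R})$, with norm $\|u\|_{H^\sigma_t}=\|(1+it\xi)^\sigma\,\widehat u\|_{L^2}$. Then there is a constant $C>0$ such that for every $t\in(0,1]$: for every Schwartz function $f$, the function $d(x,tD)f$ and its Fourier transform are integrable (so that $p^{-1}(x,tD)\,d(x,tD)f$ is given by the formula above), and the operator $$f\mapsto t^{-1}\Big(p^{-1}(x,tD)\,d(x,tD)f-(p^{-1}d)(x,tD)f\Big),$$ defined on Schwartz functions $f$, extends to a bounded linear operator $H^{-m_1}_t(\mathbb{R})\to L^2(\mathbb{R})$ with $$\Big\|t^{-1}\big(p^{-1}(x,tD)\,d(x,tD)-(p^{-1}d)(x,tD)\big)\Big\|_{\mathcal{L}(H^{-m_1}_t;\,L^2)}\le C .$$ -/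

import Mathlib

open MeasureTheory TemperedDistribution
open scoped FourierTransform SchwartzMap ContDiff ENNReal

noncomputable section

/-! ### Semiclassical Sobolev spaces -/

/-- The weight `(1 + t² ξ²) ^ (s / 2)`, i.e. the modulus of `(1 + i t ξ) ^ s`. -/
def sobolevWeight (t s : ℝ) (ξ : ℝ) : ℂ :=
  (((1 + (t * ξ) ^ 2) ^ (s / 2) : ℝ) : ℂ)

theorem sobolevWeight_hasTemperateGrowth (t s : ℝ) :
    (sobolevWeight t s).HasTemperateGrowth := by
  have h1 : (fun ξ : ℝ ↦ t * ξ).HasTemperateGrowth := by fun_prop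
  have h2 : (fun y : ℝ ↦ (((1 + ‖y‖ ^ 2) ^ (s / 2) : ℝ) : ℂ)).HasTemperateGrowth := by
    fun_prop
  have h3 := h2.comp h1
  have h4 : sobolevWeight t s
      = (fun y : ℝ ↦ (((1 + ‖y‖ ^ 2) ^ (s / 2) : ℝ) : ℂ)) ∘ (fun ξ : ℝ ↦ t * ξ) := by
    funext ξ
    simp [sobolevWeight]
  rw [h4]
  exact h3

theorem sobolevWeight_mul_neg (t s : ℝ) :
    sobolevWeight t s * sobolevWeight t (-s) = fun _ ↦ 1 := by
  funext ξ
  have h : (0 : ℝ) < 1 + (t * ξ) ^ 2 := by positivity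
  simp only [Pi.mul_apply, sobolevWeight]
  rw [← Complex.ofReal_mul, ← Real.rpow_add h]
  norm_num [neg_div]

/-- `u ↦ (1 + t² ξ²) ^ (s / 2) û(ξ)` on tempered distributions. -/
def weightedFourier (t s : ℝ) : 𝓢'(ℝ, ℂ) →ₗ[ℂ] 𝓢'(ℝ, ℂ) :=
  (smulLeftCLM ℂ (sobolevWeight t s)).toLinearMap ∘ₗ
    (FourierTransform.fourierCLM ℂ 𝓢'(ℝ, ℂ)).toLinearMap

theorem weightedFourier_apply (t s : ℝ) (u : 𝓢'(ℝ, ℂ)) :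
    weightedFourier t s u = smulLeftCLM ℂ (sobolevWeight t s) (𝓕 u) := rfl

theorem weightedFourier_injective (t s : ℝ) : Function.Injective (weightedFourier t s) := by
  intro u v h
  have h1 := congrArg (smulLeftCLM ℂ (sobolevWeight t (-s))) h
  simp only [weightedFourier_apply] at h1
  rw [smulLeftCLM_smulLeftCLM_apply (sobolevWeight_hasTemperateGrowth t s)
      (sobolevWeight_hasTemperateGrowth t (-s)),
    smulLeftCLM_smulLeftCLM_apply (sobolevWeight_hasTemperateGrowth t s)
      (sobolevWeight_hasTemperateGrowth t (-s)), sobolevWeight_mul_neg] at h1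
  simp only [smulLeftCLM_const, one_smul] at h1
  have h2 := congrArg (fun w : 𝓢'(ℝ, ℂ) ↦ 𝓕⁻ w) h1
  simpa using h2

/-- The canonical embedding of `L²(ℝ)` into the tempered distributions. -/
def lpTwoToDistribution : Lp ℂ 2 (volume : Measure ℝ) →ₗ[ℂ] 𝓢'(ℝ, ℂ) :=
  (Lp.toTemperedDistributionCLM ℂ (volume : Measure ℝ) 2).toLinearMap

theorem lpTwoToDistribution_injective : Function.Injective lpTwoToDistribution :=
  LinearMap.ker_eq_bot.1 Lp.ker_toTemperedDistributionCLM_eq_bot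

/-- The tempered distributions `u` with `(1 + t² ξ²) ^ (s / 2) û ∈ L²(ℝ)`. -/
def semiclassicalSobolevSubmodule (t s : ℝ) : Submodule ℂ 𝓢'(ℝ, ℂ) :=
  (LinearMap.range lpTwoToDistribution).comap (weightedFourier t s)

/-- The semiclassical Sobolev space `H^s_t(ℝ)`. -/
def SemiclassicalSobolev (t s : ℝ) : Type := ↥(semiclassicalSobolevSubmodule t s)

namespace SemiclassicalSobolev

instance (t s : ℝ) : AddCommGroup (SemiclassicalSobolev t s) :=
  inferInstanceAs (AddCommGroup ↥(semiclassicalSobolevSubmodule t s))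

instance (t s : ℝ) : Module ℂ (SemiclassicalSobolev t s) :=
  inferInstanceAs (Module ℂ ↥(semiclassicalSobolevSubmodule t s))

/-- The underlying tempered distribution. -/
def toDistribution (t s : ℝ) : SemiclassicalSobolev t s →ₗ[ℂ] 𝓢'(ℝ, ℂ) :=
  (semiclassicalSobolevSubmodule t s).subtype

/-- The `L²` function that represents `(1 + t² ξ²) ^ (s / 2) û`. -/
def toLpTwo (t s : ℝ) : SemiclassicalSobolev t s →ₗ[ℂ] Lp ℂ 2 (volume : Measure ℝ) :=
  (LinearEquiv.ofInjective lpTwoToDistribution lpTwoToDistribution_injective).symm.toLinearMap ∘ₗ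
    LinearMap.codRestrict (LinearMap.range lpTwoToDistribution)
      (weightedFourier t s ∘ₗ toDistribution t s) (fun u ↦ u.2)

theorem toLpTwo_spec (t s : ℝ) (u : SemiclassicalSobolev t s) :
    lpTwoToDistribution (toLpTwo t s u) = weightedFourier t s (toDistribution t s u) :=
  congrArg Subtype.val
    ((LinearEquiv.ofInjective lpTwoToDistribution lpTwoToDistribution_injective).apply_symm_apply
      (LinearMap.codRestrict (LinearMap.range lpTwoToDistribution)
        (weightedFourier t s ∘ₗ toDistribution t s) (fun u ↦ u.2) u))

theorem toLpTwo_injective (t s : ℝ) : Function.Injective (toLpTwo t s) := by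
  intro u v h
  have h1 := congrArg lpTwoToDistribution h
  rw [toLpTwo_spec, toLpTwo_spec] at h1
  exact Subtype.ext (weightedFourier_injective t s h1)

/-- `‖u‖_{H^s_t} = ‖(1 + t² ξ²) ^ (s / 2) û‖_{L²} = ‖(1 + i t ξ) ^ s û‖_{L²}`. -/
instance (t s : ℝ) : NormedAddCommGroup (SemiclassicalSobolev t s) :=
  NormedAddCommGroup.induced (SemiclassicalSobolev t s) (Lp ℂ 2 (volume : Measure ℝ))
    (toLpTwo t s) (toLpTwo_injective t s)

instance (t s : ℝ) : NormedSpace ℂ (SemiclassicalSobolev t s) :=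
  NormedSpace.induced ℂ (SemiclassicalSobolev t s) (Lp ℂ 2 (volume : Measure ℝ)) (toLpTwo t s)

theorem norm_eq (t s : ℝ) (u : SemiclassicalSobolev t s) : ‖u‖ = ‖toLpTwo t s u‖ := rfl

theorem schwartz_mem (t s : ℝ) (f : 𝓢(ℝ, ℂ)) :
    (f : 𝓢'(ℝ, ℂ)) ∈ semiclassicalSobolevSubmodule t s := by
  refine ⟨(SchwartzMap.smulLeftCLM ℂ (sobolevWeight t s) (𝓕 f)).toLp 2, ?_⟩
  have h := sobolevWeight_hasTemperateGrowth t s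
  rw [weightedFourier_apply, fourier_toTemperedDistributionCLM_eq]
  change Lp.toTemperedDistribution _ = _
  rw [Lp.toTemperedDistribution_toLp_eq]
  ext g
  rw [smulLeftCLM_apply_apply]
  refine (SchwartzMap.coe_apply _ _).trans (Eq.trans ?_ (SchwartzMap.coe_apply _ _).symm)
  congr 1
  funext x
  simp only [SchwartzMap.smulLeftCLM_apply_apply h, smul_eq_mul]
  ring

/-- A Schwartz function as an element of `H^s_t(ℝ)`. -/
def ofSchwartz (t s : ℝ) (f : 𝓢(ℝ, ℂ)) : SemiclassicalSobolev t s :=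
  ⟨(f : 𝓢'(ℝ, ℂ)), schwartz_mem t s f⟩

end SemiclassicalSobolev

/-! ### Hypotheses on the coefficient -/

/-- `g` is the weak derivative of order `k` of `f`. -/
def HasWeakDerivOfOrder (k : ℕ) (f g : ℝ → ℝ) : Prop :=
  ∀ φ : ℝ → ℝ, ContDiff ℝ ∞ φ → HasCompactSupport φ →
    ∫ x, f x * iteratedDeriv k φ x = (-1) ^ k * ∫ x, g x * φ x

/-- `f ∈ W^{N,∞}(ℝ)`. -/
def MemSobolevInfty (N : ℕ) (f : ℝ → ℝ) : Prop :=
  MemLp f ∞ volume ∧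
    ∀ k ≤ N, ∃ g : ℝ → ℝ, MemLp g ∞ volume ∧ HasWeakDerivOfOrder k f g

/-- `f ∈ H^s(ℝ)`, for a real-valued `f ∈ L²(ℝ)`. -/
def MemSobolevTwo (s : ℝ) (f : ℝ → ℝ) : Prop :=
  ∃ hf : MemLp (fun x ↦ (f x : ℂ)) 2 (volume : Measure ℝ),
    MemSobolev s 2 (hf.toLp (fun x ↦ (f x : ℂ)) : 𝓢'(ℝ, ℂ))

/-- `c₁ < inf c ≤ sup c < c₂`. -/
def ConditionC1 (c₁ c₂ : ℝ) (c : ℝ → ℝ) : Prop :=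
  BddBelow (Set.range c) ∧ BddAbove (Set.range c) ∧ c₁ < ⨅ x, c x ∧ ⨆ x, c x < c₂

/-- `c ∈ W^{N,∞}(ℝ)` for some natural number `N > 3/2 + 1/c₁` with `N ≥ 1 + ⌈1/c₁⌉`. -/
def ConditionC2 (c₁ : ℝ) (c : ℝ → ℝ) : Prop :=
  ∃ N : ℕ, 3 / 2 + c₁⁻¹ < (N : ℝ) ∧ 1 + ⌈c₁⁻¹⌉₊ ≤ N ∧ MemSobolevInfty N c

/-- `c - c₀` and `1/c - 1/c₀` are in `H^s(ℝ)` for some `c₀ ∈ (c₁, c₂)` and some real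
`s > 3/2 + 1/c₁` with `s ≥ 1 + ⌈1/c₁⌉`. -/
def ConditionC2' (c₁ c₂ : ℝ) (c : ℝ → ℝ) : Prop :=
  ∃ c₀ s : ℝ, c₁ < c₀ ∧ c₀ < c₂ ∧ 3 / 2 + c₁⁻¹ < s ∧ 1 + (⌈c₁⁻¹⌉₊ : ℝ) ≤ s ∧
    MemSobolevTwo s (fun x ↦ c x - c₀) ∧ MemSobolevTwo s (fun x ↦ (c x)⁻¹ - c₀⁻¹)

/-! ### Symbols and their semiclassical quantization -/

/-- `d(x, ξ) = |ξ| / (1 + c(x) |ξ|)`. -/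
def dSymbol (c : ℝ → ℝ) (x ξ : ℝ) : ℂ :=
  ((|ξ| / (1 + c x * |ξ|) : ℝ) : ℂ)

/-- `p(x, ξ) = (1 + c(x) |ξ|) ^ (1 / c(x))`. -/
def pSymbol (c : ℝ → ℝ) (x ξ : ℝ) : ℂ :=
  (((1 + c x * |ξ|) ^ (1 / c x) : ℝ) : ℂ)

/-- The symbol `p⁻¹(x, ξ) = 1 / p(x, ξ)`. -/
def pInvSymbol (c : ℝ → ℝ) (x ξ : ℝ) : ℂ := (pSymbol c x ξ)⁻¹

/-- `a(x, tD) u (x) = ∫ e^{2πi x ξ} a(x, t ξ) û(ξ) dξ`, for `u` integrable with integrable Fourier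
transform and bounded `a`. -/
def semiclassicalOp (t : ℝ) (a : ℝ → ℝ → ℂ) (u : ℝ → ℂ) (x : ℝ) : ℂ :=
  ∫ ξ : ℝ, Complex.exp (2 * Real.pi * Complex.I * x * ξ) * a x (t * ξ) * 𝓕 u ξ

/-- `a(x, tD) b(x, tD) u - (a b)(x, tD) u`. -/
def semicommutator (t : ℝ) (a b : ℝ → ℝ → ℂ) (u : ℝ → ℂ) (x : ℝ) : ℂ :=
  semiclassicalOp t a (semiclassicalOp t b u) x -
    semiclassicalOp t (fun y ξ ↦ a y ξ * b y ξ) u x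

end

/-! Write a for the coefficient, with values in [k₁, k₂] where c₁ < k₁ and k₂ < c₂, and m = 1/c₁. If
the coefficient in `p⁻¹` is frozen at a number κ, its quantization is a Fourier multiplier φ_κ(tD),
and the quantization of φ_κ d is exactly d(x,tD) φ_κ(tD). The semicommutator is then the commutator
of φ_κ(tD) with d(x,tD). The true symbol is recovered from the frozen ones by the fundamental
theorem of calculus in κ, from k₁ up to a(x). Cauchy–Schwarz over the compact range of κ
(`lintegral_fourierInv_pInvProfile_sq_le`) therefore reduces the estimate to commutator bounds that
are uniform in κ, for φ_κ and for its κ-derivative.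

Commutators with B = d(x,tD) reduce to commutators with multiplication by a. Put ε = k₂|tξ|/(1 +
k₂|tξ|) and h = a/k₂ - 1. Then d = k₂⁻¹ ε/(1 + hε), so B = k₂⁻¹E - hBE with ‖E‖ ≤ 1 and sup|h| < 1.
Hence B is a Neumann series, and [φ,B] = -[φ,h]BE - h[φ,B]E can be iterated
(`exists_commutator_bound_of_isResolventSolution`). Boundedness of B on H^{-m}_t follows from the
same equation with the Sobolev weight as multiplier, at a smaller scale δt where the commutator with
h is small enough to be absorbed.

The commutator of φ(tD) with a function is a superposition, over the frequencies ζ of that function,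
of the increments φ(t(ξ+ζ)) - φ(tξ). For a slowly varying φ these are O(t) relative to the weight of
H^{-m}_t, with a loss of order m + 1 in ζ. Under (C2') the Fourier transform of a - c₀ is integrable
against this loss (`norm_commutator_le_of_integrable`). Under (C2) one takes out a factor (1 +
2πiζ)⁻ᴺ and moves the Fourier transform from the remaining bounded function (1 + d/dx)ᴺa to the
kernel, whose transform is integrable because the kernel has one square integrable derivative in ζ
(`norm_commutator_le_of_bounded`). This is done for Schwartz functions with constants depending only
on sup norms of derivatives, and then passes to the limit. Both routes need regularity above 3/2 +
m.

The gap condition enters through φ_κ: its ξ-derivative decays with exponent 1/κ + 1, the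
κ-derivative costs a logarithm, and slow variation of order m thus requires m < 1 + 1/k₂
(`exists_isSlowlyVarying_pInvProfile`).

The composition is meaningful because d(x,tD)f is O((1 + x²)⁻¹) with Lipschitz increments of the
same decay, hence has an integrable Fourier transform (`integrable_fourier_dQuantization`). The
extension to H^{-m}_t is by density (`exists_extension`). -/

noncomputable section

/-! ### Multiplication operators and Fourier multipliers on `L²(ℝ)` -/

/-- The Hilbert space `L²(ℝ)`. -/
abbrev LTwo : Type := Lp ℂ 2 (volume : Measure ℝ)

open Classical in
/-- Multiplication by an essentially bounded function on `L²(ℝ)`. -/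
def mulOp (φ : ℝ → ℂ) : LTwo →L[ℂ] LTwo :=
  if h : MemLp φ ∞ volume then
    (ContinuousLinearMap.mul ℂ ℂ).holderL volume ∞ 2 2 (h.toLp φ)
  else 0

theorem coeFn_mulOp {φ : ℝ → ℂ} (h : MemLp φ ∞ volume) (u : LTwo) :
    mulOp φ u =ᵐ[volume] fun x ↦ φ x * u x := by
  rw [mulOp, dif_pos h]
  have h1 := (ContinuousLinearMap.mul ℂ ℂ).coeFn_holder (r := 2) (h.toLp φ) u
  filter_upwards [h1, h.coeFn_toLp] with x hx hx'
  change ((ContinuousLinearMap.mul ℂ ℂ).holder 2 (h.toLp φ) u) x = _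
  rw [hx, hx']
  rfl

theorem mulOp_congr {φ ψ : ℝ → ℂ} (h : φ =ᵐ[volume] ψ) : mulOp φ = mulOp ψ := by
  by_cases hφ : MemLp φ ∞ volume
  · have hψ : MemLp ψ ∞ volume := (memLp_congr_ae h).1 hφ
    ext1 u
    apply Lp.ext
    filter_upwards [coeFn_mulOp hφ u, coeFn_mulOp hψ u, h] with x h1 h2 h3
    rw [h1, h2, h3]
  · have hψ : ¬ MemLp ψ ∞ volume := fun h' ↦ hφ ((memLp_congr_ae h).2 h')
    rw [mulOp, mulOp, dif_neg hφ, dif_neg hψ]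

theorem norm_mulOp_apply_le {φ : ℝ → ℂ} (h : MemLp φ ∞ volume) {K : ℝ}
    (hK : ∀ᵐ x, ‖φ x‖ ≤ K) (u : LTwo) : ‖mulOp φ u‖ ≤ K * ‖u‖ := by
  apply Lp.norm_le_mul_norm_of_ae_le_mul
  filter_upwards [coeFn_mulOp h u, hK] with x hx hx'
  rw [hx, norm_mul]
  gcongr

theorem norm_mulOp_le_norm_mulOp {φ ψ : ℝ → ℂ} (hφ : MemLp φ ∞ volume) (hψ : MemLp ψ ∞ volume)
    {K : ℝ} (h : ∀ x, ‖φ x‖ ≤ K * ‖ψ x‖) (u : LTwo) : ‖mulOp φ u‖ ≤ K * ‖mulOp ψ u‖ := by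
  apply Lp.norm_le_mul_norm_of_ae_le_mul
  filter_upwards [coeFn_mulOp hφ u, coeFn_mulOp hψ u] with x h1 h2
  rw [h1, h2, norm_mul, norm_mul, ← mul_assoc]
  gcongr
  exact h x

theorem mulOp_mulOp {φ ψ : ℝ → ℂ} (hφ : MemLp φ ∞ volume) (hψ : MemLp ψ ∞ volume) (u : LTwo) :
    mulOp φ (mulOp ψ u) = mulOp (fun x ↦ φ x * ψ x) u := by
  have h : MemLp (fun x ↦ φ x * ψ x) ∞ volume := hψ.mul' hφ
  apply Lp.ext
  filter_upwards [coeFn_mulOp hφ (mulOp ψ u), coeFn_mulOp hψ u, coeFn_mulOp h u] with x h1 h2 h3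
  rw [h1, h2, h3, mul_assoc]

theorem mulOp_comm {φ ψ : ℝ → ℂ} (hφ : MemLp φ ∞ volume) (hψ : MemLp ψ ∞ volume) (u : LTwo) :
    mulOp φ (mulOp ψ u) = mulOp ψ (mulOp φ u) := by
  rw [mulOp_mulOp hφ hψ, mulOp_mulOp hψ hφ]
  congr 2
  funext x
  ring

theorem mulOp_toLp {φ g : ℝ → ℂ} (hφ : MemLp φ ∞ volume) (hg : MemLp g 2 volume)
    (h : MemLp (fun x ↦ φ x * g x) 2 volume) :
    mulOp φ (hg.toLp g) = h.toLp (fun x ↦ φ x * g x) := by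
  apply Lp.ext
  filter_upwards [coeFn_mulOp hφ (hg.toLp g), hg.coeFn_toLp, h.coeFn_toLp] with x h1 h2 h3
  rw [h1, h2, h3]

/-- The Fourier multiplier with symbol `φ` on `L²(ℝ)`. -/
def fourierMul (φ : ℝ → ℂ) : LTwo →L[ℂ] LTwo :=
  (FourierTransform.fourierInvCLM ℂ LTwo) ∘L mulOp φ ∘L (FourierTransform.fourierCLM ℂ LTwo)

theorem fourierMul_apply (φ : ℝ → ℂ) (u : LTwo) : fourierMul φ u = 𝓕⁻ (mulOp φ (𝓕 u)) := rfl

theorem norm_fourierInv_eq (u : LTwo) : ‖(𝓕⁻ u : LTwo)‖ = ‖u‖ :=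
  (Lp.fourierTransformₗᵢ ℝ ℂ).symm.norm_map u

theorem norm_fourierMul_apply (φ : ℝ → ℂ) (u : LTwo) :
    ‖fourierMul φ u‖ = ‖mulOp φ (𝓕 u)‖ := by
  rw [fourierMul_apply, norm_fourierInv_eq]

theorem norm_fourierMul_apply_le {φ : ℝ → ℂ} (h : MemLp φ ∞ volume) {K : ℝ}
    (hK : ∀ᵐ x, ‖φ x‖ ≤ K) (u : LTwo) : ‖fourierMul φ u‖ ≤ K * ‖u‖ := by
  rw [norm_fourierMul_apply, ← Lp.norm_fourier_eq u]
  exact norm_mulOp_apply_le h hK _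

theorem fourierMul_comm {φ ψ : ℝ → ℂ} (hφ : MemLp φ ∞ volume) (hψ : MemLp ψ ∞ volume)
    (u : LTwo) : fourierMul φ (fourierMul ψ u) = fourierMul ψ (fourierMul φ u) := by
  simp only [fourierMul_apply, FourierTransform.fourier_fourierInv_eq, mulOp_comm hφ hψ]

/-! ### The Fourier transform on `L¹ ∩ L²` -/

/-- Smooth compactly supported functions are Schwartz functions and already determine a locally
integrable function almost everywhere. This identifies L² transforms, which are defined abstractly,
with Fourier integrals. -/
theorem ae_eq_of_schwartz_integral_eq (h : LTwo) {k : ℝ → ℂ} (hk : Continuous k)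
    (H : ∀ ψ : 𝓢(ℝ, ℂ), ∫ x, ψ x * h x = ∫ x, ψ x * k x) : h =ᵐ[volume] k := by
  apply ae_eq_of_integral_contDiff_smul_eq
  · exact (Lp.memLp h).locallyIntegrable (by norm_num)
  · exact hk.locallyIntegrable
  intro g hg hgc
  have hgC : HasCompactSupport (fun x ↦ (g x : ℂ)) := hgc.comp_left (g := fun r : ℝ ↦ (r : ℂ)) (by simp)
  have hgd : ContDiff ℝ ∞ (fun x ↦ (g x : ℂ)) := Complex.ofRealCLM.contDiff.comp hg
  have := H (hgC.toSchwartzMap hgd)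
  simpa [Complex.real_smul] using this

theorem continuous_fourier_of_integrable {g : ℝ → ℂ} (h : Integrable g) : Continuous (𝓕 g) :=
  VectorFourier.fourierIntegral_continuous Real.continuous_fourierChar
    (by exact continuous_inner) h

theorem continuous_fourierInv_of_integrable {g : ℝ → ℂ} (h : Integrable g) :
    Continuous (𝓕⁻ g) := by
  rw [Real.fourierInv_eq_fourier_comp_neg]
  exact continuous_fourier_of_integrable h.comp_neg

theorem integral_fourier_mul_eq {f g : ℝ → ℂ} (hf : Integrable f) (hg : Integrable g) :
    ∫ x, 𝓕 f x * g x = ∫ x, f x * 𝓕 g x := by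
  have := VectorFourier.integral_fourierIntegral_smul_eq_flip (μ := volume) (ν := volume)
    (L := innerₗ ℝ) Real.continuous_fourierChar (by exact continuous_inner) hf hg
  rw [flip_innerₗ] at this
  exact this

/-- The L² transform is determined by its pairing with Schwartz functions, and the multiplication
formula gives the Fourier integral of an integrable g the same pairing. -/
theorem fourier_toLp_ae {g : ℝ → ℂ} (h1 : Integrable g) (h2 : MemLp g 2 volume) :
    (𝓕 (h2.toLp g) : LTwo) =ᵐ[volume] 𝓕 g := by
  apply ae_eq_of_schwartz_integral_eq
  · exact continuous_fourier_of_integrable h1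
  intro ψ
  have e1 := congrArg (fun w : 𝓢'(ℝ, ℂ) ↦ w ψ) (Lp.fourier_toTemperedDistribution_eq (h2.toLp g))
  simp only [TemperedDistribution.fourier_apply, Lp.toTemperedDistribution_apply, smul_eq_mul] at e1
  rw [← e1]
  have e2 : ∫ x, 𝓕 ψ x * (h2.toLp g) x = ∫ x, 𝓕 ψ x * g x := by
    apply integral_congr_ae
    filter_upwards [h2.coeFn_toLp] with x hx
    rw [hx]
  rw [e2, SchwartzMap.fourier_coe]
  exact integral_fourier_mul_eq ψ.integrable h1

theorem fourierInv_toLp_ae {g : ℝ → ℂ} (h1 : Integrable g) (h2 : MemLp g 2 volume) :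
    (𝓕⁻ (h2.toLp g) : LTwo) =ᵐ[volume] 𝓕⁻ g := by
  apply ae_eq_of_schwartz_integral_eq
  · exact continuous_fourierInv_of_integrable h1
  intro ψ
  have e1 := congrArg (fun w : 𝓢'(ℝ, ℂ) ↦ w ψ)
    (Lp.fourierInv_toTemperedDistribution_eq (h2.toLp g))
  simp only [TemperedDistribution.fourierInv_apply, Lp.toTemperedDistribution_apply,
    smul_eq_mul] at e1
  rw [← e1]
  have e2 : ∫ x, 𝓕⁻ ψ x * (h2.toLp g) x = ∫ x, 𝓕⁻ ψ x * g x := by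
    apply integral_congr_ae
    filter_upwards [h2.coeFn_toLp] with x hx
    rw [hx]
  rw [e2, SchwartzMap.fourierInv_coe]
  -- The inverse transform is the forward transform of the reflected function; a change of sign in
  -- the integral then moves the reflection onto ψ.
  have e3 := integral_fourier_mul_eq ψ.integrable h1.comp_neg
  rw [← Real.fourierInv_eq_fourier_comp_neg] at e3
  rw [← e3, ← integral_neg_eq_self]
  simp only [Real.fourierInv_eq_fourier_neg, neg_neg]

theorem lintegral_enorm_sq_eq {f : ℝ → ℂ} (h : MemLp f 2 volume) :
    ∫⁻ x, ‖f x‖ₑ ^ 2 = ‖h.toLp f‖ₑ ^ 2 := by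
  rw [Lp.enorm_toLp, eLpNorm_eq_lintegral_rpow_enorm_toReal (by norm_num) (by norm_num)]
  rw [← ENNReal.rpow_natCast, ← ENNReal.rpow_mul]
  simp

theorem lintegral_enorm_sq_coeFn (u : LTwo) : ∫⁻ x, ‖u x‖ₑ ^ 2 = ‖u‖ₑ ^ 2 := by
  have h := lintegral_enorm_sq_eq (Lp.memLp u)
  rwa [Lp.toLp_coeFn] at h

/-- Plancherel's theorem on `L¹ ∩ L²`. -/
theorem lintegral_enorm_fourier_sq {g : ℝ → ℂ} (h1 : Integrable g) (h2 : MemLp g 2 volume) :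
    ∫⁻ x, ‖𝓕 g x‖ₑ ^ 2 = ∫⁻ x, ‖g x‖ₑ ^ 2 := by
  rw [lintegral_enorm_sq_eq h2]
  have h3 : ∫⁻ x, ‖𝓕 g x‖ₑ ^ 2 = ∫⁻ x, ‖(𝓕 (h2.toLp g) : LTwo) x‖ₑ ^ 2 := by
    apply lintegral_congr_ae
    filter_upwards [fourier_toLp_ae h1 h2] with x hx
    rw [hx]
  rw [h3, lintegral_enorm_sq_coeFn, ← ofReal_norm, ← ofReal_norm, Lp.norm_fourier_eq]

theorem lintegral_enorm_fourierInv_sq {g : ℝ → ℂ} (h1 : Integrable g) (h2 : MemLp g 2 volume) :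
    ∫⁻ x, ‖𝓕⁻ g x‖ₑ ^ 2 = ∫⁻ x, ‖g x‖ₑ ^ 2 := by
  rw [lintegral_enorm_sq_eq h2]
  have h3 : ∫⁻ x, ‖𝓕⁻ g x‖ₑ ^ 2 = ∫⁻ x, ‖(𝓕⁻ (h2.toLp g) : LTwo) x‖ₑ ^ 2 := by
    apply lintegral_congr_ae
    filter_upwards [fourierInv_toLp_ae h1 h2] with x hx
    rw [hx]
  rw [h3, lintegral_enorm_sq_coeFn, ← ofReal_norm, ← ofReal_norm, norm_fourierInv_eq]

theorem fourierInv_apply_eq (g : ℝ → ℂ) (x : ℝ) :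
    𝓕⁻ g x = ∫ ξ : ℝ, Complex.exp (2 * Real.pi * Complex.I * x * ξ) * g ξ := by
  rw [Real.fourierInv_eq']
  congr 1
  funext ξ
  rw [smul_eq_mul]
  congr 2
  simp
  ring

theorem norm_cexp_two_pi (x ξ : ℝ) : ‖Complex.exp (2 * Real.pi * Complex.I * x * ξ)‖ = 1 := by
  have : (2 * Real.pi * Complex.I * x * ξ : ℂ) = ((2 * Real.pi * x * ξ : ℝ) : ℂ) * Complex.I := by
    push_cast; ring
  rw [this, Complex.norm_exp_ofReal_mul_I]

/-- The multiplier with symbol `φ` applied to `𝓕⁻ g`, for `g ∈ L¹ ∩ L²`. -/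
theorem fourierMul_fourierInv_toLp_ae {φ g : ℝ → ℂ} (hφ : MemLp φ ∞ volume) (h1 : Integrable g)
    (h2 : MemLp g 2 volume) :
    fourierMul φ (𝓕⁻ (h2.toLp g)) =ᵐ[volume] 𝓕⁻ (fun ξ ↦ φ ξ * g ξ) := by
  have h3 : MemLp (fun x ↦ φ x * g x) 2 volume := h2.mul' hφ
  have h4 : Integrable (fun x ↦ φ x * g x) volume := by
    rw [← memLp_one_iff_integrable] at h1 ⊢
    exact h1.mul' hφ
  rw [fourierMul_apply, FourierTransform.fourier_fourierInv_eq, mulOp_toLp hφ h2 h3]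
  exact fourierInv_toLp_ae h4 h3

/-! ### A formula for the commutator of a multiplier and a multiplication operator -/

theorem memLp_top_of_measurable_bounded {φ : ℝ → ℂ} (hm : Measurable φ) {K : ℝ}
    (hK : ∀ x, ‖φ x‖ ≤ K) : MemLp φ ∞ volume :=
  memLp_top_of_bound hm.aestronglyMeasurable K (Filter.Eventually.of_forall hK)

theorem measurable_cexp_two_pi (x : ℝ) :
    Measurable fun ξ : ℝ ↦ Complex.exp (2 * Real.pi * Complex.I * x * ξ) := by fun_prop

theorem memLp_two_of_integrable_of_bounded {g : ℝ → ℂ} (h1 : Integrable g) {G : ℝ}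
    (hG : ∀ x, ‖g x‖ ≤ G) : MemLp g 2 volume := by
  rw [memLp_two_iff_integrable_sq_norm h1.1]
  refine (h1.norm.const_mul G).mono' (by fun_prop) (Filter.Eventually.of_forall fun x ↦ ?_)
  rw [Real.norm_of_nonneg (by positivity), sq]
  gcongr
  exact hG x

theorem fourierInv_convolution {v g : ℝ → ℂ} (hv : Integrable v) (hg : Integrable g) (x : ℝ) :
    𝓕⁻ (fun η ↦ ∫ ζ, v ζ * g (η - ζ)) x = 𝓕⁻ v x * 𝓕⁻ g x := by
  have h := Real.fourier_mul_convolution_eq hv hg (-x)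
  simp only [Real.fourierInv_eq_fourier_neg]
  rw [← h]
  rfl

/-- Multiplication by 𝓕⁻ v is convolution with v on the Fourier side. After Fubini and the
substitution η = ξ + ζ, multiplying first shows the symbol φ(ξ + ζ) and multiplying last shows φ(ξ),
with the same modulation; only the increment of φ survives. -/
theorem fourierMul_commutator_pointwise {φ v g : ℝ → ℂ} (hφ : Measurable φ) {K : ℝ}
    (hK : ∀ ξ, ‖φ ξ‖ ≤ K) (hv : Integrable v) (hg : Integrable g) (x : ℝ) :
    𝓕⁻ (fun η ↦ φ η * ∫ ζ, v ζ * g (η - ζ)) x - 𝓕⁻ v x * 𝓕⁻ (fun ξ ↦ φ ξ * g ξ) x =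
      ∫ ζ : ℝ, v ζ * (Complex.exp (2 * Real.pi * Complex.I * x * ζ) *
        𝓕⁻ (fun ξ ↦ (φ (ξ + ζ) - φ ξ) * g ξ) x) := by
  set e : ℝ → ℂ := fun ξ ↦ Complex.exp (2 * Real.pi * Complex.I * x * ξ) with he
  have hem : Measurable e := measurable_cexp_two_pi x
  have hen : ∀ ξ, ‖e ξ‖ = 1 := norm_cexp_two_pi x
  have headd : ∀ a b, e (a + b) = e b * e a := by
    intro a b
    simp only [he]
    rw [← Complex.exp_add]
    congr 1
    push_cast
    ring
  have hprod : Integrable (fun p : ℝ × ℝ ↦ (e p.1 * φ p.1) * (v p.2 * g (p.1 - p.2)))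
      (volume.prod volume) := by
    have h0 := hv.convolution_integrand (ContinuousLinearMap.mul ℂ ℂ) hg
    refine h0.bdd_mul (c := K) (by fun_prop) (Filter.Eventually.of_forall fun p ↦ ?_)
    rw [norm_mul, hen, one_mul]
    exact hK _
  have hφg : ∀ ζ, Integrable (fun ξ ↦ e ξ * φ (ξ + ζ) * g ξ) := fun ζ ↦ by
    refine hg.bdd_mul (c := K) (by fun_prop) (Filter.Eventually.of_forall fun p ↦ ?_)
    rw [norm_mul, hen, one_mul]
    exact hK _
  have h1 : 𝓕⁻ (fun η ↦ φ η * ∫ ζ, v ζ * g (η - ζ)) x =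
      ∫ ζ, ∫ η, (e η * φ η) * (v ζ * g (η - ζ)) := by
    rw [fourierInv_apply_eq, ← integral_integral_swap hprod]
    congr 1
    funext η
    rw [← mul_assoc, ← integral_const_mul]
  have h2 : ∀ ζ, ∫ η, (e η * φ η) * (v ζ * g (η - ζ)) =
      v ζ * (e ζ * ∫ ξ, e ξ * φ (ξ + ζ) * g ξ) := by
    intro ζ
    rw [← integral_add_right_eq_self _ ζ, ← integral_const_mul, ← integral_const_mul]
    congr 1
    funext ξ
    rw [headd, add_sub_cancel_right]
    ring
  have h3 : 𝓕⁻ v x * 𝓕⁻ (fun ξ ↦ φ ξ * g ξ) x =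
      ∫ ζ, v ζ * (e ζ * ∫ ξ, e ξ * φ ξ * g ξ) := by
    rw [fourierInv_apply_eq v, fourierInv_apply_eq, ← integral_mul_const]
    congr 1
    funext ζ
    simp only [he, mul_assoc, mul_left_comm]
  rw [h1, h3, ← integral_sub]
  · congr 1
    funext ζ
    rw [h2, ← mul_sub, ← mul_sub, ← integral_sub (hφg ζ) (by simpa using hφg 0),
      fourierInv_apply_eq]
    congr 3
    funext ξ
    simp only [he]
    ring
  · exact hprod.integral_prod_right
  · have : Integrable (fun ζ ↦ e ζ * v ζ) :=
      hv.bdd_mul (c := 1) hem.aestronglyMeasurable (Filter.Eventually.of_forall fun p ↦ (hen _).le)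
    refine (this.mul_const (∫ ξ, e ξ * φ ξ * g ξ)).congr (Filter.Eventually.of_forall fun ζ ↦ ?_)
    simp only
    ring

theorem integrable_convolution_integral {v g : ℝ → ℂ} (hv : Integrable v) (hg : Integrable g) :
    Integrable (fun η ↦ ∫ ζ, v ζ * g (η - ζ)) :=
  hv.integrable_convolution (ContinuousLinearMap.mul ℂ ℂ) hg

theorem memLp_top_fourierInv {v : ℝ → ℂ} (hv : Integrable v) : MemLp (𝓕⁻ v) ∞ volume := by
  refine memLp_top_of_bound (continuous_fourierInv_of_integrable hv).aestronglyMeasurable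
    (∫ ζ, ‖v ζ‖) (Filter.Eventually.of_forall fun x ↦ ?_)
  exact VectorFourier.norm_fourierIntegral_le_integral_norm _ _ _ _ _

/-- Boundedness of g makes its convolution with v bounded as well as integrable, hence square
integrable, so that both L² operators are given by Fourier integrals. -/
theorem fourierMul_commutator_ae {φ v g : ℝ → ℂ} (hφ : Measurable φ) {K G : ℝ}
    (hK : ∀ ξ, ‖φ ξ‖ ≤ K) (hv : Integrable v) (hg : Integrable g) (hG : ∀ ξ, ‖g ξ‖ ≤ G)
    (hg2 : MemLp g 2 volume) :
    (fourierMul φ (mulOp (𝓕⁻ v) (𝓕⁻ (hg2.toLp g))) -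
      mulOp (𝓕⁻ v) (fourierMul φ (𝓕⁻ (hg2.toLp g))) : LTwo) =ᵐ[volume]
      fun x ↦ ∫ ζ : ℝ, v ζ * (Complex.exp (2 * Real.pi * Complex.I * x * ζ) *
        𝓕⁻ (fun ξ ↦ (φ (ξ + ζ) - φ ξ) * g ξ) x) := by
  have hφ' := memLp_top_of_measurable_bounded hφ hK
  have hb := memLp_top_fourierInv hv
  set k : ℝ → ℂ := fun η ↦ ∫ ζ, v ζ * g (η - ζ) with hk
  have hk1 : Integrable k := integrable_convolution_integral hv hg
  have hk2 : MemLp k 2 volume := by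
    refine memLp_two_of_integrable_of_bounded hk1 (G := ∫ ζ, ‖v ζ‖ * G) fun η ↦ ?_
    refine norm_integral_le_of_norm_le (hv.norm.mul_const G) (Filter.Eventually.of_forall fun ζ ↦ ?_)
    rw [norm_mul]
    gcongr
    exact hG _
  have h1 : mulOp (𝓕⁻ v) (𝓕⁻ (hg2.toLp g)) = (𝓕⁻ (hk2.toLp k) : LTwo) := by
    apply Lp.ext
    filter_upwards [coeFn_mulOp hb (𝓕⁻ (hg2.toLp g)), fourierInv_toLp_ae hg hg2,
      fourierInv_toLp_ae hk1 hk2] with x e1 e2 e3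
    rw [e1, e2, e3, hk, fourierInv_convolution hv hg]
  rw [h1]
  filter_upwards [fourierMul_fourierInv_toLp_ae hφ' hk1 hk2,
    fourierMul_fourierInv_toLp_ae hφ' hg hg2, Lp.coeFn_sub (fourierMul φ (𝓕⁻ (hk2.toLp k)))
      (mulOp (𝓕⁻ v) (fourierMul φ (𝓕⁻ (hg2.toLp g)))),
    coeFn_mulOp hb (fourierMul φ (𝓕⁻ (hg2.toLp g)))] with x e1 e2 e3 e4
  rw [e3, Pi.sub_apply, e1, e4, e2]
  exact fourierMul_commutator_pointwise hφ hK hv hg x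

/-! ### Slowly varying symbols -/

/-- Bounded symbols whose increments decay like those of a symbol of order `-m`. -/
structure IsSlowlyVarying (m K : ℝ) (φ : ℝ → ℂ) : Prop where
  measurable : Measurable φ
  norm_le : ∀ ξ, ‖φ ξ‖ ≤ K
  norm_sub_le : ∀ ξ ζ, ‖φ (ξ + ζ) - φ ξ‖ ≤
    K * |ζ| * (1 + ζ ^ 2) ^ (m / 2) * (1 + ξ ^ 2) ^ (-m / 2)

theorem IsSlowlyVarying.nonneg {m K : ℝ} {φ : ℝ → ℂ} (h : IsSlowlyVarying m K φ) : 0 ≤ K :=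
  (norm_nonneg _).trans (h.norm_le 0)

/-- The weight `(1 + |ζ|) (1 + ζ²) ^ (m / 2)`. -/
def growthWeight (m ζ : ℝ) : ℝ := (1 + |ζ|) * (1 + ζ ^ 2) ^ (m / 2)

theorem growthWeight_pos (m ζ : ℝ) : 0 < growthWeight m ζ := by
  unfold growthWeight; positivity

@[fun_prop]
theorem measurable_growthWeight (m : ℝ) : Measurable (growthWeight m) := by
  unfold growthWeight; fun_prop

theorem norm_sobolevWeight (t s ξ : ℝ) : ‖sobolevWeight t s ξ‖ = (1 + (t * ξ) ^ 2) ^ (s / 2) := by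
  rw [sobolevWeight, Complex.norm_real, Real.norm_of_nonneg (by positivity)]

@[fun_prop]
theorem measurable_sobolevWeight (t s : ℝ) : Measurable (sobolevWeight t s) := by
  unfold sobolevWeight; fun_prop

theorem norm_sobolevWeight_neg_le_one {m : ℝ} (hm : 0 ≤ m) (t ξ : ℝ) :
    ‖sobolevWeight t (-m) ξ‖ ≤ 1 := by
  rw [norm_sobolevWeight]
  exact Real.rpow_le_one_of_one_le_of_nonpos (by nlinarith [sq_nonneg (t * ξ)]) (by linarith)

theorem memLp_top_sobolevWeight {m : ℝ} (hm : 0 ≤ m) (t : ℝ) :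
    MemLp (sobolevWeight t (-m)) ∞ volume :=
  memLp_top_of_measurable_bounded (by fun_prop) (norm_sobolevWeight_neg_le_one hm t)

/-- The factor t comes from |tζ|. The loss (1 + (tζ)²)^(m/2) is enlarged by t ≤ 1, which makes the
dependence on ζ uniform in t, while the decay in tξ is kept. -/
theorem IsSlowlyVarying.norm_dilation_sub_le {m K t : ℝ} (hm : 0 ≤ m) (ht : 0 < t) (ht1 : t ≤ 1)
    {φ : ℝ → ℂ} (h : IsSlowlyVarying m K φ) (ξ ζ : ℝ) :
    ‖φ (t * (ξ + ζ)) - φ (t * ξ)‖ ≤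
      K * t * (|ζ| * (1 + ζ ^ 2) ^ (m / 2)) * ‖sobolevWeight t (-m) ξ‖ := by
  have h1 := h.norm_sub_le (t * ξ) (t * ζ)
  have hK := h.nonneg
  rw [norm_sobolevWeight, mul_add]
  refine h1.trans ?_
  rw [abs_mul, abs_of_pos ht]
  have h2 : (1 + (t * ζ) ^ 2) ^ (m / 2) ≤ (1 + ζ ^ 2) ^ (m / 2) := by
    apply Real.rpow_le_rpow (by positivity) _ (by positivity)
    have : t ^ 2 ≤ 1 := by nlinarith
    rw [mul_pow]
    nlinarith [sq_nonneg ζ]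
  have e : K * (t * |ζ|) * (1 + (t * ζ) ^ 2) ^ (m / 2) * (1 + (t * ξ) ^ 2) ^ (-m / 2) =
    K * t * (|ζ| * (1 + (t * ζ) ^ 2) ^ (m / 2)) * (1 + (t * ξ) ^ 2) ^ (-m / 2) := by ring
  rw [e]
  gcongr

/-! ### Inequalities for lower integrals -/

theorem lintegral_mul_sq_le {α : Type*} [MeasurableSpace α] {μ : Measure α} {f g : α → ℝ≥0∞}
    (hf : AEMeasurable f μ) (hg : AEMeasurable g μ) :
    (∫⁻ x, f x * g x ∂μ) ^ 2 ≤ (∫⁻ x, f x ^ 2 ∂μ) * ∫⁻ x, g x ^ 2 ∂μ := by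
  have h := ENNReal.lintegral_mul_le_Lp_mul_Lq μ Real.HolderConjugate.two_two hf hg
  have h2 : ∀ a : ℝ≥0∞, (a ^ (1 / 2 : ℝ)) ^ 2 = a := fun a ↦ by
    rw [← ENNReal.rpow_natCast, ← ENNReal.rpow_mul]; norm_num
  have h3 := pow_le_pow_left₀ zero_le h 2
  rw [mul_pow, h2, h2] at h3
  exact_mod_cast h3

/-- Cauchy–Schwarz for the measure f dμ, from the splitting f g = √f · √f g. -/
theorem lintegral_mul_sq_le_weighted {α : Type*} [MeasurableSpace α] {μ : Measure α}
    {f g : α → ℝ≥0∞} (hf : AEMeasurable f μ) (hg : AEMeasurable g μ) :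
    (∫⁻ x, f x * g x ∂μ) ^ 2 ≤ (∫⁻ x, f x ∂μ) * ∫⁻ x, f x * g x ^ 2 ∂μ := by
  have h2 : ∀ a : ℝ≥0∞, (a ^ (1 / 2 : ℝ)) ^ 2 = a := fun a ↦ by
    rw [← ENNReal.rpow_natCast, ← ENNReal.rpow_mul]; norm_num
  have h := lintegral_mul_sq_le (μ := μ) (hf.pow_const (1 / 2 : ℝ))
    ((hf.pow_const (1 / 2 : ℝ)).mul hg)
  simp only [Pi.mul_apply, mul_pow, h2, ← mul_assoc, ← sq] at h
  exact h

theorem enorm_integral_le_lintegral {α : Type*} [MeasurableSpace α] {μ : Measure α} (f : α → ℂ) :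
    ‖∫ x, f x ∂μ‖ₑ ≤ ∫⁻ x, ‖f x‖ₑ ∂μ := enorm_integral_le_lintegral_enorm f

theorem norm_le_of_lintegral_le {u : LTwo} {C : ℝ} (hC : 0 ≤ C) {w : LTwo}
    (h : ∫⁻ x, ‖u x‖ₑ ^ 2 ≤ ENNReal.ofReal C ^ 2 * ∫⁻ x, ‖w x‖ₑ ^ 2) : ‖u‖ ≤ C * ‖w‖ := by
  rw [lintegral_enorm_sq_coeFn, lintegral_enorm_sq_coeFn, ← mul_pow, ← ofReal_norm, ← ofReal_norm,
    ← ENNReal.ofReal_mul hC] at h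
  have h2 := (ENNReal.pow_le_pow_left_iff (by norm_num)).1 h
  exact (ENNReal.ofReal_le_ofReal_iff (by positivity)).1 h2

theorem enorm_le_of_norm_le {z : ℂ} {r : ℝ} (h : ‖z‖ ≤ r) : ‖z‖ₑ ≤ ENNReal.ofReal r := by
  rw [← ofReal_norm]; exact ENNReal.ofReal_le_ofReal h

theorem lintegral_sq_le_of_norm_le {f g : ℝ → ℂ} {C : ℝ} (hC : 0 ≤ C)
    (h : ∀ x, ‖f x‖ ≤ C * ‖g x‖) :
    ∫⁻ x, ‖f x‖ₑ ^ 2 ≤ ENNReal.ofReal C ^ 2 * ∫⁻ x, ‖g x‖ₑ ^ 2 := by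
  rw [← lintegral_const_mul' _ _ (by finiteness)]
  gcongr with x
  rw [← mul_pow]
  gcongr
  refine (enorm_le_of_norm_le (h x)).trans ?_
  rw [ENNReal.ofReal_mul hC, ofReal_norm]

/-! ### The commutator estimate for coefficients with integrable Fourier transform -/

theorem measurable_fourierInv_param {β : Type*} [MeasurableSpace β] {F : β → ℝ → ℂ}
    (hF : Measurable fun p : β × ℝ ↦ F p.1 p.2) :
    Measurable fun p : ℝ × β ↦ 𝓕⁻ (F p.2) p.1 := by
  simp only [fourierInv_apply_eq]
  have h : StronglyMeasurable fun q : (ℝ × β) × ℝ ↦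
      Complex.exp (2 * Real.pi * Complex.I * q.1.1 * q.2) * F q.1.2 q.2 := by
    apply Measurable.stronglyMeasurable
    have : Measurable fun q : (ℝ × β) × ℝ ↦ F q.1.2 q.2 :=
      hF.comp (by fun_prop : Measurable fun q : (ℝ × β) × ℝ ↦ (q.1.2, q.2))
    fun_prop
  exact h.integral_prod_right'.measurable

theorem lintegral_fourierInv_mul_sq_le {ψ g : ℝ → ℂ} {w : ℝ → ℂ} {C : ℝ} (hC : 0 ≤ C)
    (hψ : Measurable ψ) {K : ℝ} (hK : ∀ ξ, ‖ψ ξ‖ ≤ K) (h : ∀ ξ, ‖ψ ξ‖ ≤ C * ‖w ξ‖)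
    (hg : Integrable g) (hg2 : MemLp g 2 volume) :
    ∫⁻ x, ‖𝓕⁻ (fun ξ ↦ ψ ξ * g ξ) x‖ₑ ^ 2 ≤
      ENNReal.ofReal C ^ 2 * ∫⁻ ξ, ‖w ξ * g ξ‖ₑ ^ 2 := by
  have hψ' := memLp_top_of_measurable_bounded hψ hK
  rw [lintegral_enorm_fourierInv_sq]
  · apply lintegral_sq_le_of_norm_le hC fun ξ ↦ ?_
    rw [norm_mul, norm_mul, ← mul_assoc]
    gcongr
    exact h ξ
  · rw [← memLp_one_iff_integrable] at hg ⊢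
    exact hg.mul' hψ'
  · exact hg2.mul' hψ'

theorem lintegral_mulOp_toLp {w g : ℝ → ℂ} (hw : MemLp w ∞ volume) (hg2 : MemLp g 2 volume) :
    ∫⁻ ξ, ‖(mulOp w (hg2.toLp g)) ξ‖ₑ ^ 2 = ∫⁻ ξ, ‖w ξ * g ξ‖ₑ ^ 2 := by
  apply lintegral_congr_ae
  filter_upwards [coeFn_mulOp hw (hg2.toLp g), hg2.coeFn_toLp] with x h1 h2
  rw [h1, h2]

theorem enorm_cexp_two_pi (x ξ : ℝ) :
    ‖Complex.exp (2 * Real.pi * Complex.I * x * ξ)‖ₑ = 1 := by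
  rw [← ofReal_norm, norm_cexp_two_pi]; simp

/-- A form of Minkowski's integral inequality: Cauchy–Schwarz in ζ for the measure r|v| dζ, applied
to |H|/r, followed by Tonelli. The weight r² of the hypothesis on H cancels the factor r⁻². -/
theorem lintegral_enorm_integral_mul_sq_le {v : ℝ → ℂ} {H : ℝ → ℝ → ℂ} {r : ℝ → ℝ≥0∞} {N : ℝ≥0∞}
    (hv : AEStronglyMeasurable v volume) (hHm : Measurable fun p : ℝ × ℝ ↦ H p.1 p.2)
    (hr : Measurable r) (hr0 : ∀ ζ, r ζ ≠ 0) (hrt : ∀ ζ, r ζ ≠ ⊤)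
    (hH : ∀ ζ, ∫⁻ x, ‖H x ζ‖ₑ ^ 2 ≤ r ζ ^ 2 * N) (hfin : ∫⁻ ζ, r ζ * ‖v ζ‖ₑ ≠ ⊤) :
    ∫⁻ x : ℝ, ‖∫ ζ : ℝ, v ζ * (Complex.exp (2 * Real.pi * Complex.I * x * ζ) * H x ζ)‖ₑ ^ 2 ≤
      (∫⁻ ζ, r ζ * ‖v ζ‖ₑ) ^ 2 * N := by
  have hvm := hv.aemeasurable.enorm
  have ham : AEMeasurable (fun ζ ↦ r ζ * ‖v ζ‖ₑ) := hr.aemeasurable.mul hvm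
  have h1 : ∀ x : ℝ, ‖∫ ζ : ℝ, v ζ * (Complex.exp (2 * Real.pi * Complex.I * x * ζ) * H x ζ)‖ₑ ^ 2 ≤
      (∫⁻ ζ, r ζ * ‖v ζ‖ₑ) * ∫⁻ ζ, (r ζ * ‖v ζ‖ₑ) * ((r ζ)⁻¹ * ‖H x ζ‖ₑ) ^ 2 := by
    intro x
    have hHx : Measurable (H x) := hHm.comp (by fun_prop : Measurable fun ζ : ℝ ↦ (x, ζ))
    refine le_trans ?_ (lintegral_mul_sq_le_weighted ham (by fun_prop))
    gcongr
    refine (enorm_integral_le_lintegral _).trans (lintegral_mono fun ζ ↦ le_of_eq ?_)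
    rw [enorm_mul, enorm_mul, enorm_cexp_two_pi, one_mul]
    calc ‖v ζ‖ₑ * ‖H x ζ‖ₑ = (r ζ * (r ζ)⁻¹) * (‖v ζ‖ₑ * ‖H x ζ‖ₑ) := by
          rw [ENNReal.mul_inv_cancel (hr0 ζ) (hrt ζ), one_mul]
      _ = _ := by ring
  have h2 : ∫⁻ x, ∫⁻ ζ, (r ζ * ‖v ζ‖ₑ) * ((r ζ)⁻¹ * ‖H x ζ‖ₑ) ^ 2 =
      ∫⁻ ζ, (r ζ * ‖v ζ‖ₑ) * (r ζ)⁻¹ ^ 2 * ∫⁻ x, ‖H x ζ‖ₑ ^ 2 := by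
    rw [lintegral_lintegral_swap]
    · apply lintegral_congr fun ζ ↦ ?_
      have hHx : Measurable fun x ↦ H x ζ :=
        hHm.comp (by fun_prop : Measurable fun x : ℝ ↦ (x, ζ))
      rw [← lintegral_const_mul _ (by fun_prop)]
      congr 1
      funext x
      ring
    · have h1 : AEMeasurable (fun p : ℝ × ℝ ↦ r p.2 * ‖v p.2‖ₑ) (volume.prod volume) :=
        ham.comp_quasiMeasurePreserving Measure.quasiMeasurePreserving_snd
      have h2 : Measurable fun p : ℝ × ℝ ↦ ((r p.2)⁻¹ * ‖H p.1 p.2‖ₑ) ^ 2 := by fun_prop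
      exact h1.mul h2.aemeasurable
  have h3 : ∀ ζ, (r ζ * ‖v ζ‖ₑ) * (r ζ)⁻¹ ^ 2 * ∫⁻ x, ‖H x ζ‖ₑ ^ 2 ≤ (r ζ * ‖v ζ‖ₑ) * N := by
    intro ζ
    calc _ ≤ (r ζ * ‖v ζ‖ₑ) * (r ζ)⁻¹ ^ 2 * (r ζ ^ 2 * N) := by
          gcongr
          exact hH ζ
      _ = (r ζ * ‖v ζ‖ₑ) * ((r ζ)⁻¹ * r ζ) ^ 2 * N := by ring
      _ = _ := by rw [ENNReal.inv_mul_cancel (hr0 ζ) (hrt ζ)]; ring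
  calc _ ≤ _ := lintegral_mono h1
    _ = _ := by rw [lintegral_const_mul' _ _ hfin, h2]
    _ ≤ (∫⁻ ζ, r ζ * ‖v ζ‖ₑ) * ∫⁻ ζ, (r ζ * ‖v ζ‖ₑ) * N := by
        exact mul_le_mul_right (lintegral_mono h3) _
    _ = _ := by rw [lintegral_mul_const'' _ ham, sq, mul_assoc]

theorem lintegral_fourierInv_increment_sq_le {m K t : ℝ} (hm : 0 ≤ m) (ht : 0 < t) (ht1 : t ≤ 1)
    {φ g : ℝ → ℂ} (hφ : IsSlowlyVarying m K φ) (hg : Integrable g) (hg2 : MemLp g 2 volume)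
    (ζ : ℝ) :
    ∫⁻ x, ‖𝓕⁻ (fun ξ ↦ (φ (t * (ξ + ζ)) - φ (t * ξ)) * g ξ) x‖ₑ ^ 2 ≤
      ENNReal.ofReal (K * t * growthWeight m ζ) ^ 2 *
        ∫⁻ ξ, ‖sobolevWeight t (-m) ξ * g ξ‖ₑ ^ 2 := by
  have hφm := hφ.measurable
  have hK := hφ.nonneg
  have := growthWeight_pos m ζ
  apply lintegral_fourierInv_mul_sq_le (K := K + K) (by positivity) (by fun_prop)
    (fun ξ ↦ (norm_sub_le _ _).trans (add_le_add (hφ.norm_le _) (hφ.norm_le _))) _ hg hg2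
  intro ξ
  refine (hφ.norm_dilation_sub_le hm ht ht1 ξ ζ).trans ?_
  unfold growthWeight
  gcongr
  linarith

theorem measurable_fourierInv_increment {φ g : ℝ → ℂ} (hφ : Measurable φ) (hg : Measurable g)
    (t : ℝ) : Measurable fun p : ℝ × ℝ ↦
      𝓕⁻ (fun ξ ↦ (φ (t * (ξ + p.2)) - φ (t * ξ)) * g ξ) p.1 := by
  apply measurable_fourierInv_param (F := fun ζ ξ ↦ (φ (t * (ξ + ζ)) - φ (t * ξ)) * g ξ)
  fun_prop

theorem lintegral_commutator_eq {φ v g : ℝ → ℂ} (hφ : Measurable φ) {K G : ℝ} (t : ℝ)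
    (hK : ∀ ξ, ‖φ ξ‖ ≤ K) (hv : Integrable v) (hg : Integrable g) (hG : ∀ ξ, ‖g ξ‖ ≤ G)
    (hg2 : MemLp g 2 volume) :
    ∫⁻ x, ‖(fourierMul (fun ξ ↦ φ (t * ξ)) (mulOp (𝓕⁻ v) (𝓕⁻ (hg2.toLp g))) -
      mulOp (𝓕⁻ v) (fourierMul (fun ξ ↦ φ (t * ξ)) (𝓕⁻ (hg2.toLp g))) : LTwo) x‖ₑ ^ 2 =
    ∫⁻ x : ℝ, ‖∫ ζ : ℝ, v ζ * (Complex.exp (2 * Real.pi * Complex.I * x * ζ) *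
        𝓕⁻ (fun ξ ↦ (φ (t * (ξ + ζ)) - φ (t * ξ)) * g ξ) x)‖ₑ ^ 2 := by
  apply lintegral_congr_ae
  filter_upwards [fourierMul_commutator_ae (φ := fun ξ ↦ φ (t * ξ)) (by fun_prop)
    (fun ξ ↦ hK (t * ξ)) hv hg hG hg2] with x hx
  rw [hx]

theorem norm_commutator_le_of_integrable {m K t G : ℝ} (hm : 0 ≤ m) (ht : 0 < t) (ht1 : t ≤ 1)
    {φ v g : ℝ → ℂ} (hφ : IsSlowlyVarying m K φ) (hv : Integrable v)
    (hvw : Integrable fun ζ ↦ growthWeight m ζ * ‖v ζ‖)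
    (hgm : Measurable g) (hg : Integrable g) (hG : ∀ ξ, ‖g ξ‖ ≤ G) (hg2 : MemLp g 2 volume) :
    ‖fourierMul (fun ξ ↦ φ (t * ξ)) (mulOp (𝓕⁻ v) (𝓕⁻ (hg2.toLp g))) -
      mulOp (𝓕⁻ v) (fourierMul (fun ξ ↦ φ (t * ξ)) (𝓕⁻ (hg2.toLp g)))‖ ≤
      (∫ ζ, growthWeight m ζ * ‖v ζ‖) * (K * t) *
        ‖mulOp (sobolevWeight t (-m)) (hg2.toLp g)‖ := by
  have hK := hφ.nonneg
  have hW0 : 0 ≤ ∫ ζ, growthWeight m ζ * ‖v ζ‖ :=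
    integral_nonneg fun ζ ↦ mul_nonneg (growthWeight_pos m ζ).le (norm_nonneg _)
  have hai : ∫⁻ ζ, ENNReal.ofReal (growthWeight m ζ) * ‖v ζ‖ₑ =
      ENNReal.ofReal (∫ ζ, growthWeight m ζ * ‖v ζ‖) := by
    rw [ofReal_integral_eq_lintegral_ofReal hvw (Filter.Eventually.of_forall fun ζ ↦
      mul_nonneg (growthWeight_pos m ζ).le (norm_nonneg _))]
    congr 1
    funext ζ
    rw [ENNReal.ofReal_mul (growthWeight_pos m ζ).le, ofReal_norm]
  have key := lintegral_enorm_integral_mul_sq_le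
    (r := fun ζ ↦ ENNReal.ofReal (growthWeight m ζ))
    (H := fun x ζ ↦ 𝓕⁻ (fun ξ ↦ (φ (t * (ξ + ζ)) - φ (t * ξ)) * g ξ) x)
    (N := ENNReal.ofReal (K * t) ^ 2 * ∫⁻ ξ, ‖sobolevWeight t (-m) ξ * g ξ‖ₑ ^ 2) hv.1
    (measurable_fourierInv_increment hφ.measurable hgm t) (by fun_prop)
    (fun ζ ↦ by simp [growthWeight_pos m ζ]) (fun ζ ↦ ENNReal.ofReal_ne_top) (fun ζ ↦ by
      refine (lintegral_fourierInv_increment_sq_le hm ht ht1 hφ hg hg2 ζ).trans (le_of_eq ?_)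
      rw [ENNReal.ofReal_mul (by positivity), mul_pow, mul_assoc, mul_left_comm])
    (by rw [hai]; exact ENNReal.ofReal_ne_top)
  rw [← lintegral_commutator_eq hφ.measurable t hφ.norm_le hv hg hG hg2, hai,
    ← lintegral_mulOp_toLp (memLp_top_sobolevWeight hm t) hg2, ← mul_assoc, ← mul_pow,
    ← ENNReal.ofReal_mul hW0] at key
  exact norm_le_of_lintegral_le (by positivity) key

/-! ### Difference quotients and weighted bounds for the Fourier transform -/

theorem fourier_apply_eq (g : ℝ → ℂ) (y : ℝ) :
    𝓕 g y = ∫ x : ℝ, Complex.exp (2 * Real.pi * Complex.I * (-y : ℝ) * x) * g x := by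
  have := fourierInv_apply_eq g (-y)
  rwa [Real.fourierInv_eq_fourier_neg, neg_neg] at this

theorem fourier_comp_add_right (u : ℝ → ℂ) (s y : ℝ) :
    𝓕 (fun ζ ↦ u (ζ + s)) y = Complex.exp (2 * Real.pi * Complex.I * s * y) * 𝓕 u y := by
  rw [fourier_apply_eq, fourier_apply_eq, ← integral_const_mul,
    ← integral_add_right_eq_self (fun x : ℝ ↦ Complex.exp (2 * Real.pi * Complex.I * s * y) *
      (Complex.exp (2 * Real.pi * Complex.I * (-y : ℝ) * x) * u x)) s]
  congr 1
  funext ζ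
  rw [← mul_assoc, ← Complex.exp_add]
  congr 2
  push_cast
  ring

theorem measurable_fourier_param {β : Type*} [MeasurableSpace β] {F : β → ℝ → ℂ}
    (hF : Measurable fun p : β × ℝ ↦ F p.1 p.2) :
    Measurable fun p : β × ℝ ↦ 𝓕 (F p.1) p.2 := by
  have h := (measurable_fourierInv_param hF).comp
    (by fun_prop : Measurable fun p : β × ℝ ↦ (-p.2, p.1))
  simpa only [Function.comp_def, Real.fourierInv_eq_fourier_neg, neg_neg] using h

theorem tendsto_norm_exp_sub_one_sq_div (y : ℝ) :
    Filter.Tendsto (fun n : ℕ ↦ (‖Complex.exp (2 * Real.pi * Complex.I *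
      ((1 / ((n : ℝ) + 1) : ℝ)) * y) - 1‖ / (1 / ((n : ℝ) + 1))) ^ 2) Filter.atTop
      (nhds ((2 * Real.pi * y) ^ 2)) := by
  have h1 : HasDerivAt (fun s : ℝ ↦ Complex.exp (2 * Real.pi * Complex.I * s * y))
      (2 * Real.pi * Complex.I * y) 0 := by
    have h2 : HasDerivAt (fun s : ℝ ↦ (2 * Real.pi * Complex.I * s * y : ℂ))
        (2 * Real.pi * Complex.I * y) 0 := by
      have := ((hasDerivAt_id (0 : ℝ)).ofReal_comp.const_mul
        (2 * Real.pi * Complex.I : ℂ)).mul_const (y : ℂ)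
      simpa using this
    have h3 := h2.cexp
    simpa using h3
  have h4 := (hasDerivAt_iff_tendsto_slope_zero.1 h1)
  have h5 : Filter.Tendsto (fun n : ℕ ↦ 1 / ((n : ℝ) + 1)) Filter.atTop
      (nhdsWithin 0 {0}ᶜ) := by
    rw [tendsto_nhdsWithin_iff]
    refine ⟨tendsto_one_div_add_atTop_nhds_zero_nat, Filter.Eventually.of_forall fun n ↦ ?_⟩
    simp only [Set.mem_compl_iff, Set.mem_singleton_iff]
    positivity
  have h6 := ((h4.comp h5).norm).pow 2
  have e : ‖(2 * Real.pi * Complex.I * y : ℂ)‖ ^ 2 = (2 * Real.pi * y) ^ 2 := by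
    simp [mul_pow]
  rw [e] at h6
  refine h6.congr fun n ↦ ?_
  simp only [Function.comp_apply, zero_add, norm_smul, norm_inv, Complex.ofReal_zero, mul_zero,
    zero_mul, Complex.exp_zero]
  rw [Real.norm_of_nonneg (by positivity), div_eq_inv_mul _ (1 / ((n : ℝ) + 1))]

/-- Translation by s multiplies the Fourier transform by exp(2πisy), so by Plancherel the hypothesis
controls |exp(2πisy) - 1|²/s² against |𝓕 u|². As s → 0 this factor tends to (2πy)², and Fatou in y
and then in the parameter x keeps the bound. No derivative of u has to exist beforehand, and the
bound is only needed after integration over x. -/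
theorem lintegral_sq_mul_fourier_le {α : Type*} [MeasurableSpace α] {μ : Measure α}
    {u : α → ℝ → ℂ} (hu : Measurable fun p : α × ℝ ↦ u p.1 p.2)
    (h1 : ∀ x, Integrable (u x)) (h2 : ∀ x, MemLp (u x) 2 volume) {M : ℝ≥0∞}
    (hM : ∀ s : ℝ, 0 < s → s ≤ 1 →
      ∫⁻ x, (∫⁻ ζ, ‖u x (ζ + s) - u x ζ‖ₑ ^ 2) ∂μ ≤ ENNReal.ofReal s ^ 2 * M) :
    ∫⁻ x, (∫⁻ y, ENNReal.ofReal ((2 * Real.pi * y) ^ 2) * ‖𝓕 (u x) y‖ₑ ^ 2) ∂μ ≤ M := by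
  obtain ⟨s, hs⟩ : ∃ s : ℕ → ℝ, s = fun n : ℕ ↦ 1 / ((n : ℝ) + 1) := ⟨_, rfl⟩
  have hs0 : ∀ n, 0 < s n := fun n ↦ by simp only [hs]; positivity
  have hs1 : ∀ n, s n ≤ 1 := fun n ↦ by
    simp only [hs]
    rw [div_le_one (by positivity)]
    have : (0 : ℝ) ≤ n := by positivity
    linarith
  obtain ⟨q, hq⟩ : ∃ q : ℕ → ℝ → ℝ, q = fun (n : ℕ) (y : ℝ) ↦
    (‖Complex.exp (2 * Real.pi * Complex.I * (s n) * y) - 1‖ / s n) ^ 2 := ⟨_, rfl⟩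
  have hqm : ∀ n, Measurable (q n) := fun n ↦ by simp only [hq]; fun_prop
  have hFm := measurable_fourier_param hu
  obtain ⟨F, hF⟩ : ∃ F : ℕ → α → ℝ → ℝ≥0∞,
    F = fun n x y ↦ ENNReal.ofReal (q n y) * ‖𝓕 (u x) y‖ₑ ^ 2 := ⟨_, rfl⟩
  have hFm' : ∀ n, Measurable fun p : α × ℝ ↦ F n p.1 p.2 := fun n ↦ by
    simp only [hF]
    have := hqm n
    fun_prop
  have hlim : ∀ x y, ENNReal.ofReal ((2 * Real.pi * y) ^ 2) * ‖𝓕 (u x) y‖ₑ ^ 2 =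
      Filter.liminf (fun n ↦ F n x y) Filter.atTop := by
    intro x y
    refine (Filter.Tendsto.liminf_eq ?_).symm
    simp only [hF, hq, hs]
    exact ENNReal.Tendsto.mul_const
      ((ENNReal.continuous_ofReal.tendsto _).comp (tendsto_norm_exp_sub_one_sq_div y))
      (Or.inr (by finiteness))
  have hFs : ∀ n x, ∫⁻ y, F n x y =
      (ENNReal.ofReal (s n) ^ 2)⁻¹ * ∫⁻ ζ, ‖u x (ζ + s n) - u x ζ‖ₑ ^ 2 := by
    intro n x
    have ht1 : Integrable fun ζ ↦ u x (ζ + s n) := (h1 x).comp_add_right (s n)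
    have ht2 : MemLp (fun ζ ↦ u x (ζ + s n)) 2 volume :=
      (h2 x).comp_measurePreserving (measurePreserving_add_right volume (s n))
    have hp : ∫⁻ y, ‖𝓕 (fun ζ ↦ u x (ζ + s n) - u x ζ) y‖ₑ ^ 2 =
        ∫⁻ ζ, ‖u x (ζ + s n) - u x ζ‖ₑ ^ 2 :=
      lintegral_enorm_fourier_sq (ht1.sub (h1 x)) (ht2.sub (h2 x))
    rw [← hp, ← lintegral_const_mul' _ _ (by simp [hs0 n])]
    apply lintegral_congr fun y ↦ ?_
    have e1 : 𝓕 (fun ζ ↦ u x (ζ + s n) - u x ζ) y =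
        (Complex.exp (2 * Real.pi * Complex.I * (s n) * y) - 1) * 𝓕 (u x) y := by
      have e2 : 𝓕 (fun ζ ↦ u x (ζ + s n) - u x ζ) y =
          𝓕 (fun ζ ↦ u x (ζ + s n)) y - 𝓕 (u x) y := by
        simp only [Real.fourier_eq]
        rw [← integral_sub]
        · congr 1; funext v; rw [smul_sub]
        · exact (Real.fourierIntegral_convergent_iff y).2 ht1
        · exact (Real.fourierIntegral_convergent_iff y).2 (h1 x)
      rw [e2, fourier_comp_add_right]
      ring
    rw [e1, enorm_mul, mul_pow, ← mul_assoc]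
    simp only [hF, hq]
    congr 1
    rw [ENNReal.ofReal_pow (by have := hs0 n; positivity), ENNReal.ofReal_div_of_pos (hs0 n),
      ofReal_norm, ENNReal.div_eq_inv_mul, mul_pow, ENNReal.inv_pow]
  have hFM : ∀ n, ∫⁻ x, (∫⁻ y, F n x y) ∂μ ≤ M := by
    intro n
    have hne : (ENNReal.ofReal (s n) ^ 2)⁻¹ ≠ ⊤ := by simp [hs0 n]
    rw [lintegral_congr (hFs n), lintegral_const_mul' _ _ hne]
    refine (mul_le_mul_right (hM (s n) (hs0 n) (hs1 n)) _).trans (le_of_eq ?_)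
    rw [← mul_assoc, ENNReal.inv_mul_cancel, one_mul]
    · simp [hs0 n]
    · finiteness
  calc ∫⁻ x, (∫⁻ y, ENNReal.ofReal ((2 * Real.pi * y) ^ 2) * ‖𝓕 (u x) y‖ₑ ^ 2) ∂μ
      = ∫⁻ x, (∫⁻ y, Filter.liminf (fun n ↦ F n x y) Filter.atTop) ∂μ := by simp only [hlim]
    _ ≤ ∫⁻ x, Filter.liminf (fun n ↦ ∫⁻ y, F n x y) Filter.atTop ∂μ := by
        gcongr with x
        exact lintegral_liminf_le fun n ↦ (hFm' n).comp (by fun_prop : Measurable fun y : ℝ ↦ (x, y))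
    _ ≤ Filter.liminf (fun n ↦ ∫⁻ x, (∫⁻ y, F n x y) ∂μ) Filter.atTop :=
        lintegral_liminf_le fun n ↦ (hFm' n).lintegral_prod_right'
    _ ≤ M := Filter.liminf_le_of_frequently_le' (Filter.Frequently.of_forall hFM)

/-- Cauchy–Schwarz against the density (1 + y²)⁻¹ of total mass π. Applied to f = 𝓕 u, it says that
H¹ functions have integrable Fourier transforms. -/
theorem lintegral_enorm_sq_le_weighted {f : ℝ → ℂ} (hf : Measurable f) :
    (∫⁻ y, ‖f y‖ₑ) ^ 2 ≤ ENNReal.ofReal Real.pi *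
      ∫⁻ y, ENNReal.ofReal (1 + y ^ 2) * ‖f y‖ₑ ^ 2 := by
  have h1 : ∫⁻ y : ℝ, ENNReal.ofReal ((1 + y ^ 2)⁻¹) = ENNReal.ofReal Real.pi := by
    rw [← integral_univ_inv_one_add_sq, ofReal_integral_eq_lintegral_ofReal]
    · exact integrable_inv_one_add_sq
    · exact Filter.Eventually.of_forall fun y ↦ by simp only [Pi.zero_apply]; positivity
  have h := lintegral_mul_sq_le_weighted (μ := (volume : Measure ℝ))
    (f := fun y ↦ ENNReal.ofReal ((1 + y ^ 2)⁻¹))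
    (g := fun y ↦ ENNReal.ofReal (1 + y ^ 2) * ‖f y‖ₑ) (by fun_prop) (by fun_prop)
  rw [h1] at h
  have e : ∀ y : ℝ, ENNReal.ofReal ((1 + y ^ 2)⁻¹) * ENNReal.ofReal (1 + y ^ 2) = 1 := fun y ↦ by
    rw [← ENNReal.ofReal_mul (by positivity), inv_mul_cancel₀ (by positivity)]; simp
  convert h using 2
  · congr 1
    funext y
    rw [← mul_assoc, e, one_mul]
  · congr 1
    funext y
    calc _ = ENNReal.ofReal (1 + y ^ 2) * ‖f y‖ₑ ^ 2 *
          (ENNReal.ofReal ((1 + y ^ 2)⁻¹) * ENNReal.ofReal (1 + y ^ 2)) := by rw [e, mul_one]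
      _ = _ := by ring

/-! ### The commutator estimate for coefficients with bounded derivatives -/

/-- The symbol `(1 + 2πiζ)⁻ᴺ` of the inverse of `(1 + d/dx)ᴺ`. -/
def resolventPow (N : ℕ) (ζ : ℝ) : ℂ := ((1 + 2 * Real.pi * Complex.I * ζ)⁻¹) ^ N

theorem normSq_one_add_two_pi_mul (ζ : ℝ) :
    ‖(1 + 2 * Real.pi * Complex.I * ζ : ℂ)‖ ^ 2 = 1 + (2 * Real.pi * ζ) ^ 2 := by
  have : (1 + 2 * Real.pi * Complex.I * ζ : ℂ) = ((1 : ℝ) : ℂ) + ((2 * Real.pi * ζ : ℝ) : ℂ) * Complex.I := by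
    push_cast; ring
  rw [this, ← Complex.normSq_eq_norm_sq, Complex.normSq_add_mul_I, one_pow]

theorem one_add_two_pi_mul_ne_zero (ζ : ℝ) : (1 + 2 * Real.pi * Complex.I * ζ : ℂ) ≠ 0 := by
  intro h
  have := normSq_one_add_two_pi_mul ζ
  rw [h, norm_zero] at this
  nlinarith [sq_nonneg (2 * Real.pi * ζ)]

theorem norm_inv_one_add_two_pi_le (ζ : ℝ) :
    ‖(1 + 2 * Real.pi * Complex.I * ζ : ℂ)⁻¹‖ ≤ (1 + ζ ^ 2) ^ (-(1 / 2) : ℝ) := by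
  rw [norm_inv, Real.rpow_neg (by positivity), ← Real.sqrt_eq_rpow]
  apply inv_anti₀ (by positivity)
  refine Real.sqrt_le_iff.2 ⟨norm_nonneg _, ?_⟩
  rw [normSq_one_add_two_pi_mul, mul_pow]
  have : 1 ≤ (2 * Real.pi) ^ 2 := by nlinarith [Real.pi_gt_three]
  nlinarith [sq_nonneg ζ]

theorem norm_inv_one_add_two_pi_le_one (ζ : ℝ) :
    ‖(1 + 2 * Real.pi * Complex.I * ζ : ℂ)⁻¹‖ ≤ 1 :=
  (norm_inv_one_add_two_pi_le ζ).trans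
    (Real.rpow_le_one_of_one_le_of_nonpos (by nlinarith [sq_nonneg ζ]) (by norm_num))

/-- Peetre's inequality. -/
theorem one_add_sq_rpow_peetre {a : ℝ} (ha : 0 ≤ a) (x y : ℝ) :
    (1 + (x + y) ^ 2) ^ (-a) ≤ 2 ^ a * (1 + y ^ 2) ^ a * (1 + x ^ 2) ^ (-a) := by
  rw [Real.rpow_neg (by positivity), Real.rpow_neg (by positivity), ← div_eq_mul_inv,
    le_div_iff₀ (by positivity), inv_mul_le_iff₀ (by positivity),
    ← Real.mul_rpow (by positivity) (by positivity), ← Real.mul_rpow (by positivity) (by positivity)]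
  apply Real.rpow_le_rpow (by positivity) _ ha
  nlinarith [sq_nonneg (x + 2 * y), sq_nonneg ((x + y) * y)]

/-- Peetre's inequality with exponent 1/2; its constant √2 · √(1 + s²) is at most 2 for s ≤ 1. -/
theorem norm_inv_one_add_two_pi_add_le {ζ s : ℝ} (hs : 0 < s) (hs1 : s ≤ 1) :
    ‖(1 + 2 * Real.pi * Complex.I * (ζ + s : ℝ) : ℂ)⁻¹‖ ≤ 2 * (1 + ζ ^ 2) ^ (-(1 / 2) : ℝ) := by
  refine (norm_inv_one_add_two_pi_le _).trans ?_
  refine (one_add_sq_rpow_peetre (by norm_num) ζ s).trans ?_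
  gcongr
  rw [← Real.mul_rpow (by norm_num) (by positivity), ← Real.sqrt_eq_rpow]
  rw [Real.sqrt_le_left (by norm_num)]
  nlinarith

/-- Telescoping. The hypothesis has c r rather than c on the right, so that the difference of the
powers keeps the full decay rᴺ. -/
theorem norm_pow_sub_pow_le {a b : ℂ} {r c : ℝ} (hr : 0 ≤ r) (hc : 0 ≤ c) (ha : ‖a‖ ≤ r)
    (hb : ‖b‖ ≤ r) (hab : ‖a - b‖ ≤ c * r) (N : ℕ) : ‖a ^ N - b ^ N‖ ≤ N * c * r ^ N := by
  induction N with
  | zero => simp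
  | succ N ih =>
    have e : a ^ (N + 1) - b ^ (N + 1) = a * (a ^ N - b ^ N) + (a - b) * b ^ N := by ring
    rw [e]
    refine (norm_add_le _ _).trans ?_
    rw [norm_mul, norm_mul, norm_pow]
    calc _ ≤ r * (N * c * r ^ N) + c * r * r ^ N := by gcongr
      _ = _ := by push_cast; ring

theorem norm_resolventPow_le (N : ℕ) (ζ : ℝ) :
    ‖resolventPow N ζ‖ ≤ (1 + ζ ^ 2) ^ (-(N / 2) : ℝ) := by
  rw [resolventPow, norm_pow]
  refine (pow_le_pow_left₀ (norm_nonneg _) (norm_inv_one_add_two_pi_le ζ) N).trans (le_of_eq ?_)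
  rw [← Real.rpow_natCast, ← Real.rpow_mul (by positivity)]
  congr 1
  ring

theorem norm_resolventPow_le_one (N : ℕ) (ζ : ℝ) : ‖resolventPow N ζ‖ ≤ 1 := by
  rw [resolventPow, norm_pow]
  exact pow_le_one₀ (norm_nonneg _) (norm_inv_one_add_two_pi_le_one ζ)

theorem norm_resolventPow_add_le (N : ℕ) {ζ s : ℝ} (hs : 0 < s) (hs1 : s ≤ 1) :
    ‖resolventPow N (ζ + s)‖ ≤ 2 ^ N * (1 + ζ ^ 2) ^ (-(N / 2) : ℝ) := by
  rw [resolventPow, norm_pow]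
  refine (pow_le_pow_left₀ (norm_nonneg _) (norm_inv_one_add_two_pi_add_le hs hs1) N).trans
    (le_of_eq ?_)
  rw [mul_pow, ← Real.rpow_natCast ((1 + ζ ^ 2) ^ _), ← Real.rpow_mul (by positivity)]
  congr 2
  ring

theorem norm_resolventPow_add_sub_le (N : ℕ) {ζ s : ℝ} (hs : 0 < s) (hs1 : s ≤ 1) :
    ‖resolventPow N (ζ + s) - resolventPow N ζ‖ ≤
      N * (2 * Real.pi * s) * (2 ^ N * (1 + ζ ^ 2) ^ (-(N / 2) : ℝ)) := by
  have hr : 0 ≤ 2 * (1 + ζ ^ 2) ^ (-(1 / 2) : ℝ) := by positivity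
  have hb := norm_inv_one_add_two_pi_le ζ
  have hp : 0 ≤ (1 + ζ ^ 2) ^ (-(1 / 2) : ℝ) := by positivity
  have hpi := Real.pi_pos
  have h := norm_pow_sub_pow_le (c := 2 * Real.pi * s) hr (by positivity)
    (norm_inv_one_add_two_pi_add_le hs hs1) (hb.trans (by linarith)) (b := (1 + 2 * Real.pi * Complex.I * ζ)⁻¹) ?_ N
  · refine h.trans (le_of_eq ?_)
    rw [mul_pow, ← Real.rpow_natCast ((1 + ζ ^ 2) ^ _), ← Real.rpow_mul (by positivity)]
    congr 3
    ring
  -- Resolvent identity: the difference of the inverses is 2πs times their product in modulus. One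
  -- factor is bounded by one and the other keeps its decay.
  · rw [inv_sub_inv (one_add_two_pi_mul_ne_zero _) (one_add_two_pi_mul_ne_zero _), div_eq_mul_inv,
      mul_inv, norm_mul, norm_mul]
    have e : ‖(1 + 2 * Real.pi * Complex.I * ζ - (1 + 2 * Real.pi * Complex.I * (ζ + s : ℝ)) : ℂ)‖ =
        2 * Real.pi * s := by
      have : (1 + 2 * Real.pi * Complex.I * ζ - (1 + 2 * Real.pi * Complex.I * (ζ + s : ℝ)) : ℂ) =
        ((-(2 * Real.pi * s) : ℝ) : ℂ) * Complex.I := by push_cast; ring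
      rw [this, norm_mul, Complex.norm_I, mul_one, Complex.norm_real, norm_neg,
        Real.norm_of_nonneg (by positivity)]
    rw [e]
    refine mul_le_mul_of_nonneg_left ?_ (by positivity)
    calc _ ≤ 1 * (1 + ζ ^ 2) ^ (-(1 / 2) : ℝ) :=
          mul_le_mul (norm_inv_one_add_two_pi_le_one _) hb (norm_nonneg _) zero_le_one
      _ ≤ _ := by linarith

theorem norm_sobolevWeight_add_le {m t : ℝ} (hm : 0 ≤ m) (ht : 0 < t) (ht1 : t ≤ 1) (ξ ζ : ℝ) :
    ‖sobolevWeight t (-m) (ξ + ζ)‖ ≤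
      2 ^ (m / 2) * (1 + ζ ^ 2) ^ (m / 2) * ‖sobolevWeight t (-m) ξ‖ := by
  rw [norm_sobolevWeight, norm_sobolevWeight, neg_div, mul_add]
  refine (one_add_sq_rpow_peetre (by positivity) _ _).trans ?_
  gcongr 2 ^ (m / 2) * ?_ ^ (m / 2) * _
  have : t ^ 2 ≤ 1 := by nlinarith
  rw [mul_pow]
  nlinarith [sq_nonneg ζ]

theorem abs_mul_one_add_sq_rpow_le {m : ℝ} (ζ : ℝ) :
    |ζ| * (1 + ζ ^ 2) ^ (m / 2) ≤ (1 + ζ ^ 2) ^ ((m + 1) / 2) := by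
  have h : |ζ| ≤ (1 + ζ ^ 2) ^ (1 / 2 : ℝ) := by
    rw [← Real.sqrt_eq_rpow]
    exact Real.abs_le_sqrt (by linarith)
  calc _ ≤ (1 + ζ ^ 2) ^ (1 / 2 : ℝ) * (1 + ζ ^ 2) ^ (m / 2) := by gcongr
    _ = _ := by rw [← Real.rpow_add (by positivity)]; ring_nf

/-- `(1 + ζ²) ^ ((m + 1 - N) / 2)`. -/
def decayWeight (m : ℝ) (N : ℕ) (ζ : ℝ) : ℝ := (1 + ζ ^ 2) ^ ((m + 1 - N) / 2)

theorem decayWeight_pos (m : ℝ) (N : ℕ) (ζ : ℝ) : 0 < decayWeight m N ζ := by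
  unfold decayWeight; positivity

/-- The multiplier that appears in the commutator with a coefficient of modulation `ζ`. -/
def commutatorSymbol (N : ℕ) (φ : ℝ → ℂ) (t ζ ξ : ℝ) : ℂ :=
  resolventPow N ζ * (φ (t * (ξ + ζ)) - φ (t * ξ))

theorem norm_commutatorSymbol_le {m K t : ℝ} (hm : 0 ≤ m) (ht : 0 < t) (ht1 : t ≤ 1) {φ : ℝ → ℂ}
    (hφ : IsSlowlyVarying m K φ) (N : ℕ) (ζ ξ : ℝ) :
    ‖commutatorSymbol N φ t ζ ξ‖ ≤ K * t * decayWeight m N ζ * ‖sobolevWeight t (-m) ξ‖ := by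
  have hK := hφ.nonneg
  rw [commutatorSymbol, norm_mul]
  calc _ ≤ (1 + ζ ^ 2) ^ (-(N / 2) : ℝ) *
        (K * t * (1 + ζ ^ 2) ^ ((m + 1) / 2) * ‖sobolevWeight t (-m) ξ‖) := by
        gcongr
        · exact norm_resolventPow_le N ζ
        · refine (hφ.norm_dilation_sub_le hm ht ht1 ξ ζ).trans ?_
          gcongr
          exact abs_mul_one_add_sq_rpow_le ζ
    _ = K * t * ((1 + ζ ^ 2) ^ (-(N / 2) : ℝ) * (1 + ζ ^ 2) ^ ((m + 1) / 2)) *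
        ‖sobolevWeight t (-m) ξ‖ := by ring
    _ = _ := by
        rw [← Real.rpow_add (by positivity), decayWeight]
        congr 3
        ring

/-- The constant in the bound for increments of `commutatorSymbol`. -/
def commutatorConst (m : ℝ) (N : ℕ) : ℝ := 2 ^ N * (2 ^ (m / 2) * 2 ^ (m / 2)) +
  N * (2 * Real.pi) * 2 ^ N

theorem commutatorConst_nonneg (m : ℝ) (N : ℕ) : 0 ≤ commutatorConst m N := by
  have := Real.pi_pos
  unfold commutatorConst; positivity

/-- A discrete Leibniz rule. When φ moves, its increment starts from ξ + ζ, and Peetre's inequality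
returns the weight to ξ at the price (1 + ζ²)^(m/2). When the resolvent factor moves, it keeps its
decay of order N. The increment in ζ therefore decays as fast as the symbol itself, which gives H¹
regularity in ζ. -/
theorem norm_commutatorSymbol_add_sub_le {m K t : ℝ} (hm : 0 ≤ m) (ht : 0 < t) (ht1 : t ≤ 1)
    {φ : ℝ → ℂ} (hφ : IsSlowlyVarying m K φ) (N : ℕ) {s : ℝ} (hs : 0 < s) (hs1 : s ≤ 1)
    (ζ ξ : ℝ) :
    ‖commutatorSymbol N φ t (ζ + s) ξ - commutatorSymbol N φ t ζ ξ‖ ≤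
      s * (commutatorConst m N * (K * t) * decayWeight m N ζ) * ‖sobolevWeight t (-m) ξ‖ := by
  have hK := hφ.nonneg
  have hpi := Real.pi_pos
  have e : commutatorSymbol N φ t (ζ + s) ξ - commutatorSymbol N φ t ζ ξ =
      resolventPow N (ζ + s) * (φ (t * ((ξ + ζ) + s)) - φ (t * (ξ + ζ))) +
      (resolventPow N (ζ + s) - resolventPow N ζ) * (φ (t * (ξ + ζ)) - φ (t * ξ)) := by
    unfold commutatorSymbol
    rw [add_assoc]
    ring
  rw [e]
  refine (norm_add_le _ _).trans ?_
  rw [norm_mul, norm_mul]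
  have h1 : ‖φ (t * ((ξ + ζ) + s)) - φ (t * (ξ + ζ))‖ ≤ K * t * (s * 2 ^ (m / 2)) *
      (2 ^ (m / 2) * (1 + ζ ^ 2) ^ (m / 2) * ‖sobolevWeight t (-m) ξ‖) := by
    refine (hφ.norm_dilation_sub_le hm ht ht1 (ξ + ζ) s).trans ?_
    rw [abs_of_pos hs]
    gcongr
    · nlinarith
    · exact norm_sobolevWeight_add_le hm ht ht1 ξ ζ
  have h2 : ‖φ (t * (ξ + ζ)) - φ (t * ξ)‖ ≤
      K * t * (1 + ζ ^ 2) ^ ((m + 1) / 2) * ‖sobolevWeight t (-m) ξ‖ := by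
    refine (hφ.norm_dilation_sub_le hm ht ht1 ξ ζ).trans ?_
    gcongr
    exact abs_mul_one_add_sq_rpow_le ζ
  have h3 : (1 + ζ ^ 2) ^ (m / 2) ≤ (1 + ζ ^ 2) ^ ((m + 1) / 2) :=
    Real.rpow_le_rpow_of_exponent_le (by nlinarith [sq_nonneg ζ]) (by linarith)
  have h4 : decayWeight m N ζ = (1 + ζ ^ 2) ^ (-(N / 2) : ℝ) * (1 + ζ ^ 2) ^ ((m + 1) / 2) := by
    rw [← Real.rpow_add (by positivity), decayWeight]
    congr 1
    ring
  rw [h4]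
  calc _ ≤ (2 ^ N * (1 + ζ ^ 2) ^ (-(N / 2) : ℝ)) * (K * t * (s * 2 ^ (m / 2)) *
        (2 ^ (m / 2) * (1 + ζ ^ 2) ^ ((m + 1) / 2) * ‖sobolevWeight t (-m) ξ‖)) +
        (N * (2 * Real.pi * s) * (2 ^ N * (1 + ζ ^ 2) ^ (-(N / 2) : ℝ))) *
        (K * t * (1 + ζ ^ 2) ^ ((m + 1) / 2) * ‖sobolevWeight t (-m) ξ‖) := by
        gcongr
        · exact norm_resolventPow_add_le N hs hs1
        · refine h1.trans ?_
          gcongr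
        · exact norm_resolventPow_add_sub_le N hs hs1
    _ = _ := by unfold commutatorConst; ring

theorem measurable_resolventPow (N : ℕ) : Measurable (resolventPow N) := by
  unfold resolventPow; fun_prop

theorem measurable_commutatorSymbol {φ : ℝ → ℂ} (hφ : Measurable φ) (N : ℕ) (t : ℝ) :
    Measurable fun p : ℝ × ℝ ↦ commutatorSymbol N φ t p.1 p.2 := by
  have := measurable_resolventPow N
  unfold commutatorSymbol; fun_prop

theorem measurable_commutatorSymbol_right {φ : ℝ → ℂ} (hφ : Measurable φ) (N : ℕ) (t ζ : ℝ) :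
    Measurable (commutatorSymbol N φ t ζ) := by
  unfold commutatorSymbol; fun_prop

theorem norm_commutatorSymbol_le_bound {φ : ℝ → ℂ} {K : ℝ} (hK : ∀ ξ, ‖φ ξ‖ ≤ K) (N : ℕ)
    (t ζ ξ : ℝ) : ‖commutatorSymbol N φ t ζ ξ‖ ≤ ‖resolventPow N ζ‖ * (K + K) := by
  rw [commutatorSymbol, norm_mul]
  gcongr
  exact (norm_sub_le _ _).trans (add_le_add (hK _) (hK _))

theorem integrable_resolventPow {N : ℕ} (hN : 2 ≤ N) : Integrable fun ζ ↦ ‖resolventPow N ζ‖ := by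
  refine integrable_inv_one_add_sq.mono' (measurable_resolventPow N).norm.aestronglyMeasurable
    (Filter.Eventually.of_forall fun ζ ↦ ?_)
  rw [norm_norm]
  refine (norm_resolventPow_le N ζ).trans ?_
  rw [← Real.rpow_neg_one]
  apply Real.rpow_le_rpow_of_exponent_le (by nlinarith [sq_nonneg ζ])
  have : (2 : ℝ) ≤ N := by exact_mod_cast hN
  linarith

/-- The modulated multiplier applied to `𝓕⁻ g`. -/
def commutatorKernel (N : ℕ) (φ g : ℝ → ℂ) (t x ζ : ℝ) : ℂ :=
  𝓕⁻ (fun ξ ↦ commutatorSymbol N φ t ζ ξ * g ξ) x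

theorem commutatorKernel_eq (N : ℕ) (φ g : ℝ → ℂ) (t x ζ : ℝ) :
    commutatorKernel N φ g t x ζ =
      resolventPow N ζ * 𝓕⁻ (fun ξ ↦ (φ (t * (ξ + ζ)) - φ (t * ξ)) * g ξ) x := by
  rw [commutatorKernel, fourierInv_apply_eq, fourierInv_apply_eq, ← integral_const_mul]
  congr 1
  funext ξ
  unfold commutatorSymbol
  ring

theorem measurable_commutatorKernel {φ g : ℝ → ℂ} (hφ : Measurable φ) (hg : Measurable g) (N : ℕ)
    (t : ℝ) : Measurable fun p : ℝ × ℝ ↦ commutatorKernel N φ g t p.1 p.2 := by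
  apply measurable_fourierInv_param (F := fun ζ ξ ↦ commutatorSymbol N φ t ζ ξ * g ξ)
  have := measurable_commutatorSymbol hφ N t
  fun_prop

theorem measurable_commutatorKernel_add {φ g : ℝ → ℂ} (hφ : Measurable φ) (hg : Measurable g)
    (N : ℕ) (t s : ℝ) :
    Measurable fun p : ℝ × ℝ ↦ commutatorKernel N φ g t p.1 (p.2 + s) := by
  apply measurable_fourierInv_param (F := fun ζ ξ ↦ commutatorSymbol N φ t (ζ + s) ξ * g ξ)
  have := measurable_resolventPow N
  unfold commutatorSymbol
  fun_prop

theorem norm_commutatorKernel_le {φ g : ℝ → ℂ} {K : ℝ} (hK : ∀ ξ, ‖φ ξ‖ ≤ K) (hg : Integrable g)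
    (N : ℕ) (t x ζ : ℝ) :
    ‖commutatorKernel N φ g t x ζ‖ ≤ ‖resolventPow N ζ‖ * ((K + K) * ∫ ξ, ‖g ξ‖) := by
  rw [commutatorKernel, fourierInv_apply_eq, ← mul_assoc, ← integral_const_mul]
  refine norm_integral_le_of_norm_le (hg.norm.const_mul _) (Filter.Eventually.of_forall fun ξ ↦ ?_)
  rw [norm_mul, norm_cexp_two_pi, one_mul, norm_mul]
  gcongr
  exact norm_commutatorSymbol_le_bound hK N t ζ ξ

theorem integrable_commutatorKernel {φ g : ℝ → ℂ} (hφ : Measurable φ) (hg : Measurable g) {K : ℝ}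
    (hK : ∀ ξ, ‖φ ξ‖ ≤ K) (hg1 : Integrable g) {N : ℕ} (hN : 2 ≤ N) (t x : ℝ) :
    Integrable (commutatorKernel N φ g t x) := by
  refine ((integrable_resolventPow hN).mul_const ((K + K) * ∫ ξ, ‖g ξ‖)).mono' ?_
    (Filter.Eventually.of_forall fun ζ ↦ norm_commutatorKernel_le hK hg1 N t x ζ)
  exact ((measurable_commutatorKernel hφ hg N t).comp
    (by fun_prop : Measurable fun ζ : ℝ ↦ (x, ζ))).aestronglyMeasurable

theorem memLp_commutatorKernel {φ g : ℝ → ℂ} (hφ : Measurable φ) (hg : Measurable g) {K : ℝ}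
    (hK : ∀ ξ, ‖φ ξ‖ ≤ K) (hg1 : Integrable g) {N : ℕ} (hN : 2 ≤ N) (t x : ℝ) :
    MemLp (commutatorKernel N φ g t x) 2 volume := by
  have hK0 : 0 ≤ K := (norm_nonneg _).trans (hK 0)
  refine memLp_two_of_integrable_of_bounded (integrable_commutatorKernel hφ hg hK hg1 hN t x)
    (G := 1 * ((K + K) * ∫ ξ, ‖g ξ‖)) fun ζ ↦ (norm_commutatorKernel_le hK hg1 N t x ζ).trans ?_
  have : 0 ≤ ∫ ξ, ‖g ξ‖ := integral_nonneg fun _ ↦ norm_nonneg _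
  gcongr
  exact norm_resolventPow_le_one N ζ

theorem lintegral_commutatorKernel_sq_le {m K t : ℝ} (hm : 0 ≤ m) (ht : 0 < t) (ht1 : t ≤ 1)
    {φ g : ℝ → ℂ} (hφ : IsSlowlyVarying m K φ) (hg1 : Integrable g) (hg2 : MemLp g 2 volume)
    (N : ℕ) (ζ : ℝ) :
    ∫⁻ x, ‖commutatorKernel N φ g t x ζ‖ₑ ^ 2 ≤
      ENNReal.ofReal (K * t * decayWeight m N ζ) ^ 2 *
        ∫⁻ ξ, ‖sobolevWeight t (-m) ξ * g ξ‖ₑ ^ 2 := by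
  have hK := hφ.nonneg
  have hd := decayWeight_pos m N ζ
  unfold commutatorKernel
  exact lintegral_fourierInv_mul_sq_le (ψ := commutatorSymbol N φ t ζ)
    (w := sobolevWeight t (-m)) (C := K * t * decayWeight m N ζ) (by positivity)
    (measurable_commutatorSymbol_right hφ.measurable N t ζ)
    (norm_commutatorSymbol_le_bound hφ.norm_le N t ζ)
    (norm_commutatorSymbol_le hm ht ht1 hφ N ζ) hg1 hg2

theorem lintegral_commutatorKernel_add_sub_sq_le {m K t : ℝ} (hm : 0 ≤ m) (ht : 0 < t)
    (ht1 : t ≤ 1) {φ g : ℝ → ℂ} (hφ : IsSlowlyVarying m K φ) (hg1 : Integrable g)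
    (hg2 : MemLp g 2 volume) (N : ℕ) {s : ℝ} (hs : 0 < s) (hs1 : s ≤ 1) (ζ : ℝ) :
    ∫⁻ x, ‖commutatorKernel N φ g t x (ζ + s) - commutatorKernel N φ g t x ζ‖ₑ ^ 2 ≤
      ENNReal.ofReal (s * (commutatorConst m N * (K * t) * decayWeight m N ζ)) ^ 2 *
        ∫⁻ ξ, ‖sobolevWeight t (-m) ξ * g ξ‖ₑ ^ 2 := by
  have hK := hφ.nonneg
  have hd := decayWeight_pos m N ζ
  have hc := commutatorConst_nonneg m N
  have hm' := measurable_commutatorSymbol_right hφ.measurable N t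
  have hb := fun ζ ↦ norm_commutatorSymbol_le_bound hφ.norm_le N t ζ
  have hint : ∀ ζ x : ℝ, Integrable fun ξ : ℝ ↦
      Complex.exp (2 * Real.pi * Complex.I * x * ξ) * (commutatorSymbol N φ t ζ ξ * g ξ) := by
    intro ζ x
    refine (hg1.bdd_mul (c := _) (hm' ζ).aestronglyMeasurable
      (Filter.Eventually.of_forall (hb ζ))).bdd_mul (c := 1)
      (measurable_cexp_two_pi x).aestronglyMeasurable
      (Filter.Eventually.of_forall fun ξ ↦ (norm_cexp_two_pi x ξ).le)
  have e : ∀ x, commutatorKernel N φ g t x (ζ + s) - commutatorKernel N φ g t x ζ =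
      𝓕⁻ (fun ξ ↦ (commutatorSymbol N φ t (ζ + s) ξ - commutatorSymbol N φ t ζ ξ) * g ξ) x := by
    intro x
    simp only [commutatorKernel, fourierInv_apply_eq]
    rw [← integral_sub (hint _ x) (hint _ x)]
    congr 1
    funext ξ
    ring
  simp only [e]
  exact lintegral_fourierInv_mul_sq_le
    (ψ := fun ξ ↦ commutatorSymbol N φ t (ζ + s) ξ - commutatorSymbol N φ t ζ ξ)
    (w := sobolevWeight t (-m))
    (C := s * (commutatorConst m N * (K * t) * decayWeight m N ζ)) (by positivity)
    ((hm' _).sub (hm' _)) (fun ξ ↦ (norm_sub_le _ _).trans (add_le_add (hb _ ξ) (hb _ ξ)))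
    (norm_commutatorSymbol_add_sub_le hm ht ht1 hφ N hs hs1 ζ) hg1 hg2

/-- The integral of `(1 + ζ²) ^ (m + 1 - N)`. -/
def decayMass (m : ℝ) (N : ℕ) : ℝ≥0∞ := ∫⁻ ζ, ENNReal.ofReal (decayWeight m N ζ) ^ 2

/-- The function (1 + ζ²)^(m+1-N) is integrable on the line when 2(N - 1 - m) > 1, that is N > 3/2 +
m. The lower bound on the number of derivatives in (C2) originates here. -/
theorem decayMass_ne_top {m : ℝ} {N : ℕ} (hN : 3 / 2 + m < N) : decayMass m N ≠ ⊤ := by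
  have h := integrable_rpow_neg_one_add_norm_sq (E := ℝ) (μ := volume) (r := 2 * (N - 1 - m))
    (by simp; linarith)
  have h2 := h.lintegral_lt_top
  unfold decayMass
  convert h2.ne using 3 with ζ
  rw [← ENNReal.ofReal_pow (decayWeight_pos m N ζ).le, decayWeight, ← Real.rpow_natCast,
    ← Real.rpow_mul (by positivity), Real.norm_eq_abs, sq_abs]
  congr 2
  push_cast
  ring

@[fun_prop]
theorem measurable_decayWeight (m : ℝ) (N : ℕ) : Measurable (decayWeight m N) := by
  unfold decayWeight; fun_prop

theorem lintegral_ofReal_mul_decayWeight {m : ℝ} {N : ℕ} {a : ℝ} (ha : 0 ≤ a) (M : ℝ≥0∞) :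
    ∫⁻ ζ, ENNReal.ofReal (a * decayWeight m N ζ) ^ 2 * M =
      ENNReal.ofReal a ^ 2 * decayMass m N * M := by
  rw [decayMass, mul_assoc, ← lintegral_mul_const _ (by fun_prop),
    ← lintegral_const_mul' _ _ (by finiteness)]
  apply lintegral_congr fun ζ ↦ ?_
  rw [ENNReal.ofReal_mul ha, mul_pow, mul_assoc]

theorem lintegral_lintegral_commutatorKernel_sq_le {m K t : ℝ} (hm : 0 ≤ m) (ht : 0 < t)
    (ht1 : t ≤ 1) {φ g : ℝ → ℂ} (hφ : IsSlowlyVarying m K φ) (hgm : Measurable g)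
    (hg1 : Integrable g) (hg2 : MemLp g 2 volume) (N : ℕ) :
    ∫⁻ x, ∫⁻ ζ, ‖commutatorKernel N φ g t x ζ‖ₑ ^ 2 ≤
      ENNReal.ofReal (K * t) ^ 2 * decayMass m N *
        ∫⁻ ξ, ‖sobolevWeight t (-m) ξ * g ξ‖ₑ ^ 2 := by
  have hK := hφ.nonneg
  have hkm := measurable_commutatorKernel hφ.measurable hgm N t
  rw [lintegral_lintegral_swap (by fun_prop), ← lintegral_ofReal_mul_decayWeight (by positivity)]
  exact lintegral_mono fun ζ ↦ lintegral_commutatorKernel_sq_le hm ht ht1 hφ hg1 hg2 N ζ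

theorem lintegral_lintegral_commutatorKernel_add_sub_sq_le {m K t : ℝ} (hm : 0 ≤ m) (ht : 0 < t)
    (ht1 : t ≤ 1) {φ g : ℝ → ℂ} (hφ : IsSlowlyVarying m K φ) (hgm : Measurable g)
    (hg1 : Integrable g) (hg2 : MemLp g 2 volume) (N : ℕ) {s : ℝ} (hs : 0 < s) (hs1 : s ≤ 1) :
    ∫⁻ x, ∫⁻ ζ, ‖commutatorKernel N φ g t x (ζ + s) - commutatorKernel N φ g t x ζ‖ₑ ^ 2 ≤
      ENNReal.ofReal s ^ 2 * (ENNReal.ofReal (commutatorConst m N * (K * t)) ^ 2 * decayMass m N *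
        ∫⁻ ξ, ‖sobolevWeight t (-m) ξ * g ξ‖ₑ ^ 2) := by
  have hK := hφ.nonneg
  have hc := commutatorConst_nonneg m N
  have hkm := measurable_commutatorKernel hφ.measurable hgm N t
  have hkm2 := measurable_commutatorKernel_add hφ.measurable hgm N t s
  rw [lintegral_lintegral_swap (by fun_prop), ← lintegral_ofReal_mul_decayWeight (by positivity),
    ← lintegral_const_mul' _ _ (by finiteness)]
  have h : ∀ ζ, _ := lintegral_commutatorKernel_add_sub_sq_le hm ht ht1 hφ hg1 hg2 N hs hs1
  simp only [ENNReal.ofReal_mul hs.le, mul_pow, mul_assoc] at h ⊢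
  exact lintegral_mono h

/-- For fixed x the L¹ norm of the ζ-transform is bounded by the H¹ norm of the kernel in ζ, the
derivative being measured by difference quotients. Integrating in x and exchanging the integrals,
Plancherel in x applies for each ζ and `decayMass` sums the result. -/
theorem lintegral_fourier_commutatorKernel_sq_le {m K t : ℝ} (hm : 0 ≤ m) (ht : 0 < t)
    (ht1 : t ≤ 1) {φ g : ℝ → ℂ} (hφ : IsSlowlyVarying m K φ) (hgm : Measurable g)
    (hg1 : Integrable g) (hg2 : MemLp g 2 volume) {N : ℕ} (hN : 2 ≤ N) :
    ∫⁻ x, (∫⁻ y, ‖𝓕 (commutatorKernel N φ g t x) y‖ₑ) ^ 2 ≤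
      ENNReal.ofReal (Real.pi * (1 + commutatorConst m N ^ 2) * (K * t) ^ 2) * decayMass m N *
        ∫⁻ ξ, ‖sobolevWeight t (-m) ξ * g ξ‖ₑ ^ 2 := by
  have hK := hφ.nonneg
  have hc := commutatorConst_nonneg m N
  have hkm := measurable_commutatorKernel hφ.measurable hgm N t
  have hFm := measurable_fourier_param hkm
  have hk1 := fun x ↦ integrable_commutatorKernel hφ.measurable hgm hφ.norm_le hg1 hN t x
  have hk2 := fun x ↦ memLp_commutatorKernel hφ.measurable hgm hφ.norm_le hg1 hN t x
  obtain ⟨S, hS⟩ : ∃ S, S = ∫⁻ ξ, ‖sobolevWeight t (-m) ξ * g ξ‖ₑ ^ 2 := ⟨_, rfl⟩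
  have hA := lintegral_lintegral_commutatorKernel_sq_le hm ht ht1 hφ hgm hg1 hg2 N
  have hB := lintegral_sq_mul_fourier_le (μ := (volume : Measure ℝ)) hkm hk1 hk2 fun s hs hs1 ↦
    lintegral_lintegral_commutatorKernel_add_sub_sq_le hm ht ht1 hφ hgm hg1 hg2 N hs hs1
  rw [← hS] at hA hB ⊢
  have h1 : ∀ x, (∫⁻ y, ‖𝓕 (commutatorKernel N φ g t x) y‖ₑ) ^ 2 ≤ ENNReal.ofReal Real.pi *
      ((∫⁻ ζ, ‖commutatorKernel N φ g t x ζ‖ₑ ^ 2) +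
        ∫⁻ y, ENNReal.ofReal ((2 * Real.pi * y) ^ 2) * ‖𝓕 (commutatorKernel N φ g t x) y‖ₑ ^ 2) := by
    intro x
    have hFx : Measurable (𝓕 (commutatorKernel N φ g t x)) :=
      (continuous_fourier_of_integrable (hk1 x)).measurable
    refine (lintegral_enorm_sq_le_weighted hFx).trans ?_
    gcongr
    rw [← lintegral_enorm_fourier_sq (hk1 x) (hk2 x), ← lintegral_add_left (by fun_prop)]
    refine lintegral_mono fun y ↦ ?_
    have : ENNReal.ofReal (1 + y ^ 2) ≤ 1 + ENNReal.ofReal ((2 * Real.pi * y) ^ 2) := by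
      rw [← ENNReal.ofReal_one, ← ENNReal.ofReal_add (by norm_num) (by positivity)]
      apply ENNReal.ofReal_le_ofReal
      rw [mul_pow]
      have : 1 ≤ (2 * Real.pi) ^ 2 := by nlinarith [Real.pi_gt_three]
      nlinarith [sq_nonneg y]
    have h := mul_le_mul_left this (‖𝓕 (commutatorKernel N φ g t x) y‖ₑ ^ 2)
    rwa [add_mul, one_mul] at h
  calc _ ≤ ∫⁻ x, ENNReal.ofReal Real.pi * ((∫⁻ ζ, ‖commutatorKernel N φ g t x ζ‖ₑ ^ 2) +
        ∫⁻ y, ENNReal.ofReal ((2 * Real.pi * y) ^ 2) * ‖𝓕 (commutatorKernel N φ g t x) y‖ₑ ^ 2) :=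
        lintegral_mono h1
    _ = ENNReal.ofReal Real.pi * ((∫⁻ x, ∫⁻ ζ, ‖commutatorKernel N φ g t x ζ‖ₑ ^ 2) + ∫⁻ x,
        ∫⁻ y, ENNReal.ofReal ((2 * Real.pi * y) ^ 2) * ‖𝓕 (commutatorKernel N φ g t x) y‖ₑ ^ 2) := by
        rw [lintegral_const_mul' _ _ ENNReal.ofReal_ne_top, lintegral_add_left]
        exact Measurable.lintegral_prod_right' (f := fun p : ℝ × ℝ ↦
          ‖commutatorKernel N φ g t p.1 p.2‖ₑ ^ 2) (by fun_prop)
    _ ≤ ENNReal.ofReal Real.pi * (ENNReal.ofReal (K * t) ^ 2 * decayMass m N * S +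
        ENNReal.ofReal (commutatorConst m N * (K * t)) ^ 2 * decayMass m N * S) := by
        gcongr
    _ = _ := by
        have hpi := Real.pi_pos
        have e : ENNReal.ofReal (Real.pi * (1 + commutatorConst m N ^ 2) * (K * t) ^ 2) =
            ENNReal.ofReal Real.pi * (1 + ENNReal.ofReal (commutatorConst m N) ^ 2) *
              ENNReal.ofReal (K * t) ^ 2 := by
          rw [ENNReal.ofReal_mul (by positivity), ENNReal.ofReal_mul (by positivity),
            ENNReal.ofReal_add (by positivity) (by positivity),
            ENNReal.ofReal_pow (by positivity), ENNReal.ofReal_pow (by positivity),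
            ENNReal.ofReal_one]
        rw [e, ENNReal.ofReal_mul hc]
        ring

/-- The multiplication formula moves the transform from β to u, and the modulation becomes a
translation by x, which the L¹ norm does not see. Only the supremum of β is used; no norm of 𝓕 β
enters. -/
theorem enorm_integral_modulated_le {β u : ℝ → ℂ} (hβ : Integrable β) (hu : Integrable u) {M : ℝ}
    (hM : ∀ y, ‖β y‖ ≤ M) (x : ℝ) :
    ‖∫ ζ : ℝ, 𝓕 β ζ * (Complex.exp (2 * Real.pi * Complex.I * x * ζ) * u ζ)‖ₑ ≤
      ENNReal.ofReal M * ∫⁻ y, ‖𝓕 u y‖ₑ := by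
  have hu' : Integrable fun ζ : ℝ ↦ Complex.exp (2 * Real.pi * Complex.I * x * ζ) * u ζ :=
    hu.bdd_mul (c := 1) (measurable_cexp_two_pi x).aestronglyMeasurable
      (Filter.Eventually.of_forall fun ξ ↦ (norm_cexp_two_pi x ξ).le)
  have e : ∀ y, 𝓕 (fun ζ : ℝ ↦ Complex.exp (2 * Real.pi * Complex.I * x * ζ) * u ζ) y =
      𝓕 u (y - x) := by
    intro y
    rw [fourier_apply_eq, fourier_apply_eq]
    congr 1
    funext ζ
    rw [← mul_assoc, ← Complex.exp_add]
    congr 2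
    push_cast
    ring
  rw [integral_fourier_mul_eq hβ hu', ← lintegral_sub_right_eq_self _ x,
    ← lintegral_const_mul' _ _ ENNReal.ofReal_ne_top]
  refine (enorm_integral_le_lintegral _).trans (lintegral_mono fun y ↦ ?_)
  rw [e, enorm_mul]
  gcongr
  exact enorm_le_of_norm_le (hM y)

/-- The constant in the commutator estimate for coefficients with bounded derivatives. -/
def smoothCommutatorConst (m : ℝ) (N : ℕ) : ℝ :=
  Real.sqrt (Real.pi * (1 + commutatorConst m N ^ 2) * (decayMass m N).toReal)

/-- The factor (1 + 2πiζ)⁻ᴺ of v goes into the kernel and supplies its decay in ζ; the rest of v is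
𝓕 β, and only the supremum of β enters the bound. Integrability of v and β is assumed but not
measured, so the estimate survives limits of coefficients with uniformly bounded derivatives. -/
theorem norm_commutator_le_of_bounded {m K t G M : ℝ} (hm : 0 ≤ m) (ht : 0 < t) (ht1 : t ≤ 1)
    {φ v g β : ℝ → ℂ} {N : ℕ} (hN : 3 / 2 + m < N) (hφ : IsSlowlyVarying m K φ)
    (hv : Integrable v) (hβ : Integrable β) (hM : ∀ y, ‖β y‖ ≤ M)
    (hvβ : ∀ ζ, v ζ = resolventPow N ζ * 𝓕 β ζ)
    (hgm : Measurable g) (hg : Integrable g) (hG : ∀ ξ, ‖g ξ‖ ≤ G) (hg2 : MemLp g 2 volume) :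
    ‖fourierMul (fun ξ ↦ φ (t * ξ)) (mulOp (𝓕⁻ v) (𝓕⁻ (hg2.toLp g))) -
      mulOp (𝓕⁻ v) (fourierMul (fun ξ ↦ φ (t * ξ)) (𝓕⁻ (hg2.toLp g)))‖ ≤
      smoothCommutatorConst m N * M * (K * t) *
        ‖mulOp (sobolevWeight t (-m)) (hg2.toLp g)‖ := by
  have hK := hφ.nonneg
  have hM0 : 0 ≤ M := (norm_nonneg _).trans (hM 0)
  -- The strict lower bound 3/2 + m excludes N ≤ 1; two orders of decay make the kernel integrable
  -- in ζ.
  have hN2 : 2 ≤ N := by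
    have : (1 : ℝ) < N := by linarith
    exact_mod_cast this
  have hC0 : 0 ≤ smoothCommutatorConst m N := Real.sqrt_nonneg _
  have hpi := Real.pi_pos
  apply norm_le_of_lintegral_le (by positivity)
  rw [lintegral_commutator_eq hφ.measurable t hφ.norm_le hv hg hG hg2,
    lintegral_mulOp_toLp (memLp_top_sobolevWeight hm t) hg2]
  have h1 : ∀ x : ℝ, ‖∫ ζ : ℝ, v ζ * (Complex.exp (2 * Real.pi * Complex.I * x * ζ) *
      𝓕⁻ (fun ξ ↦ (φ (t * (ξ + ζ)) - φ (t * ξ)) * g ξ) x)‖ₑ ≤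
      ENNReal.ofReal M * ∫⁻ y, ‖𝓕 (commutatorKernel N φ g t x) y‖ₑ := by
    intro x
    refine le_trans (le_of_eq ?_) (enorm_integral_modulated_le hβ
      (integrable_commutatorKernel hφ.measurable hgm hφ.norm_le hg hN2 t x) hM x)
    congr 2
    funext ζ
    rw [hvβ, commutatorKernel_eq]
    ring
  calc _ ≤ ∫⁻ x, (ENNReal.ofReal M * ∫⁻ y, ‖𝓕 (commutatorKernel N φ g t x) y‖ₑ) ^ 2 :=
        lintegral_mono fun x ↦ pow_le_pow_left₀ zero_le (h1 x) 2
    _ = ENNReal.ofReal M ^ 2 * ∫⁻ x, (∫⁻ y, ‖𝓕 (commutatorKernel N φ g t x) y‖ₑ) ^ 2 := by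
        simp only [mul_pow]
        rw [lintegral_const_mul' _ _ (by finiteness)]
    _ ≤ ENNReal.ofReal M ^ 2 * (ENNReal.ofReal (Real.pi * (1 + commutatorConst m N ^ 2) *
          (K * t) ^ 2) * decayMass m N * ∫⁻ ξ, ‖sobolevWeight t (-m) ξ * g ξ‖ₑ ^ 2) := by
        gcongr
        exact lintegral_fourier_commutatorKernel_sq_le hm ht ht1 hφ hgm hg hg2 hN2
    _ = _ := by
        rw [← ENNReal.ofReal_toReal (decayMass_ne_top hN), ← ENNReal.ofReal_mul (by positivity),
          ← mul_assoc, ← ENNReal.ofReal_pow hM0, ← ENNReal.ofReal_mul (by positivity),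
          ← ENNReal.ofReal_pow (by positivity)]
        congr 2
        rw [mul_pow, mul_pow, mul_pow, mul_pow, smoothCommutatorConst,
          Real.sq_sqrt (by positivity)]
        ring

/-! ### Coefficients with bounded commutators -/

/-- Commutators of multiplication by `a` with dilated slowly varying multipliers are `O(t)` from
the semiclassical Sobolev space of order `-m` to `L²(ℝ)`. -/
def HasCommutatorBound (m C : ℝ) (a : ℝ → ℂ) : Prop :=
  ∀ (t : ℝ), 0 < t → t ≤ 1 → ∀ (K : ℝ) (φ : ℝ → ℂ), IsSlowlyVarying m K φ → ∀ u : LTwo,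
    ‖fourierMul (fun ξ ↦ φ (t * ξ)) (mulOp a u) - mulOp a (fourierMul (fun ξ ↦ φ (t * ξ)) u)‖ ≤
      C * (K * t) * ‖fourierMul (sobolevWeight t (-m)) u‖

theorem HasCommutatorBound.congr {m C : ℝ} {a b : ℝ → ℂ} (h : HasCommutatorBound m C a)
    (hab : a =ᵐ[volume] b) : HasCommutatorBound m C b := by
  unfold HasCommutatorBound at h ⊢
  rwa [mulOp_congr hab] at h

/-- Both sides are continuous in u for the L² norm, and the Schwartz functions, written as 𝓕⁻ g, are
dense. -/
theorem hasCommutatorBound_of_schwartz {m C : ℝ} {a : ℝ → ℂ}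
    (h : ∀ (t : ℝ), 0 < t → t ≤ 1 → ∀ (K : ℝ) (φ : ℝ → ℂ), IsSlowlyVarying m K φ →
      ∀ (g : 𝓢(ℝ, ℂ)) (hg2 : MemLp g 2 volume),
      ‖fourierMul (fun ξ ↦ φ (t * ξ)) (mulOp a (𝓕⁻ (hg2.toLp g))) -
        mulOp a (fourierMul (fun ξ ↦ φ (t * ξ)) (𝓕⁻ (hg2.toLp g)))‖ ≤
      C * (K * t) * ‖mulOp (sobolevWeight t (-m)) (hg2.toLp g)‖) : HasCommutatorBound m C a := by
  intro t ht ht1 K φ hφ u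
  refine DenseRange.induction_on (p := fun u : LTwo ↦
    ‖fourierMul (fun ξ ↦ φ (t * ξ)) (mulOp a u) - mulOp a (fourierMul (fun ξ ↦ φ (t * ξ)) u)‖ ≤
      C * (K * t) * ‖fourierMul (sobolevWeight t (-m)) u‖)
    (SchwartzMap.denseRange_toLpCLM (p := 2) ENNReal.ofNat_ne_top) u ?_ fun f ↦ ?_
  · exact isClosed_le (by fun_prop) (by fun_prop)
  · have h2 := h t ht ht1 K φ hφ (𝓕 f) ((𝓕 f).memLp 2)
    have e : ((𝓕 f).memLp 2 (volume : Measure ℝ)).toLp (𝓕 f : 𝓢(ℝ, ℂ)) = (𝓕 (f.toLp 2) : LTwo) :=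
      (SchwartzMap.toLp_fourier_eq f).symm
    rw [e, FourierTransform.fourierInv_fourier_eq, ← norm_fourierMul_apply] at h2
    exact h2

theorem mulOp_const_add {a : ℝ → ℂ} (ha : MemLp a ∞ volume) (z : ℂ) (u : LTwo) :
    mulOp (fun x ↦ z + a x) u = z • u + mulOp a u := by
  have h : MemLp (fun x ↦ z + a x) ∞ volume := (memLp_top_const z).add ha
  apply Lp.ext
  filter_upwards [coeFn_mulOp h u, coeFn_mulOp ha u, Lp.coeFn_add (z • u) (mulOp a u),
    Lp.coeFn_smul z u] with x h1 h2 h3 h4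
  rw [h1, h3, Pi.add_apply, h2, h4, Pi.smul_apply, smul_eq_mul, add_mul]

theorem HasCommutatorBound.const_add {m C : ℝ} {a : ℝ → ℂ} (h : HasCommutatorBound m C a)
    (ha : MemLp a ∞ volume) (z : ℂ) : HasCommutatorBound m C (fun x ↦ z + a x) := by
  intro t ht ht1 K φ hφ u
  have := h t ht ht1 K φ hφ u
  simp only [mulOp_const_add ha, map_add, map_smul]
  rwa [add_sub_add_left_eq_sub]

theorem mulOp_const_mul {a : ℝ → ℂ} (ha : MemLp a ∞ volume) (z : ℂ) (u : LTwo) :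
    mulOp (fun x ↦ z * a x) u = z • mulOp a u := by
  have h : MemLp (fun x ↦ z * a x) ∞ volume := ha.const_mul z
  apply Lp.ext
  filter_upwards [coeFn_mulOp h u, coeFn_mulOp ha u, Lp.coeFn_smul z (mulOp a u)] with x h1 h2 h3
  rw [h1, h3, Pi.smul_apply, h2, smul_eq_mul, mul_assoc]

theorem HasCommutatorBound.const_mul {m C : ℝ} {a : ℝ → ℂ} (h : HasCommutatorBound m C a)
    (ha : MemLp a ∞ volume) (z : ℂ) : HasCommutatorBound m (‖z‖ * C) (fun x ↦ z * a x) := by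
  intro t ht ht1 K φ hφ u
  have := h t ht ht1 K φ hφ u
  simp only [mulOp_const_mul ha, map_smul]
  rw [← smul_sub, norm_smul, mul_assoc, mul_assoc, ← mul_assoc C]
  gcongr

theorem hasCommutatorBound_fourierInv {m : ℝ} (hm : 0 ≤ m) {v : ℝ → ℂ} (hv : Integrable v)
    (hvw : Integrable fun ζ ↦ growthWeight m ζ * ‖v ζ‖) :
    HasCommutatorBound m (∫ ζ, growthWeight m ζ * ‖v ζ‖) (𝓕⁻ v) := by
  apply hasCommutatorBound_of_schwartz
  intro t ht ht1 K φ hφ g hg2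
  obtain ⟨G, hG⟩ : ∃ G, ∀ x, ‖g x‖ ≤ G :=
    ⟨_, fun x ↦ (BoundedContinuousFunction.norm_coe_le_norm g.toBoundedContinuousFunction x)⟩
  exact norm_commutator_le_of_integrable hm ht ht1 hφ hv hvw g.continuous.measurable g.integrable
    hG hg2

/-- Dominated convergence. Bounded almost everywhere convergence of coefficients gives strong, not
norm, convergence of the multiplication operators; this suffices because commutators are tested on
one u at a time. -/
theorem tendsto_mulOp {b : ℕ → ℝ → ℂ} {a : ℝ → ℂ} {M : ℝ}
    (hbm : ∀ n, AEStronglyMeasurable (b n) volume) (hb : ∀ n x, ‖b n x‖ ≤ M)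
    (hlim : ∀ᵐ x, Filter.Tendsto (fun n ↦ b n x) Filter.atTop (nhds (a x))) (u : LTwo) :
    Filter.Tendsto (fun n ↦ mulOp (b n) u) Filter.atTop (nhds (mulOp a u)) := by
  have ham : AEStronglyMeasurable a volume := aestronglyMeasurable_of_tendsto_ae _ hbm hlim
  have haM : ∀ᵐ x, ‖a x‖ ≤ M := by
    filter_upwards [hlim] with x hx
    exact le_of_tendsto hx.norm (Filter.Eventually.of_forall fun n ↦ hb n x)
  have ha : MemLp a ∞ volume := memLp_top_of_bound ham M haM
  have hbL : ∀ n, MemLp (b n) ∞ volume := fun n ↦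
    memLp_top_of_bound (hbm n) M (Filter.Eventually.of_forall (hb n))
  have hu := (Lp.memLp u).1.aemeasurable.enorm
  have key : Filter.Tendsto (fun n ↦ ∫⁻ x, (‖b n x - a x‖ₑ * ‖u x‖ₑ) ^ 2) Filter.atTop
      (nhds (∫⁻ _ : ℝ, 0)) := by
    refine tendsto_lintegral_of_dominated_convergence'
      (fun x ↦ (ENNReal.ofReal (M + M) * ‖u x‖ₑ) ^ 2) (fun n ↦ ?_) (fun n ↦ ?_) ?_ ?_
    · have := ((hbm n).sub ham).aemeasurable.enorm
      simp only [Pi.sub_apply] at this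
      fun_prop
    · filter_upwards [haM] with x hx
      gcongr
      exact enorm_le_of_norm_le ((norm_sub_le _ _).trans (add_le_add (hb n x) hx))
    · simp only [mul_pow]
      rw [lintegral_const_mul' _ _ (by finiteness), lintegral_enorm_sq_coeFn]
      finiteness
    · filter_upwards [hlim] with x hx
      have h1 : Filter.Tendsto (fun n ↦ ‖b n x - a x‖ₑ) Filter.atTop (nhds 0) := by
        have := (hx.sub_const (a x)).enorm
        simpa using this
      have h2 := ((ENNReal.continuous_pow 2).tendsto _).comp
        (ENNReal.Tendsto.mul_const h1 (b := ‖u x‖ₑ) (Or.inr (by finiteness)))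
      simpa [Function.comp_def] using h2
  rw [tendsto_iff_norm_sub_tendsto_zero]
  have e : ∀ n, ‖mulOp (b n) u - mulOp a u‖ₑ ^ 2 = ∫⁻ x, (‖b n x - a x‖ₑ * ‖u x‖ₑ) ^ 2 := by
    intro n
    rw [← lintegral_enorm_sq_coeFn]
    apply lintegral_congr_ae
    filter_upwards [coeFn_mulOp (hbL n) u, coeFn_mulOp ha u,
      Lp.coeFn_sub (mulOp (b n) u) (mulOp a u)] with x h1 h2 h3
    rw [h3, Pi.sub_apply, h1, h2, ← sub_mul, enorm_mul]
  simp only [← e, lintegral_zero] at key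
  have h3 := (ENNReal.tendsto_toReal ENNReal.zero_ne_top).comp key
  have h4 := h3.sqrt
  simpa [Function.comp_def, Real.sqrt_sq] using h4

theorem HasCommutatorBound.of_tendsto {m C M : ℝ} {b : ℕ → ℝ → ℂ} {a : ℝ → ℂ}
    (h : ∀ n, HasCommutatorBound m C (b n))
    (hbm : ∀ n, AEStronglyMeasurable (b n) volume) (hb : ∀ n x, ‖b n x‖ ≤ M)
    (hlim : ∀ᵐ x, Filter.Tendsto (fun n ↦ b n x) Filter.atTop (nhds (a x))) :
    HasCommutatorBound m C a := by
  intro t ht ht1 K φ hφ u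
  have h1 := tendsto_mulOp hbm hb hlim u
  have h2 := tendsto_mulOp hbm hb hlim (fourierMul (fun ξ ↦ φ (t * ξ)) u)
  have h3 := (((fourierMul (fun ξ ↦ φ (t * ξ))).continuous.tendsto _).comp h1).sub h2
  exact le_of_tendsto h3.norm (Filter.Eventually.of_forall fun n ↦ h n t ht ht1 K φ hφ u)

/-! ### Schwartz coefficients: commutator bounds from sup norms of derivatives. -/

/-- `(1 + d/dx)` on Schwartz functions. -/
def oneAddDeriv : 𝓢(ℝ, ℂ) →L[ℂ] 𝓢(ℝ, ℂ) :=
  ContinuousLinearMap.id ℂ _ + SchwartzMap.derivCLM ℂ ℂ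

theorem fourier_oneAddDeriv (f : 𝓢(ℝ, ℂ)) (ζ : ℝ) :
    𝓕 (oneAddDeriv f : ℝ → ℂ) ζ = (1 + 2 * Real.pi * Complex.I * ζ) * 𝓕 (f : ℝ → ℂ) ζ := by
  have h := Real.fourier_deriv (f := (f : ℝ → ℂ)) f.integrable f.differentiable
    (SchwartzMap.derivCLM ℂ ℂ f).integrable
  have e : (oneAddDeriv f : ℝ → ℂ) = fun x ↦ f x + deriv f x := by
    funext x; rfl
  have hd : Integrable (deriv (f : ℝ → ℂ)) := (SchwartzMap.derivCLM ℂ ℂ f).integrable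
  have h2 : 𝓕 (fun x ↦ f x + deriv f x) ζ = 𝓕 (f : ℝ → ℂ) ζ + 𝓕 (deriv f) ζ := by
    simp only [Real.fourier_eq]
    rw [← integral_add]
    · congr 1; funext v; rw [smul_add]
    · exact (Real.fourierIntegral_convergent_iff ζ).2 f.integrable
    · exact (Real.fourierIntegral_convergent_iff ζ).2 hd
  rw [e, h2, h]
  simp only [smul_eq_mul]
  ring

theorem fourier_iterate_oneAddDeriv (N : ℕ) (f : 𝓢(ℝ, ℂ)) (ζ : ℝ) :
    𝓕 (f : ℝ → ℂ) ζ = resolventPow N ζ * 𝓕 (oneAddDeriv^[N] f : ℝ → ℂ) ζ := by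
  induction N generalizing f with
  | zero => simp [resolventPow]
  | succ N ih =>
    rw [Function.iterate_succ_apply', fourier_oneAddDeriv]
    have h0 := one_add_two_pi_mul_ne_zero ζ
    rw [ih f]
    unfold resolventPow
    rw [pow_succ]
    field_simp

/-- Each application of 1 + d/dx doubles the common bound and uses up one of the N available
derivatives. -/
theorem norm_iterate_oneAddDeriv_le (N : ℕ) (f : 𝓢(ℝ, ℂ)) {M : ℝ}
    (h : ∀ k ≤ N, ∀ x, ‖iteratedDeriv k f x‖ ≤ M) (x : ℝ) :
    ‖oneAddDeriv^[N] f x‖ ≤ 2 ^ N * M := by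
  induction N generalizing f M with
  | zero => simpa using h 0 le_rfl x
  | succ N ih =>
    rw [Function.iterate_succ_apply]
    have h1 : ∀ k ≤ N, ∀ x, ‖iteratedDeriv k (oneAddDeriv f) x‖ ≤ 2 * M := by
      intro k hk x
      have e : (oneAddDeriv f : ℝ → ℂ) = fun x ↦ f x + deriv f x := by
        funext x; rfl
      have e2 : iteratedDeriv k (oneAddDeriv f) x =
          iteratedDeriv k f x + iteratedDeriv (k + 1) f x := by
        rw [e, iteratedDeriv_succ', iteratedDeriv_fun_add]
        · exact (f.smooth k).contDiffAt
        · exact ((SchwartzMap.derivCLM ℂ ℂ f).smooth k).contDiffAt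
      rw [e2]
      refine (norm_add_le _ _).trans ?_
      linarith [h k (by omega) x, h (k + 1) (by omega) x]
    refine (ih (oneAddDeriv f) h1).trans (le_of_eq ?_)
    ring

theorem hasCommutatorBound_schwartz {m M : ℝ} (hm : 0 ≤ m) {N : ℕ} (hN : 3 / 2 + m < N)
    (b : 𝓢(ℝ, ℂ)) (h : ∀ k ≤ N, ∀ x, ‖iteratedDeriv k b x‖ ≤ M) :
    HasCommutatorBound m (smoothCommutatorConst m N * (2 ^ N * M)) b := by
  have hb : 𝓕⁻ (𝓕 (b : ℝ → ℂ)) = b := by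
    have : (𝓕⁻ (𝓕 b) : 𝓢(ℝ, ℂ)) = b := FourierTransform.fourierInv_fourier_eq b
    conv_rhs => rw [← this]
    rw [SchwartzMap.fourierInv_coe, SchwartzMap.fourier_coe]
  rw [← hb]
  apply hasCommutatorBound_of_schwartz
  intro t ht ht1 K φ hφ g hg2
  obtain ⟨G, hG⟩ : ∃ G, ∀ x, ‖g x‖ ≤ G :=
    ⟨_, fun x ↦ (BoundedContinuousFunction.norm_coe_le_norm g.toBoundedContinuousFunction x)⟩
  exact norm_commutator_le_of_bounded hm ht ht1 hN hφ 
    (by rw [← SchwartzMap.fourier_coe]; exact (𝓕 b).integrable)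
    (oneAddDeriv^[N] b).integrable
    (norm_iterate_oneAddDeriv_le N b h) (fourier_iterate_oneAddDeriv N b)
    g.continuous.measurable g.integrable hG hg2

/-! ### Slowly varying functions of the modulus -/

/-- Mean value inequality between |ξ| and |ξ + ζ|, which are at distance at most |ζ|; Peetre's
inequality replaces the weight at an intermediate point by the weight at ξ. Derivatives are taken
within the half-line because a function of |ξ| may have a kink at 0. -/
theorem isSlowlyVarying_of_hasDerivWithinAt {m K : ℝ} (hm : 0 ≤ m) {ψ ψ' : ℝ → ℝ}
    (hd : ∀ l, 0 ≤ l → HasDerivWithinAt ψ (ψ' l) (Set.Ici 0) l)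
    (hb : ∀ l, 0 ≤ l → |ψ l| ≤ K)
    (hb' : ∀ l, 0 ≤ l → |ψ' l| ≤ K * (1 + l ^ 2) ^ (-m / 2)) :
    IsSlowlyVarying m (2 ^ (m / 2) * K) (fun ξ ↦ (ψ |ξ| : ℂ)) := by
  have hK : 0 ≤ K := (abs_nonneg _).trans (hb 0 le_rfl)
  have h2 : (1 : ℝ) ≤ 2 ^ (m / 2) := Real.one_le_rpow (by norm_num) (by positivity)
  refine ⟨?_, fun ξ ↦ ?_, fun ξ ζ ↦ ?_⟩
  · have h1 : Continuous fun ξ : ℝ ↦ ψ |ξ| := by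
      rw [← continuousOn_univ]
      exact ContinuousOn.comp (t := Set.Ici 0) (fun l hl ↦ (hd l hl).continuousWithinAt)
        continuous_abs.continuousOn (fun x _ ↦ abs_nonneg x)
    exact (Complex.continuous_ofReal.comp h1).measurable
  · rw [Complex.norm_real, Real.norm_eq_abs]
    exact (hb _ (abs_nonneg ξ)).trans (le_mul_of_one_le_left hK h2)
  · have hsub : Set.uIcc |ξ| |ξ + ζ| ⊆ Set.Ici 0 := fun x hx ↦
      (le_min (abs_nonneg _) (abs_nonneg _)).trans hx.1
    have hbd : ∀ l ∈ Set.uIcc |ξ| |ξ + ζ|,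
        ‖ψ' l‖ ≤ 2 ^ (m / 2) * K * (1 + ζ ^ 2) ^ (m / 2) * (1 + ξ ^ 2) ^ (-m / 2) := by
      intro l hl
      refine (hb' l (hsub hl)).trans ?_
      have h3 : |(|ξ + ζ| - |ξ|)| ≤ |ζ| := by
        have := abs_abs_sub_abs_le_abs_sub (ξ + ζ) ξ
        rwa [add_sub_cancel_left] at this
      have h4 : |(l - |ξ|)| ≤ |ζ| := (Set.abs_sub_left_of_mem_uIcc hl).trans h3
      have h5 := one_add_sq_rpow_peetre (a := m / 2) (by positivity) |ξ| (l - |ξ|)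
      rw [add_sub_cancel, sq_abs, ← neg_div] at h5
      have h6 : (1 + (l - |ξ|) ^ 2) ^ (m / 2) ≤ (1 + ζ ^ 2) ^ (m / 2) := by
        apply Real.rpow_le_rpow (by positivity) _ (by positivity)
        have := sq_le_sq.2 h4
        linarith
      calc K * (1 + l ^ 2) ^ (-m / 2)
          ≤ K * (2 ^ (m / 2) * (1 + (l - |ξ|) ^ 2) ^ (m / 2) * (1 + ξ ^ 2) ^ (-m / 2)) := by gcongr
        _ ≤ K * (2 ^ (m / 2) * (1 + ζ ^ 2) ^ (m / 2) * (1 + ξ ^ 2) ^ (-m / 2)) := by gcongr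
        _ = _ := by ring
    have h7 := (convex_uIcc |ξ| |ξ + ζ|).norm_image_sub_le_of_norm_hasDerivWithin_le
      (fun l hl ↦ (hd l (hsub hl)).mono hsub) hbd Set.left_mem_uIcc Set.right_mem_uIcc
    rw [← Complex.ofReal_sub, Complex.norm_real]
    refine h7.trans ?_
    have h8 : ‖|ξ + ζ| - |ξ|‖ ≤ |ζ| := by
      have := abs_abs_sub_abs_le_abs_sub (ξ + ζ) ξ
      rwa [add_sub_cancel_left] at this
    calc _ ≤ 2 ^ (m / 2) * K * (1 + ζ ^ 2) ^ (m / 2) * (1 + ξ ^ 2) ^ (-m / 2) * |ζ| := by gcongr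
      _ = _ := by ring

/-- The weight of the Sobolev norm is itself an admissible multiplier, so the commutator bounds
apply to it; this is how B is controlled on H^{-m}_t. -/
theorem isSlowlyVarying_sobolevWeight {m : ℝ} (hm : 0 ≤ m) :
    IsSlowlyVarying m (2 ^ (m / 2) * (1 + m)) (sobolevWeight 1 (-m)) := by
  have e : sobolevWeight 1 (-m) = fun ξ ↦ (((fun l : ℝ ↦ (1 + l ^ 2) ^ (-m / 2)) |ξ| : ℝ) : ℂ) := by
    funext ξ; simp [sobolevWeight]
  rw [e]
  refine isSlowlyVarying_of_hasDerivWithinAt hm (ψ := fun l : ℝ ↦ (1 + l ^ 2) ^ (-m / 2))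
    (ψ' := fun l ↦ 2 * l * (-m / 2) * (1 + l ^ 2) ^ (-m / 2 - 1)) (fun l _ ↦ ?_) (fun l _ ↦ ?_)
    fun l _ ↦ ?_
  · have h1 : HasDerivAt (fun l : ℝ ↦ 1 + l ^ 2) (2 * l) l := by
      simpa using (hasDerivAt_pow 2 l).const_add 1
    exact (h1.rpow_const (Or.inl (by positivity))).hasDerivWithinAt
  · rw [abs_of_nonneg (by positivity)]
    have : (1 + l ^ 2) ^ (-m / 2) ≤ 1 :=
      Real.rpow_le_one_of_one_le_of_nonpos (by nlinarith [sq_nonneg l]) (by linarith)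
    linarith
  · rw [Real.rpow_sub_one (by positivity), abs_mul, abs_div, 
      abs_of_pos (a := 1 + l ^ 2) (by positivity),
      abs_of_pos (a := (1 + l ^ 2) ^ (-m / 2)) (by positivity)]
    have h2 : |2 * l * (-m / 2)| ≤ (1 + m) * (1 + l ^ 2) := by
      have h3 : |2 * l * (-m / 2)| = |l| * m := by
        rw [show 2 * l * (-m / 2) = -(l * m) by ring, abs_neg, abs_mul, abs_of_nonneg hm]
      rw [h3]
      have h4 : |l| ≤ 1 + l ^ 2 := by nlinarith [sq_abs l, sq_nonneg (|l| - 1), abs_nonneg l]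
      nlinarith [abs_nonneg l]
    calc _ = |2 * l * (-m / 2)| / (1 + l ^ 2) * (1 + l ^ 2) ^ (-m / 2) := by ring
      _ ≤ _ := by
        gcongr
        rw [div_le_iff₀ (by positivity)]
        exact h2

/-! ### The operator equation for the quantization of `d` -/

/-- Iteration produces a geometric series in q and a remainder q^n |K| ‖f‖ that disappears in the
limit. The crude constant K does not enter the conclusion, so it may be an operator norm without any
uniformity in t. -/
theorem le_of_iterate_le {N X : LTwo → ℝ} {E : LTwo → LTwo} {A q K : ℝ} (hA : 0 ≤ A)
    (hq : 0 ≤ q) (hq1 : q < 1) (hX : ∀ f, 0 ≤ X f)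
    (hN : ∀ f, N f ≤ A * X f + q * N (E f)) (hXE : ∀ f, X (E f) ≤ X f)
    (hK : ∀ f, N f ≤ K * ‖f‖) (hE : ∀ f, ‖E f‖ ≤ ‖f‖) (f : LTwo) : N f ≤ A / (1 - q) * X f := by
  have h1 : ∀ n : ℕ, ∀ f, N f ≤ A / (1 - q) * X f + q ^ n * (|K| * ‖f‖) := by
    intro n
    induction n with
    | zero =>
      intro f
      have h2 : 0 ≤ A / (1 - q) * X f := mul_nonneg (div_nonneg hA (by linarith)) (hX f)
      have h3 : K * ‖f‖ ≤ |K| * ‖f‖ := by gcongr; exact le_abs_self K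
      linarith [hK f]
    | succ n ih =>
      intro f
      have h2 := ih (E f)
      have h3 : q * N (E f) ≤ q * (A / (1 - q) * X f + q ^ n * (|K| * ‖f‖)) := by
        refine mul_le_mul_of_nonneg_left (h2.trans ?_) hq
        have h4 : 0 ≤ A / (1 - q) := div_nonneg hA (by linarith)
        gcongr
        · exact hXE f
        · exact hE f
      refine (hN f).trans ((add_le_add_right h3 _).trans (le_of_eq ?_))
      have : 1 - q ≠ 0 := by linarith
      field_simp
      ring
  have h2 : Filter.Tendsto (fun n : ℕ ↦ A / (1 - q) * X f + q ^ n * (|K| * ‖f‖)) Filter.atTop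
      (nhds (A / (1 - q) * X f + 0 * (|K| * ‖f‖))) :=
    ((tendsto_pow_atTop_nhds_zero_of_lt_one hq hq1).mul_const _).const_add _
  have h3 := ge_of_tendsto' h2 fun n ↦ h1 n f
  simpa using h3

/-- A solution `B` of `B = κ E - h B E`. -/
def IsResolventSolution (κ : ℂ) (h ε : ℝ → ℂ) (B : LTwo →L[ℂ] LTwo) : Prop :=
  ∀ u, B u = κ • fourierMul ε u - mulOp h (B (fourierMul ε u))

/-- The partial sums of the Neumann series of the solution of `B = κ E - h B E`. -/
def neumannPartial (κ : ℂ) (h ε : ℝ → ℂ) : ℕ → (LTwo →L[ℂ] LTwo)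
  | 0 => 0
  | n + 1 => κ • fourierMul ε - mulOp h ∘L neumannPartial κ h ε n ∘L fourierMul ε

theorem norm_fourierMul_le_self {ε : ℝ → ℂ} (hε : Measurable ε) (hε1 : ∀ ξ, ‖ε ξ‖ ≤ 1) (u : LTwo) :
    ‖fourierMul ε u‖ ≤ ‖u‖ := by
  simpa using norm_fourierMul_apply_le (memLp_top_of_measurable_bounded hε hε1)
    (Filter.Eventually.of_forall hε1) u

/-- The partial sums form a geometric Cauchy sequence with ratio q. Their convergence is part of the
conclusion because it later identifies the solution with a quantized symbol. -/
theorem exists_isResolventSolution (κ : ℂ) {h ε : ℝ → ℂ} (hh : MemLp h ∞ volume)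
    (hε : Measurable ε) (hε1 : ∀ ξ, ‖ε ξ‖ ≤ 1) {q : ℝ} (hq0 : 0 ≤ q) (hq : q < 1)
    (hhq : ∀ᵐ x, ‖h x‖ ≤ q) :
    ∃ B, IsResolventSolution κ h ε B ∧
      Filter.Tendsto (neumannPartial κ h ε) Filter.atTop (nhds B) := by
  have hE : ‖fourierMul ε‖ ≤ 1 := ContinuousLinearMap.opNorm_le_bound _ zero_le_one fun u ↦ by
    simpa using norm_fourierMul_le_self hε hε1 u
  have hH : ‖mulOp h‖ ≤ q := ContinuousLinearMap.opNorm_le_bound _ hq0 (norm_mulOp_apply_le hh hhq)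
  have h1 : ∀ n, dist (neumannPartial κ h ε n) (neumannPartial κ h ε (n + 1)) ≤
      ‖neumannPartial κ h ε 1‖ * q ^ n := by
    intro n
    induction n with
    | zero => simp [neumannPartial, dist_eq_norm]
    | succ n ih =>
      have e : neumannPartial κ h ε (n + 1) - neumannPartial κ h ε (n + 1 + 1) =
          - (mulOp h ∘L (neumannPartial κ h ε n - neumannPartial κ h ε (n + 1)) ∘L
            fourierMul ε) := by
        ext1 u
        simp [neumannPartial]
      rw [dist_eq_norm, e, norm_neg]
      rw [dist_eq_norm] at ih
      calc _ ≤ ‖mulOp h‖ * (‖neumannPartial κ h ε n - neumannPartial κ h ε (n + 1)‖ *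
            ‖fourierMul ε‖) :=
            (ContinuousLinearMap.opNorm_comp_le _ _).trans
              (mul_le_mul_of_nonneg_left (ContinuousLinearMap.opNorm_comp_le _ _) (norm_nonneg _))
        _ ≤ q * ((‖neumannPartial κ h ε 1‖ * q ^ n) * 1) := by gcongr
        _ = _ := by ring
  obtain ⟨B, hB⟩ := cauchySeq_tendsto_of_complete (cauchySeq_of_le_geometric q _ hq h1)
  refine ⟨B, fun u ↦ ?_, hB⟩
  have h2 : ∀ v, Filter.Tendsto (fun n ↦ neumannPartial κ h ε n v) Filter.atTop (nhds (B v)) :=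
    fun v ↦ ((ContinuousLinearMap.apply ℂ LTwo v).continuous.tendsto B).comp hB
  have h3 := (h2 u).comp (Filter.tendsto_add_atTop_nat 1)
  have h4 : Filter.Tendsto (fun n ↦ κ • fourierMul ε u -
      mulOp h (neumannPartial κ h ε n (fourierMul ε u))) Filter.atTop
      (nhds (κ • fourierMul ε u - mulOp h (B (fourierMul ε u)))) :=
    (((mulOp h).continuous.tendsto _).comp (h2 _)).const_sub _
  exact tendsto_nhds_unique h3 h4

/-- Commute φ with both sides of B = κE - hBE. Multipliers commute with E, so κE drops out, and the
commutator with hBE splits by the Leibniz rule. -/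
theorem fourierMul_commutator_eq {κ : ℂ} {h ε : ℝ → ℂ} {B : LTwo →L[ℂ] LTwo}
    (hB : IsResolventSolution κ h ε B) {φ : ℝ → ℂ} (hφ : MemLp φ ∞ volume)
    (hε : MemLp ε ∞ volume) (u : LTwo) :
    fourierMul φ (B u) - B (fourierMul φ u) =
      -(fourierMul φ (mulOp h (B (fourierMul ε u))) -
        mulOp h (fourierMul φ (B (fourierMul ε u)))) -
      mulOp h (fourierMul φ (B (fourierMul ε u)) - B (fourierMul φ (fourierMul ε u))) := by
  rw [hB u, hB (fourierMul φ u), fourierMul_comm hε hφ]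
  simp only [map_sub, map_smul]
  abel

theorem fourierMul_sobolevWeight_comparison {m δ t : ℝ} (hm : 0 ≤ m) (hδ : 0 < δ) (hδ1 : δ ≤ 1)
    (u : LTwo) :
    ‖fourierMul (sobolevWeight t (-m)) u‖ ≤ ‖fourierMul (sobolevWeight (δ * t) (-m)) u‖ ∧
    ‖fourierMul (sobolevWeight (δ * t) (-m)) u‖ ≤
      δ ^ (-m) * ‖fourierMul (sobolevWeight t (-m)) u‖ := by
  simp only [norm_fourierMul_apply]
  have hd2 : δ ^ 2 ≤ 1 := by nlinarith
  constructor
  · have := norm_mulOp_le_norm_mulOp (memLp_top_sobolevWeight hm t)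
      (memLp_top_sobolevWeight hm (δ * t)) (K := 1) (fun ξ ↦ ?_) (𝓕 u)
    · simpa using this
    · rw [norm_sobolevWeight, norm_sobolevWeight, one_mul]
      apply Real.rpow_le_rpow_of_nonpos (by positivity) _ (by linarith)
      rw [mul_assoc, mul_pow]
      nlinarith [sq_nonneg (t * ξ)]
  · refine norm_mulOp_le_norm_mulOp (memLp_top_sobolevWeight hm (δ * t))
      (memLp_top_sobolevWeight hm t) (fun ξ ↦ ?_) (𝓕 u)
    rw [norm_sobolevWeight, norm_sobolevWeight]
    have e : δ ^ (-m) = (δ ^ 2) ^ (-m / 2) := by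
      rw [← Real.rpow_natCast, ← Real.rpow_mul hδ.le]; congr 1; push_cast; ring
    rw [e, ← Real.mul_rpow (by positivity) (by positivity)]
    apply Real.rpow_le_rpow_of_nonpos (by positivity) _ (by linarith)
    rw [mul_assoc, mul_pow δ]
    nlinarith [sq_nonneg (t * ξ)]

/-- Uniform bounds for the solutions of `B = κ E - h B E` in the semiclassical Sobolev space of
order `-m`, and for their commutators with slowly varying multipliers. -/
theorem exists_commutator_bound_of_isResolventSolution {m C q : ℝ} (hm : 0 ≤ m) (hq0 : 0 ≤ q)
    (hq : q < 1) {h : ℝ → ℂ} (hh : MemLp h ∞ volume) (hhq : ∀ᵐ x, ‖h x‖ ≤ q)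
    (hC : HasCommutatorBound m C h) (κ : ℂ) :
    ∃ A, 0 ≤ A ∧ ∀ t, 0 < t → t ≤ 1 → ∀ ε : ℝ → ℂ, Measurable ε → (∀ ξ, ‖ε ξ‖ ≤ 1) →
      ∀ B : LTwo →L[ℂ] LTwo, IsResolventSolution κ h ε B →
      ∀ (K : ℝ) (φ : ℝ → ℂ), IsSlowlyVarying m K φ → ∀ u,
      ‖fourierMul (fun ξ ↦ φ (t * ξ)) (B u) - B (fourierMul (fun ξ ↦ φ (t * ξ)) u)‖ ≤
        A * (K * t) * ‖fourierMul (sobolevWeight t (-m)) u‖ := by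
  obtain ⟨D, hD0, hD⟩ : ∃ D, 0 ≤ D ∧ HasCommutatorBound m D h := by
    refine ⟨|C|, abs_nonneg C, fun t ht ht1 K φ hφ u ↦ (hC t ht ht1 K φ hφ u).trans ?_⟩
    have := hφ.nonneg
    gcongr
    exact le_abs_self C
  obtain ⟨L, hL⟩ : ∃ L, L = 2 ^ (m / 2) * (1 + m) := ⟨_, rfl⟩
  have hw : IsSlowlyVarying m L (sobolevWeight 1 (-m)) := hL ▸ isSlowlyVarying_sobolevWeight hm
  have hL0 := hw.nonneg
  -- At scale δt the commutator of the weight with h has size at most D L δ t. This δ makes it at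
  -- most (1 - q)/2, so that together with sup|h| ≤ q the contraction factor is r = (1 + q)/2 < 1.
  -- The choice does not depend on t.
  obtain ⟨δ, hδ0, hδ1, hδ⟩ : ∃ δ : ℝ, 0 < δ ∧ δ ≤ 1 ∧ D * L * δ ≤ (1 - q) / 2 := by
    refine ⟨min 1 ((1 - q) / 2 / (D * L + 1)), ?_, min_le_left _ _, ?_⟩
    · apply lt_min zero_lt_one
      apply div_pos (by linarith); positivity
    · calc _ ≤ D * L * ((1 - q) / 2 / (D * L + 1)) := by
            gcongr; exact min_le_right _ _
        _ = (1 - q) / 2 * (D * L / (D * L + 1)) := by ring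
        _ ≤ (1 - q) / 2 * 1 := by
            apply mul_le_mul_of_nonneg_left _ (by linarith)
            rw [div_le_one (by positivity)]; linarith
        _ = _ := mul_one _
  obtain ⟨r, hr⟩ : ∃ r, r = (1 + q) / 2 := ⟨_, rfl⟩
  refine ⟨D * (‖κ‖ / (1 - r) * δ ^ (-m)) / (1 - q), ?_, ?_⟩
  · have h1 : 0 < 1 - r := by linarith
    have h2 : 0 < 1 - q := by linarith
    positivity
  intro t ht ht1 ε hε hε1 B hB K φ hφ
  have hεL := memLp_top_of_measurable_bounded hε hε1
  have hE := norm_fourierMul_le_self hε hε1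
  have hδt : 0 < δ * t := by positivity
  have hδt1 : δ * t ≤ 1 := by nlinarith
  have hweq : (fun ξ ↦ sobolevWeight 1 (-m) (δ * t * ξ)) = sobolevWeight (δ * t) (-m) := by
    funext ξ; simp [sobolevWeight]
  have hWE : ∀ s u, ‖fourierMul (sobolevWeight s (-m)) (fourierMul ε u)‖ ≤
      ‖fourierMul (sobolevWeight s (-m)) u‖ := fun s u ↦ by
    rw [fourierMul_comm (memLp_top_sobolevWeight hm s) hεL]
    exact hE _
  have hHq := norm_mulOp_apply_le hh hhq
  -- Apply the weight W to B = κE - hBE. The commutator bound for [W,h] is again in terms of the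
  -- norm of WBEf, so it joins the contraction term and the iteration closes.
  have key1 : ∀ f, ‖fourierMul (sobolevWeight (δ * t) (-m)) (B f)‖ ≤
      ‖κ‖ / (1 - r) * ‖fourierMul (sobolevWeight (δ * t) (-m)) f‖ := by
    refine le_of_iterate_le (E := fun u ↦ fourierMul ε u)
      (K := ‖fourierMul (sobolevWeight (δ * t) (-m)) ∘L B‖) (norm_nonneg _)
      (by linarith) (by linarith) (fun f ↦ norm_nonneg _) (fun f ↦ ?_) (hWE _) (fun f ↦ ?_) hE
    · have h1 := hD (δ * t) hδt hδt1 L _ hw (B (fourierMul ε f))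
      rw [hweq] at h1
      obtain ⟨W, hW⟩ : ∃ W, W = fourierMul (sobolevWeight (δ * t) (-m)) := ⟨_, rfl⟩
      have h0 := hWE (δ * t) f
      rw [← hW] at h1 h0 ⊢
      have e : W (B f) = κ • W (fourierMul ε f) -
          (W (mulOp h (B (fourierMul ε f))) - mulOp h (W (B (fourierMul ε f)))) -
          mulOp h (W (B (fourierMul ε f))) := by
        conv_lhs => rw [hB f]
        rw [map_sub, map_smul]; abel
      rw [e]
      have h2 := hHq (W (B (fourierMul ε f)))
      have h3 : D * (L * (δ * t)) ≤ (1 - q) / 2 := by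
        calc D * (L * (δ * t)) = D * L * δ * t := by ring
          _ ≤ D * L * δ * 1 := by gcongr
          _ ≤ _ := by linarith
      have h4 : ‖κ • W (fourierMul ε f)‖ ≤ ‖κ‖ * ‖W f‖ := by
        rw [norm_smul]; gcongr
      have h5 := mul_le_mul_of_nonneg_right h3 (norm_nonneg (W (B (fourierMul ε f))))
      have h6 := norm_sub_le (κ • W (fourierMul ε f) -
          (W (mulOp h (B (fourierMul ε f))) - mulOp h (W (B (fourierMul ε f)))))
          (mulOp h (W (B (fourierMul ε f))))
      have h7 := norm_sub_le (κ • W (fourierMul ε f))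
          (W (mulOp h (B (fourierMul ε f))) - mulOp h (W (B (fourierMul ε f))))
      rw [hr]
      linarith
    · exact (fourierMul (sobolevWeight (δ * t) (-m)) ∘L B).le_opNorm f
  have key2 : ∀ f, ‖fourierMul (sobolevWeight t (-m)) (B f)‖ ≤
      ‖κ‖ / (1 - r) * δ ^ (-m) * ‖fourierMul (sobolevWeight t (-m)) f‖ := by
    intro f
    have h1 : 0 < 1 - r := by linarith
    refine (fourierMul_sobolevWeight_comparison hm hδ0 hδ1 (B f)).1.trans ((key1 f).trans ?_)
    rw [mul_assoc]
    gcongr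
    exact (fourierMul_sobolevWeight_comparison hm hδ0 hδ1 f).2
  obtain ⟨Φ, hΦ⟩ : ∃ Φ, Φ = fun ξ ↦ φ (t * ξ) := ⟨_, rfl⟩
  have hΦL : MemLp Φ ∞ volume := by
    rw [hΦ]
    exact memLp_top_of_measurable_bounded (hφ.measurable.comp (measurable_const_mul t))
      (fun ξ ↦ hφ.norm_le _)
  have hK := hφ.nonneg
  intro f
  -- The same iteration for the commutator with φ, now at scale t. The source term is [φ,h] acting
  -- on BEf, whose H^{-m}_t norm has just been bounded.
  have key3 := le_of_iterate_le (N := fun f ↦ ‖fourierMul Φ (B f) - B (fourierMul Φ f)‖)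
    (X := fun f ↦ ‖fourierMul (sobolevWeight t (-m)) f‖) (E := fun u ↦ fourierMul ε u)
    (A := D * (K * t) * (‖κ‖ / (1 - r) * δ ^ (-m))) (q := q)
    (K := ‖fourierMul Φ ∘L B - B ∘L fourierMul Φ‖) ?_ hq0 hq (fun f ↦ norm_nonneg _)
    (fun f ↦ ?_) (hWE t) (fun f ↦ ?_) hE f
  · rw [← hΦ]
    refine key3.trans (le_of_eq ?_)
    ring
  · have h1 : 0 < 1 - r := by linarith
    positivity
  · rw [fourierMul_commutator_eq hB hΦL hεL f]
    have h1 := hD t ht ht1 K φ hφ (B (fourierMul ε f))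
    rw [← hΦ] at h1
    have h2 := hHq (fourierMul Φ (B (fourierMul ε f)) - B (fourierMul Φ (fourierMul ε f)))
    have h3 := key2 (fourierMul ε f)
    have h4 : 0 ≤ ‖κ‖ / (1 - r) * δ ^ (-m) := by
      have h1 : 0 < 1 - r := by linarith
      positivity
    have h5 : D * (K * t) * ‖fourierMul (sobolevWeight t (-m)) (B (fourierMul ε f))‖ ≤
        D * (K * t) * (‖κ‖ / (1 - r) * δ ^ (-m)) * ‖fourierMul (sobolevWeight t (-m)) f‖ := by
      rw [mul_assoc (D * (K * t))]
      apply mul_le_mul_of_nonneg_left _ (by positivity)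
      exact h3.trans (mul_le_mul_of_nonneg_left (hWE t f) h4)
    refine (norm_sub_le _ _).trans ?_
    rw [norm_neg]
    linarith
  · exact (fourierMul Φ ∘L B - B ∘L fourierMul Φ).le_opNorm f

/-! ### The solution of the operator equation as a pseudodifferential operator -/

theorem fourierMul_fourierInv_toLp {φ g : ℝ → ℂ} (hφ : MemLp φ ∞ volume) (hg : MemLp g 2 volume) :
    fourierMul φ (𝓕⁻ (hg.toLp g)) =
      𝓕⁻ ((hg.mul' hφ : MemLp (fun ξ ↦ φ ξ * g ξ) 2 volume).toLp fun ξ ↦ φ ξ * g ξ) := by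
  rw [fourierMul_apply, FourierTransform.fourier_fourierInv_eq, mulOp_toLp hφ hg]

theorem integrable_cexp_mul {g : ℝ → ℂ} (hg : Integrable g) (x : ℝ) :
    Integrable fun ξ : ℝ ↦ Complex.exp (2 * Real.pi * Complex.I * x * ξ) * g ξ := by
  refine hg.bdd_mul (c := 1) (measurable_cexp_two_pi x).aestronglyMeasurable
    (Filter.Eventually.of_forall fun ξ ↦ (norm_cexp_two_pi x ξ).le)

/-- Each step applies E first and multiplication by h last. Under the Fourier integral h(x) is a
constant, so the partial sum is the quantization of a truncated geometric series in -h(x)ε(ξ). -/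
theorem neumannPartial_fourierInv_ae (κ : ℂ) {h ε : ℝ → ℂ} (hh : MemLp h ∞ volume)
    (hε : Measurable ε) (hε1 : ∀ ξ, ‖ε ξ‖ ≤ 1) (n : ℕ) :
    ∀ {g : ℝ → ℂ}, Integrable g → ∀ hg : MemLp g 2 volume,
    neumannPartial κ h ε n (𝓕⁻ (hg.toLp g)) =ᵐ[volume] fun x ↦
      𝓕⁻ (fun ξ ↦ κ * ε ξ * (∑ k ∈ Finset.range n, (-(h x * ε ξ)) ^ k) * g ξ) x := by
  have hεL := memLp_top_of_measurable_bounded hε hε1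
  induction n with
  | zero =>
    intro g hg1 hg
    filter_upwards with x
    simp [neumannPartial, Real.fourierInv_eq]
  | succ n ih =>
    intro g hg1 hg
    have hεg1 : Integrable fun ξ ↦ ε ξ * g ξ :=
      hg1.bdd_mul hε.aestronglyMeasurable (Filter.Eventually.of_forall hε1)
    have hεg : MemLp (fun ξ ↦ ε ξ * g ξ) 2 volume := hg.mul' hεL
    have h1 := ih hεg1 hεg
    have h2 := fourierInv_toLp_ae hεg1 hεg
    have e1 : neumannPartial κ h ε (n + 1) (𝓕⁻ (hg.toLp g)) =
        κ • 𝓕⁻ (hεg.toLp fun ξ ↦ ε ξ * g ξ) -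
          mulOp h (neumannPartial κ h ε n (𝓕⁻ (hεg.toLp fun ξ ↦ ε ξ * g ξ))) := by
      simp only [neumannPartial, sub_apply, smul_apply,
        ContinuousLinearMap.comp_apply]
      rw [fourierMul_fourierInv_toLp hεL hg]
    rw [e1]
    filter_upwards [h1, h2, coeFn_mulOp hh (neumannPartial κ h ε n
        (𝓕⁻ (hεg.toLp fun ξ ↦ ε ξ * g ξ))), Lp.coeFn_sub (κ • 𝓕⁻ (hεg.toLp fun ξ ↦ ε ξ * g ξ))
        (mulOp h (neumannPartial κ h ε n (𝓕⁻ (hεg.toLp fun ξ ↦ ε ξ * g ξ)))),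
      Lp.coeFn_smul κ (𝓕⁻ (hεg.toLp fun ξ ↦ ε ξ * g ξ))] with x hx1 hx2 hx3 hx4 hx5
    rw [hx4, Pi.sub_apply, hx5, hx3, Pi.smul_apply, hx1, hx2]
    simp only [fourierInv_apply_eq, smul_eq_mul]
    have hb : ∀ ξ, ‖κ * ε ξ * ∑ k ∈ Finset.range n, (-(h x * ε ξ)) ^ k‖ ≤
        ‖κ‖ * 1 * ∑ k ∈ Finset.range n, (‖h x‖ * 1) ^ k := by
      intro ξ
      rw [norm_mul, norm_mul]
      gcongr
      · exact hε1 ξ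
      · refine (norm_sum_le _ _).trans (Finset.sum_le_sum fun k _ ↦ ?_)
        rw [norm_pow, norm_neg, norm_mul]
        gcongr
        exact hε1 ξ
    have hi : Integrable fun ξ ↦ κ * ε ξ * (∑ k ∈ Finset.range n, (-(h x * ε ξ)) ^ k) *
        (ε ξ * g ξ) :=
      hεg1.bdd_mul (by fun_prop) (Filter.Eventually.of_forall hb)
    rw [← integral_const_mul, ← integral_const_mul, ← integral_sub
      ((integrable_cexp_mul hεg1 x).const_mul _) ((integrable_cexp_mul hi x).const_mul _)]
    congr 1
    funext ξ
    rw [geom_sum_succ]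
    ring

/-- Convergence in L² gives almost everywhere convergence along a subsequence, which must agree with
the pointwise limit. -/
theorem coeFn_ae_eq_of_tendsto {u : ℕ → LTwo} {v : LTwo} {F : ℕ → ℝ → ℂ} {G : ℝ → ℂ}
    (hu : Filter.Tendsto u Filter.atTop (nhds v)) (huF : ∀ n, u n =ᵐ[volume] F n)
    (hFG : ∀ᵐ x, Filter.Tendsto (fun n ↦ F n x) Filter.atTop (nhds (G x))) :
    v =ᵐ[volume] G := by
  have h1 := (tendstoInMeasure_of_tendsto_Lp hu).exists_seq_tendsto_ae
  obtain ⟨ns, hns, h2⟩ := h1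
  filter_upwards [h2, hFG, ae_all_iff.2 huF] with x hx1 hx2 hx3
  have h3 := hx2.comp hns.tendsto_atTop
  refine tendsto_nhds_unique hx1 ?_
  simpa [hx3, Function.comp_def] using h3

theorem isResolventSolution_fourierInv_ae {κ : ℂ} {h ε : ℝ → ℂ} (hh : Measurable h)
    (hε : Measurable ε) (hε1 : ∀ ξ, ‖ε ξ‖ ≤ 1) {q : ℝ} (hq : q < 1)
    (hhq : ∀ x, ‖h x‖ ≤ q) {B : LTwo →L[ℂ] LTwo}
    (hB : Filter.Tendsto (neumannPartial κ h ε) Filter.atTop (nhds B))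
    {g : ℝ → ℂ} (hg1 : Integrable g) (hg : MemLp g 2 volume) :
    B (𝓕⁻ (hg.toLp g)) =ᵐ[volume] fun x ↦
      𝓕⁻ (fun ξ ↦ κ * ε ξ / (1 + h x * ε ξ) * g ξ) x := by
  have hhL := memLp_top_of_measurable_bounded hh hhq
  have h2 : Filter.Tendsto (fun n ↦ neumannPartial κ h ε n (𝓕⁻ (hg.toLp g))) Filter.atTop
      (nhds (B (𝓕⁻ (hg.toLp g)))) :=
    ((ContinuousLinearMap.apply ℂ LTwo (𝓕⁻ (hg.toLp g))).continuous.tendsto B).comp hB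
  refine coeFn_ae_eq_of_tendsto h2 (fun n ↦ neumannPartial_fourierInv_ae κ hhL hε hε1 n hg1 hg)
    (Filter.Eventually.of_forall fun x ↦ ?_)
  have hq0 : 0 ≤ q := (norm_nonneg _).trans (hhq 0)
  have hz : ∀ ξ, ‖-(h x * ε ξ)‖ ≤ q := fun ξ ↦ by
    rw [norm_neg, norm_mul]
    calc _ ≤ q * 1 := by gcongr; exacts [hhq x, hε1 ξ]
      _ = q := mul_one q
  simp only [fourierInv_apply_eq]
  refine tendsto_integral_of_dominated_convergence
    (fun ξ ↦ ‖κ‖ * 1 * (1 - q)⁻¹ * ‖g ξ‖) (fun n ↦ ?_) (hg1.norm.const_mul _) (fun n ↦ ?_) ?_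
  · have := hg1.aestronglyMeasurable
    have := (measurable_cexp_two_pi x).aestronglyMeasurable (μ := volume)
    have h3 : AEStronglyMeasurable (fun ξ ↦ κ * ε ξ * ∑ k ∈ Finset.range n, (-(h x * ε ξ)) ^ k)
      volume := by fun_prop
    fun_prop
  · refine Filter.Eventually.of_forall fun ξ ↦ ?_
    rw [norm_mul, norm_cexp_two_pi, one_mul, norm_mul, norm_mul, norm_mul]
    gcongr
    · exact hε1 ξ
    · refine (norm_sum_le _ _).trans ?_
      simp only [norm_pow]
      calc _ ≤ ∑ k ∈ Finset.range n, q ^ k := by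
            gcongr with k _; exact hz ξ
        _ ≤ ∑' k, q ^ k := (summable_geometric_of_lt_one hq0 hq).sum_le_tsum _
            (fun k _ ↦ by positivity)
        _ = _ := tsum_geometric_of_lt_one hq0 hq
  · refine Filter.Eventually.of_forall fun ξ ↦ ?_
    have h3 := (hasSum_geometric_of_norm_lt_one ((hz ξ).trans_lt hq)).tendsto_sum_nat
    rw [sub_neg_eq_add] at h3
    rw [div_eq_mul_inv]
    exact ((h3.const_mul (κ * ε ξ)).mul_const (g ξ)).const_mul _

/-! ### Decay of oscillatory integrals -/

/-- Two integrations by parts on the half-line. Because k vanishes at 0, the boundary term of the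
first one is zero and only k'(0) g(0) remains at the second, so the decay is quadratic in x despite
the endpoint. The constant depends on g alone. -/
theorem exists_norm_integral_Ioi_le (g : 𝓢(ℝ, ℂ)) :
    ∃ C, 0 ≤ C ∧ ∀ (M : ℝ) (k k' k'' : ℝ → ℝ), (∀ l, 0 ≤ l → HasDerivAt k (k' l) l) →
      (∀ l, 0 ≤ l → HasDerivAt k' (k'' l) l) → ContinuousOn k'' (Set.Ici 0) → k 0 = 0 →
      (∀ l, 0 ≤ l → |k l| ≤ M) → (∀ l, 0 ≤ l → |k' l| ≤ M) → (∀ l, 0 ≤ l → |k'' l| ≤ M) →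
      ∀ x : ℝ, (1 + x ^ 2) * ‖∫ ξ : ℝ in Set.Ioi 0, Complex.exp (2 * Real.pi * Complex.I * x * ξ) *
        ((k ξ : ℂ) * g ξ)‖ ≤ C * M := by
  obtain ⟨g1, hg1⟩ : ∃ g1 : 𝓢(ℝ, ℂ), g1 = SchwartzMap.derivCLM ℂ ℂ g := ⟨_, rfl⟩
  obtain ⟨g2, hg2⟩ : ∃ g2 : 𝓢(ℝ, ℂ), g2 = SchwartzMap.derivCLM ℂ ℂ g1 := ⟨_, rfl⟩
  have hgd : ∀ x, HasDerivAt g (g1 x) x := fun x ↦ by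
    rw [hg1]; exact g.differentiableAt.hasDerivAt
  have hgd1 : ∀ x, HasDerivAt g1 (g2 x) x := fun x ↦ by
    rw [hg2]; exact g1.differentiableAt.hasDerivAt
  refine ⟨(∫ ξ, ‖g ξ‖) + (‖g 0‖ + ((∫ ξ, ‖g ξ‖) + 2 * (∫ ξ, ‖g1 ξ‖) + ∫ ξ, ‖g2 ξ‖)),
    by positivity, fun M k k' k'' hk hk' hk'' hk0 hb hb' hb'' x ↦ ?_⟩
  have hM : 0 ≤ M := (abs_nonneg _).trans (hb 0 le_rfl)
  have hmeas : ∀ {κ : ℝ → ℝ}, ContinuousOn κ (Set.Ici 0) →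
      AEStronglyMeasurable (fun ξ ↦ (κ ξ : ℂ)) (volume.restrict (Set.Ioi 0)) := fun h ↦
    (Complex.continuous_ofReal.comp_continuousOn
      (h.mono Set.Ioi_subset_Ici_self)).aestronglyMeasurable measurableSet_Ioi
  have hint : ∀ {κ : ℝ → ℝ} (w : 𝓢(ℝ, ℂ)), ContinuousOn κ (Set.Ici 0) →
      (∀ l, 0 ≤ l → |κ l| ≤ M) → IntegrableOn (fun ξ ↦ (κ ξ : ℂ) * w ξ) (Set.Ioi 0) :=
    fun w h1 h2 ↦ (w.integrable.integrableOn).bdd_mul (c := M) (hmeas h1)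
      (ae_restrict_of_forall_mem measurableSet_Ioi fun ξ hξ ↦ by
        rw [Complex.norm_real]; exact h2 ξ (le_of_lt hξ))
  have hnorm : ∀ {κ : ℝ → ℝ} (w : 𝓢(ℝ, ℂ)), (∀ l, 0 ≤ l → |κ l| ≤ M) →
      ‖∫ ξ : ℝ in Set.Ioi 0, Complex.exp (2 * Real.pi * Complex.I * x * ξ) *
        ((κ ξ : ℂ) * w ξ)‖ ≤ M * ∫ ξ, ‖w ξ‖ := fun {κ} w h ↦ by
    calc _ ≤ ∫ ξ in Set.Ioi 0, M * ‖w ξ‖ := by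
          apply norm_integral_le_of_norm_le (w.integrable.norm.const_mul M).integrableOn
          refine ae_restrict_of_forall_mem measurableSet_Ioi fun ξ hξ ↦ ?_
          rw [norm_mul, norm_cexp_two_pi, one_mul, norm_mul, Complex.norm_real]
          gcongr
          exact h ξ (le_of_lt hξ)
      _ ≤ ∫ ξ, M * ‖w ξ‖ := setIntegral_le_integral (w.integrable.norm.const_mul M)
          (Filter.Eventually.of_forall fun ξ ↦ by simp only [Pi.zero_apply]; positivity)
      _ = _ := integral_const_mul _ _
  have hkc : ContinuousOn k (Set.Ici 0) := fun l hl ↦ (hk l hl).continuousAt.continuousWithinAt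
  have hkc' : ContinuousOn k' (Set.Ici 0) := fun l hl ↦ (hk' l hl).continuousAt.continuousWithinAt
  have hexp : ∀ {F : ℝ → ℂ}, IntegrableOn F (Set.Ioi 0) → IntegrableOn (fun ξ : ℝ ↦
      Complex.exp (2 * Real.pi * Complex.I * x * ξ) * F ξ) (Set.Ioi 0) := fun h ↦
    h.bdd_mul (c := 1) (measurable_cexp_two_pi x).aestronglyMeasurable
      (Filter.Eventually.of_forall fun ξ ↦ (norm_cexp_two_pi x ξ).le)
  have i0 := hexp (hint g hkc hb)
  have i1 := hexp (hint g hk'' hb'')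
  have i2 := hexp (hint g1 hkc' hb')
  have i3 := hexp (hint g2 hkc hb)
  obtain ⟨z, hz⟩ : ∃ z : ℂ, z = 2 * Real.pi * Complex.I * x := ⟨_, rfl⟩
  have b0 := hnorm g hb
  have b1 := hnorm g hb''
  have b2 := hnorm g1 hb'
  have b3 := hnorm g2 hb
  have hexp1 : ∀ ξ : ℝ, ‖Complex.exp (z * ξ)‖ = 1 := fun ξ ↦ by rw [hz]; exact norm_cexp_two_pi x ξ
  have hnz : ‖z‖ ^ 2 = (2 * Real.pi * x) ^ 2 := by
    rw [hz]
    simp only [norm_mul, Complex.norm_real, Complex.norm_I, mul_one, RCLike.norm_ofNat,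
      Real.norm_eq_abs]
    rw [← abs_of_pos (zero_lt_two' ℝ), ← abs_mul, ← abs_mul, sq_abs, abs_of_pos (zero_lt_two' ℝ)]
  simp only [← hz] at i0 i1 i2 i3 b0 b1 b2 b3 ⊢
  -- With F = k g, the function exp(zξ)(zF - F') has derivative exp(zξ)(z²F - F''); this performs
  -- both integrations by parts at once.
  have hderiv : ∀ ξ ∈ Set.Ici (0 : ℝ), HasDerivAt
      (fun ξ : ℝ ↦ Complex.exp (z * ξ) * (z * ((k ξ : ℂ) * g ξ) -
        ((k' ξ : ℂ) * g ξ + (k ξ : ℂ) * g1 ξ)))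
      (z ^ 2 * (Complex.exp (z * ξ) * ((k ξ : ℂ) * g ξ)) -
        (Complex.exp (z * ξ) * ((k'' ξ : ℂ) * g ξ) +
        2 * (Complex.exp (z * ξ) * ((k' ξ : ℂ) * g1 ξ)) +
        Complex.exp (z * ξ) * ((k ξ : ℂ) * g2 ξ))) ξ := by
    intro ξ hξ
    have h1 : HasDerivAt (fun ξ : ℝ ↦ Complex.exp (z * ξ)) (Complex.exp (z * ξ) * (z * 1)) ξ :=
      ((hasDerivAt_id ξ).ofReal_comp.const_mul z).cexp
    have h2 := (hk ξ hξ).ofReal_comp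
    have h3 := (hk' ξ hξ).ofReal_comp
    have h4 := h1.fun_mul (((h2.fun_mul (hgd ξ)).const_mul z).fun_sub
      ((h3.fun_mul (hgd ξ)).fun_add (h2.fun_mul (hgd1 ξ))))
    refine h4.congr_deriv ?_
    ring
  have hlim : Filter.Tendsto (fun ξ : ℝ ↦ Complex.exp (z * ξ) * (z * ((k ξ : ℂ) * g ξ) -
        ((k' ξ : ℂ) * g ξ + (k ξ : ℂ) * g1 ξ))) Filter.atTop (nhds 0) := by
    have h0 : ∀ w : 𝓢(ℝ, ℂ), Filter.Tendsto w Filter.atTop (nhds 0) := fun w ↦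
      (w.toZeroAtInfty.zero_at_infty').mono_left atTop_le_cocompact
    have h5 : Filter.Tendsto (fun ξ ↦ ‖z‖ * (M * ‖g ξ‖) + (M * ‖g ξ‖ + M * ‖g1 ξ‖)) Filter.atTop
        (nhds (‖z‖ * (M * ‖(0 : ℂ)‖) + (M * ‖(0 : ℂ)‖ + M * ‖(0 : ℂ)‖))) :=
      (((h0 g).norm.const_mul M).const_mul _).add
        (((h0 g).norm.const_mul M).add ((h0 g1).norm.const_mul M))
    simp only [norm_zero, mul_zero, add_zero] at h5
    refine squeeze_zero_norm' ?_ h5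
    filter_upwards [Filter.eventually_ge_atTop 0] with ξ hξ
    rw [norm_mul, hexp1, one_mul]
    refine (norm_sub_le _ _).trans (add_le_add ?_ ((norm_add_le _ _).trans (add_le_add ?_ ?_)))
    · rw [norm_mul, norm_mul, Complex.norm_real]; gcongr; exact hb ξ hξ
    · rw [norm_mul, Complex.norm_real]; gcongr; exact hb' ξ hξ
    · rw [norm_mul, Complex.norm_real]; gcongr; exact hb ξ hξ
  have i12 : IntegrableOn (fun ξ : ℝ ↦ Complex.exp (z * ξ) * ((k'' ξ : ℂ) * g ξ) +
      2 * (Complex.exp (z * ξ) * ((k' ξ : ℂ) * g1 ξ))) (Set.Ioi 0) := i1.add (i2.const_mul 2)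
  have i123 : IntegrableOn (fun ξ : ℝ ↦ Complex.exp (z * ξ) * ((k'' ξ : ℂ) * g ξ) +
      2 * (Complex.exp (z * ξ) * ((k' ξ : ℂ) * g1 ξ)) +
      Complex.exp (z * ξ) * ((k ξ : ℂ) * g2 ξ)) (Set.Ioi 0) := i12.add i3
  have key := integral_Ioi_of_hasDerivAt_of_tendsto' hderiv
    ((i0.const_mul (z ^ 2)).sub i123) hlim
  rw [integral_sub (i0.const_mul (z ^ 2)) i123,
    integral_add i12 i3, integral_add i1 (i2.const_mul 2),
    integral_const_mul, integral_const_mul, hk0] at key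
  obtain ⟨I0, hI0⟩ : ∃ I0, I0 = ∫ ξ : ℝ in Set.Ioi 0, Complex.exp (z * ξ) * ((k ξ : ℂ) * g ξ) :=
    ⟨_, rfl⟩
  obtain ⟨I1, hI1⟩ : ∃ I0, I0 = ∫ ξ : ℝ in Set.Ioi 0, Complex.exp (z * ξ) * ((k'' ξ : ℂ) * g ξ) :=
    ⟨_, rfl⟩
  obtain ⟨I2, hI2⟩ : ∃ I0, I0 = ∫ ξ : ℝ in Set.Ioi 0, Complex.exp (z * ξ) * ((k' ξ : ℂ) * g1 ξ) :=
    ⟨_, rfl⟩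
  obtain ⟨I3, hI3⟩ : ∃ I0, I0 = ∫ ξ : ℝ in Set.Ioi 0, Complex.exp (z * ξ) * ((k ξ : ℂ) * g2 ξ) :=
    ⟨_, rfl⟩
  rw [← hI0, ← hI1, ← hI2, ← hI3] at key
  rw [← hI0] at b0 ⊢
  rw [← hI1] at b1
  rw [← hI2] at b2
  rw [← hI3] at b3
  have key2 : z ^ 2 * I0 = (k' 0 : ℂ) * g 0 + (I1 + 2 * I2 + I3) := by
    have e : Complex.exp (z * ((0 : ℝ) : ℂ)) = 1 := by simp
    rw [e] at key
    push_cast at key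
    linear_combination key
  have h6 : (2 * Real.pi * x) ^ 2 * ‖I0‖ ≤
      M * ‖g 0‖ + (M * (∫ ξ, ‖g ξ‖) + 2 * (M * ∫ ξ, ‖g1 ξ‖) + M * ∫ ξ, ‖g2 ξ‖) := by
    rw [← hnz, ← norm_pow, ← norm_mul, key2]
    refine (norm_add_le _ _).trans (add_le_add ?_ ((norm_add_le _ _).trans (add_le_add
      ((norm_add_le _ _).trans (add_le_add b1 ?_)) b3)))
    · rw [norm_mul, Complex.norm_real]; gcongr; exact hb' 0 le_rfl
    · rw [norm_mul]; simp only [RCLike.norm_ofNat]; gcongr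
  have h7 : x ^ 2 * ‖I0‖ ≤ (2 * Real.pi * x) ^ 2 * ‖I0‖ := by
    refine mul_le_mul_of_nonneg_right ?_ (norm_nonneg _)
    rw [mul_pow]
    have : 1 ≤ (2 * Real.pi) ^ 2 := by nlinarith [Real.pi_gt_three]
    nlinarith [sq_nonneg x]
  linarith

/-- Split the line at 0, where |ξ| is not smooth, and reflect the negative half. -/
theorem exists_norm_fourierInv_abs_le (g : 𝓢(ℝ, ℂ)) :
    ∃ C, 0 ≤ C ∧ ∀ (M : ℝ) (k k' k'' : ℝ → ℝ), (∀ l, 0 ≤ l → HasDerivAt k (k' l) l) →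
      (∀ l, 0 ≤ l → HasDerivAt k' (k'' l) l) → ContinuousOn k'' (Set.Ici 0) → k 0 = 0 →
      (∀ l, 0 ≤ l → |k l| ≤ M) → (∀ l, 0 ≤ l → |k' l| ≤ M) → (∀ l, 0 ≤ l → |k'' l| ≤ M) →
      ∀ x : ℝ, ‖𝓕⁻ (fun ξ ↦ (k |ξ| : ℂ) * g ξ) x‖ ≤ C * M / (1 + x ^ 2) := by
  obtain ⟨gr, hgr⟩ : ∃ gr : 𝓢(ℝ, ℂ), ∀ x, gr x = g (-x) :=
    ⟨SchwartzMap.compCLMOfContinuousLinearEquiv ℂ (ContinuousLinearEquiv.neg ℝ) g, fun x ↦ rfl⟩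
  obtain ⟨C1, hC1, h1⟩ := exists_norm_integral_Ioi_le g
  obtain ⟨C2, hC2, h2⟩ := exists_norm_integral_Ioi_le gr
  refine ⟨C1 + C2, by positivity, fun M k k' k'' hk hk' hk'' hk0 hb hb' hb'' x ↦ ?_⟩
  have a1 := h1 M k k' k'' hk hk' hk'' hk0 hb hb' hb'' x
  have a2 := h2 M k k' k'' hk hk' hk'' hk0 hb hb' hb'' (-x)
  have hc : Continuous fun ξ : ℝ ↦ (k |ξ| : ℂ) := by
    refine Complex.continuous_ofReal.comp ?_
    rw [← continuousOn_univ]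
    exact ContinuousOn.comp (t := Set.Ici 0)
      (fun l hl ↦ (hk l hl).continuousAt.continuousWithinAt)
      continuous_abs.continuousOn (fun x _ ↦ abs_nonneg x)
  have hi : Integrable fun ξ : ℝ ↦ Complex.exp (2 * Real.pi * Complex.I * x * ξ) *
      ((k |ξ| : ℂ) * g ξ) := by
    apply integrable_cexp_mul
    refine g.integrable.bdd_mul (c := M) hc.aestronglyMeasurable
      (Filter.Eventually.of_forall fun ξ ↦ ?_)
    rw [Complex.norm_real]; exact hb _ (abs_nonneg ξ)
  rw [fourierInv_apply_eq, ← integral_add_compl measurableSet_Ioi hi (s := Set.Ioi 0),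
    Set.compl_Ioi]
  have e1 : ∫ ξ : ℝ in Set.Ioi 0, Complex.exp (2 * Real.pi * Complex.I * x * ξ) *
      ((k |ξ| : ℂ) * g ξ) = ∫ ξ : ℝ in Set.Ioi 0, Complex.exp (2 * Real.pi * Complex.I * x * ξ) *
      ((k ξ : ℂ) * g ξ) := by
    apply setIntegral_congr_fun measurableSet_Ioi
    intro ξ hξ
    have : (0 : ℝ) < ξ := hξ
    simp only [abs_of_pos this]
  have e2 : ∫ ξ : ℝ in Set.Iic 0, Complex.exp (2 * Real.pi * Complex.I * x * ξ) *
      ((k |ξ| : ℂ) * g ξ) = ∫ ξ : ℝ in Set.Ioi 0,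
      Complex.exp (2 * Real.pi * Complex.I * (-x : ℝ) * ξ) * ((k ξ : ℂ) * gr ξ) := by
    have := integral_comp_neg_Ioi 0 (fun ξ : ℝ ↦
      Complex.exp (2 * Real.pi * Complex.I * x * ξ) * ((k |ξ| : ℂ) * g ξ))
    rw [neg_zero] at this
    rw [← this]
    apply setIntegral_congr_fun measurableSet_Ioi
    intro ξ hξ
    have : (0 : ℝ) < ξ := hξ
    simp only [abs_neg, abs_of_pos this, hgr]
    push_cast
    ring_nf
  rw [e1, e2, le_div_iff₀ (by positivity)]
  rw [neg_sq] at a2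
  have := mul_le_mul_of_nonneg_left (norm_add_le (∫ ξ : ℝ in Set.Ioi 0,
    Complex.exp (2 * Real.pi * Complex.I * x * ξ) * ((k ξ : ℂ) * g ξ)) (∫ ξ : ℝ in Set.Ioi 0,
      Complex.exp (2 * Real.pi * Complex.I * (-x : ℝ) * ξ) * ((k ξ : ℂ) * gr ξ)))
      (by positivity : 0 ≤ 1 + x ^ 2)
  rw [mul_comm]
  linarith

/-! ### The quantization of `d` maps Schwartz functions to functions with integrable Fourier
transform -/

/-- The symbol `d` as a function of the coefficient and of the modulus of the frequency. -/
def dProfile (κ l : ℝ) : ℝ := l / (1 + κ * l)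

theorem hasDerivAt_dProfile {κ t : ℝ} (hκ : 0 < κ) (ht : 0 < t) {l : ℝ} (hl : 0 ≤ l) :
    HasDerivAt (fun l ↦ dProfile κ (t * l)) (t / (1 + κ * (t * l)) ^ 2) l := by
  have h1 : HasDerivAt (fun l : ℝ ↦ t * l) t l := by simpa using (hasDerivAt_id l).const_mul t
  have h2 : 1 + κ * (t * l) ≠ 0 := by positivity
  have h3 := h1.fun_div ((h1.const_mul κ).const_add 1) h2
  refine h3.congr_deriv ?_
  congr 1
  ring

theorem hasDerivAt_dProfile_deriv {κ t : ℝ} (hκ : 0 < κ) (ht : 0 < t) {l : ℝ} (hl : 0 ≤ l) :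
    HasDerivAt (fun l ↦ t / (1 + κ * (t * l)) ^ 2) (-2 * κ * t ^ 2 / (1 + κ * (t * l)) ^ 3) l := by
  have h1 : HasDerivAt (fun l : ℝ ↦ t * l) t l := by simpa using (hasDerivAt_id l).const_mul t
  have h2 : 1 + κ * (t * l) ≠ 0 := by positivity
  have h3 := (hasDerivAt_const l t).fun_div (((h1.const_mul κ).const_add 1).fun_pow 2)
    (pow_ne_zero 2 h2)
  refine h3.congr_deriv ?_
  field_simp
  ring

theorem dProfile_bounds {k₁ k₂ κ t l : ℝ} (hk₁ : 0 < k₁) (h1 : k₁ ≤ κ) (h2 : κ ≤ k₂) (ht : 0 < t)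
    (ht1 : t ≤ 1) (hl : 0 ≤ l) :
    |dProfile κ (t * l)| ≤ k₁⁻¹ + 1 + 2 * k₂ ∧
    |t / (1 + κ * (t * l)) ^ 2| ≤ k₁⁻¹ + 1 + 2 * k₂ ∧
    |-2 * κ * t ^ 2 / (1 + κ * (t * l)) ^ 3| ≤ k₁⁻¹ + 1 + 2 * k₂ := by
  have hκ : 0 < κ := hk₁.trans_le h1
  have hk₂ : 0 < k₂ := hκ.trans_le h2
  have hk : 0 < k₁⁻¹ := by positivity
  have h3 : 1 ≤ 1 + κ * (t * l) := by have : 0 ≤ κ * (t * l) := by positivity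
                                      linarith
  refine ⟨?_, ?_, ?_⟩
  · unfold dProfile
    rw [abs_of_nonneg (by positivity)]
    have : t * l / (1 + κ * (t * l)) ≤ k₁⁻¹ := by
      rw [div_le_iff₀ (by positivity), inv_mul_eq_div, le_div_iff₀ hk₁]
      have : k₁ * (t * l) ≤ κ * (t * l) := by gcongr
      linarith
    linarith
  · rw [abs_of_nonneg (by positivity)]
    have : t / (1 + κ * (t * l)) ^ 2 ≤ 1 := by
      rw [div_le_one (by positivity)]
      exact ht1.trans (one_le_pow₀ h3)
    linarith
  · rw [abs_div, abs_of_pos (a := (1 + κ * (t * l)) ^ 3) (by positivity), abs_of_nonpos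
      (by have : 0 < κ * t ^ 2 := by positivity
          linarith)]
    have : -(-2 * κ * t ^ 2) / (1 + κ * (t * l)) ^ 3 ≤ 2 * k₂ := by
      rw [div_le_iff₀ (by positivity)]
      calc -(-2 * κ * t ^ 2) = 2 * κ * t ^ 2 := by ring
        _ ≤ 2 * k₂ * 1 := by
          gcongr; exact pow_le_one₀ ht.le ht1
        _ ≤ _ := by gcongr; exact one_le_pow₀ h3
    linarith

/-- Products of two profiles are included because the difference of `dProfile` at two coefficients
is a multiple of such a product (`dProfile_sub`). -/
theorem exists_norm_fourierInv_dProfile_le (g : 𝓢(ℝ, ℂ)) {k₁ k₂ t : ℝ} (hk₁ : 0 < k₁)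
    (hk₂ : 0 < k₂) (ht : 0 < t) (ht1 : t ≤ 1) : ∃ C, 0 ≤ C ∧
    (∀ κ, k₁ ≤ κ → κ ≤ k₂ → ∀ x,
      ‖𝓕⁻ (fun ξ ↦ (dProfile κ (t * |ξ|) : ℂ) * g ξ) x‖ ≤ C / (1 + x ^ 2)) ∧
    (∀ κ κ', k₁ ≤ κ → κ ≤ k₂ → k₁ ≤ κ' → κ' ≤ k₂ → ∀ x,
      ‖𝓕⁻ (fun ξ ↦ (dProfile κ (t * |ξ|) * dProfile κ' (t * |ξ|) : ℂ) * g ξ) x‖ ≤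
        C / (1 + x ^ 2)) := by
  obtain ⟨C, hC, h⟩ := exists_norm_fourierInv_abs_le g
  obtain ⟨M, hM⟩ : ∃ M, M = k₁⁻¹ + 1 + 2 * k₂ := ⟨_, rfl⟩
  have hM1 : 1 ≤ M := by
    have : 0 < k₁⁻¹ := by positivity
    linarith
  have hcont : ∀ κ, 0 < κ → ContinuousOn (fun l ↦ -2 * κ * t ^ 2 / (1 + κ * (t * l)) ^ 3)
      (Set.Ici 0) := fun κ hκ l hl ↦ by
    have : (1 + κ * (t * l)) ^ 3 ≠ 0 := by
      have : 0 ≤ l := hl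
      positivity
    exact ContinuousAt.continuousWithinAt (by fun_prop (disch := assumption))
  -- The second derivative of a product of two profiles consists of four terms of size at most M²;
  -- since M ≥ 1 the same constant serves a single profile.
  refine ⟨C * (4 * M ^ 2), by positivity, fun κ h1 h2 x ↦ ?_, fun κ κ' h1 h2 h1' h2' x ↦ ?_⟩
  · have hκ := hk₁.trans_le h1
    have hb := fun l hl ↦ dProfile_bounds (l := l) hk₁ h1 h2 ht ht1 hl
    refine (h M (fun l ↦ dProfile κ (t * l)) _ _ (fun l hl ↦ hasDerivAt_dProfile hκ ht hl)
      (fun l hl ↦ hasDerivAt_dProfile_deriv hκ ht hl) (hcont κ hκ) (by simp [dProfile])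
      (fun l hl ↦ hM ▸ (hb l hl).1) (fun l hl ↦ hM ▸ (hb l hl).2.1)
      (fun l hl ↦ hM ▸ (hb l hl).2.2) x).trans ?_
    gcongr
    nlinarith
  · have hκ := hk₁.trans_le h1
    have hκ' := hk₁.trans_le h1'
    have hb := fun l hl ↦ dProfile_bounds (l := l) hk₁ h1 h2 ht ht1 hl
    have hb' := fun l hl ↦ dProfile_bounds (l := l) hk₁ h1' h2' ht ht1 hl
    rw [← hM] at hb hb'
    have hd := fun l (hl : 0 ≤ l) ↦ hasDerivAt_dProfile hκ ht hl
    have hd' := fun l (hl : 0 ≤ l) ↦ hasDerivAt_dProfile hκ' ht hl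
    have hdd := fun l (hl : 0 ≤ l) ↦ hasDerivAt_dProfile_deriv hκ ht hl
    have hdd' := fun l (hl : 0 ≤ l) ↦ hasDerivAt_dProfile_deriv hκ' ht hl
    have hm : ∀ {a b : ℝ}, |a| ≤ M → |b| ≤ M → |a * b| ≤ M ^ 2 := fun ha hb ↦ by
      rw [abs_mul, sq]; gcongr
    have h0 := h (4 * M ^ 2) (fun l ↦ dProfile κ (t * l) * dProfile κ' (t * l)) _ _
      (fun l hl ↦ (hd l hl).fun_mul (hd' l hl))
      (fun l hl ↦ ((hdd l hl).fun_mul (hd' l hl)).fun_add ((hd l hl).fun_mul (hdd' l hl))) ?_ ?_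
      (fun l hl ↦ (hm (hb l hl).1 (hb' l hl).1).trans (by nlinarith)) (fun l hl ↦ ?_)
      (fun l hl ↦ ?_) x
    · push_cast at h0
      exact h0
    · have c1 : ContinuousOn (fun l ↦ dProfile κ (t * l)) (Set.Ici 0) := fun l hl ↦
        (hd l hl).continuousAt.continuousWithinAt
      have c2 : ContinuousOn (fun l ↦ dProfile κ' (t * l)) (Set.Ici 0) := fun l hl ↦
        (hd' l hl).continuousAt.continuousWithinAt
      have c3 : ContinuousOn (fun l ↦ t / (1 + κ * (t * l)) ^ 2) (Set.Ici 0) := fun l hl ↦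
        (hdd l hl).continuousAt.continuousWithinAt
      have c4 : ContinuousOn (fun l ↦ t / (1 + κ' * (t * l)) ^ 2) (Set.Ici 0) := fun l hl ↦
        (hdd' l hl).continuousAt.continuousWithinAt
      exact (((hcont κ hκ).mul c2).add (c3.mul c4)).add ((c3.mul c4).add (c1.mul (hcont κ' hκ')))
    · simp [dProfile]
    · have a1 := hm (hb l hl).2.1 (hb' l hl).1
      have a2 := hm (hb l hl).1 (hb' l hl).2.1
      refine (abs_add_le _ _).trans ?_
      nlinarith
    · have a1 := hm (hb l hl).2.2 (hb' l hl).1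
      have a2 := hm (hb l hl).1 (hb' l hl).2.2
      have a3 := hm (hb l hl).2.1 (hb' l hl).2.1
      refine (abs_add_le _ _).trans ?_
      have a4 := abs_add_le (-2 * κ * t ^ 2 / (1 + κ * (t * l)) ^ 3 * dProfile κ' (t * l))
        (t / (1 + κ * (t * l)) ^ 2 * (t / (1 + κ' * (t * l)) ^ 2))
      have a5 := abs_add_le (t / (1 + κ * (t * l)) ^ 2 * (t / (1 + κ' * (t * l)) ^ 2))
        (dProfile κ (t * l) * (-2 * κ' * t ^ 2 / (1 + κ' * (t * l)) ^ 3))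
      linarith

/-- A multiplier commutes with d/dx: the factor 2πiξ from differentiating under the integral turns 𝓕
f into the transform of f'. -/
theorem hasDerivAt_fourierInv_mul_fourier (f : 𝓢(ℝ, ℂ)) {k : ℝ → ℂ} (hk : Measurable k) {M : ℝ}
    (hM : ∀ ξ, ‖k ξ‖ ≤ M) (x : ℝ) :
    HasDerivAt (fun x ↦ 𝓕⁻ (fun ξ ↦ k ξ * (𝓕 f : 𝓢(ℝ, ℂ)) ξ) x)
      (𝓕⁻ (fun ξ ↦ k ξ * (𝓕 (SchwartzMap.derivCLM ℂ ℂ f) : 𝓢(ℝ, ℂ)) ξ) x) x := by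
  have e : ∀ ξ : ℝ, (𝓕 (SchwartzMap.derivCLM ℂ ℂ f) : 𝓢(ℝ, ℂ)) ξ =
      2 * Real.pi * Complex.I * ξ * (𝓕 f : 𝓢(ℝ, ℂ)) ξ := fun ξ ↦ by
    have h := Real.fourier_deriv (f := (f : ℝ → ℂ)) f.integrable f.differentiable
      (SchwartzMap.derivCLM ℂ ℂ f).integrable
    rw [SchwartzMap.fourier_coe, SchwartzMap.fourier_coe]
    exact congrFun h ξ
  have hb : ∀ w : 𝓢(ℝ, ℂ), Integrable fun ξ ↦ k ξ * w ξ := fun w ↦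
    w.integrable.bdd_mul hk.aestronglyMeasurable (Filter.Eventually.of_forall hM)
  have h2 : Integrable fun ξ : ℝ ↦ ξ • (k ξ * (𝓕 f : 𝓢(ℝ, ℂ)) ξ) := by
    have h3 := (hb (𝓕 (SchwartzMap.derivCLM ℂ ℂ f))).const_mul (2 * Real.pi * Complex.I)⁻¹
    refine h3.congr (Filter.Eventually.of_forall fun ξ ↦ ?_)
    simp only [e, Complex.real_smul]
    have : (2 * Real.pi * Complex.I : ℂ) ≠ 0 := Complex.two_pi_I_ne_zero
    field_simp
  have h4 := Real.hasDerivAt_fourier (hb (𝓕 f)) h2 (-x)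
  have h5 := h4.scomp x (hasDerivAt_neg x)
  simp only [Real.fourierInv_eq_fourier_neg]
  refine h5.congr_deriv ?_
  rw [fourier_apply_eq, fourier_apply_eq, neg_one_smul, ← integral_neg]
  congr 1
  funext ξ
  rw [e]
  simp only [smul_eq_mul]
  push_cast
  ring

/-! ### Regularity and decay of d(x,tD)f for a Lipschitz coefficient. -/

/-- The function `d(x, tD) f`, with `g` the Fourier transform of `f`. -/
def dQuantization (t : ℝ) (a : ℝ → ℝ) (g : ℝ → ℂ) (x : ℝ) : ℂ :=
  𝓕⁻ (fun ξ ↦ (dProfile (a x) (t * |ξ|) : ℂ) * g ξ) x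

theorem measurable_dQuantization {t : ℝ} {a : ℝ → ℝ} {g : ℝ → ℂ} (ha : Measurable a)
    (hg : Measurable g) : Measurable (dQuantization t a g) := by
  have h := measurable_fourierInv_param
    (F := fun x ξ ↦ (dProfile (a x) (t * |ξ|) : ℂ) * g ξ) (by unfold dProfile; fun_prop)
  have h2 : Measurable fun x : ℝ ↦ (x, x) := by fun_prop
  have h3 := h.comp h2
  simp only [Function.comp_def] at h3
  exact h3

theorem dProfile_sub {κ κ' l : ℝ} (hκ : 0 < κ) (hκ' : 0 < κ') (hl : 0 ≤ l) :
    dProfile κ' l - dProfile κ l = (κ - κ') * (dProfile κ l * dProfile κ' l) := by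
  have h1 : 1 + κ * l ≠ 0 := by positivity
  have h2 : 1 + κ' * l ≠ 0 := by positivity
  unfold dProfile
  field_simp
  ring

theorem measurable_ofReal_dProfile (κ t : ℝ) :
    Measurable fun ξ : ℝ ↦ (dProfile κ (t * |ξ|) : ℂ) := by
  unfold dProfile; fun_prop

theorem norm_ofReal_dProfile_le {κ l : ℝ} (hκ : 0 < κ) (hl : 0 ≤ l) :
    ‖(dProfile κ l : ℂ)‖ ≤ κ⁻¹ := by
  rw [Complex.norm_real, Real.norm_eq_abs, dProfile, abs_of_nonneg (by positivity),
    div_le_iff₀ (by positivity), inv_mul_eq_div, le_div_iff₀ hκ]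
  linarith

/-- Compare through the multiplier with the coefficient frozen at x, evaluated at x + s. Changing
the coefficient costs |a(x + s) - a(x)| times a quantized product of profiles; moving the point
costs the derivative of a frozen multiplier. Both decay like (1 + x²)⁻¹. -/
theorem norm_dQuantization_translate_sub_le {a : ℝ → ℝ} {k₁ k₂ t C L : ℝ} (f : 𝓢(ℝ, ℂ))
    (hk₁ : 0 < k₁) (ht : 0 < t) (ha1 : ∀ x, k₁ ≤ a x) (ha2 : ∀ x, a x ≤ k₂) (hC : 0 ≤ C)
    (h1 : ∀ κ, k₁ ≤ κ → κ ≤ k₂ → ∀ x, ‖𝓕⁻ (fun ξ ↦ (dProfile κ (t * |ξ|) : ℂ) *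
      (𝓕 (SchwartzMap.derivCLM ℂ ℂ f) : 𝓢(ℝ, ℂ)) ξ) x‖ ≤ C / (1 + x ^ 2))
    (h2 : ∀ κ κ', k₁ ≤ κ → κ ≤ k₂ → k₁ ≤ κ' → κ' ≤ k₂ → ∀ x,
      ‖𝓕⁻ (fun ξ ↦ (dProfile κ (t * |ξ|) * dProfile κ' (t * |ξ|) : ℂ) * (𝓕 f : 𝓢(ℝ, ℂ)) ξ) x‖ ≤
        C / (1 + x ^ 2)) {s x : ℝ} (hs : 0 < s) (hs1 : s ≤ 1)
    (hL : |a (x + s) - a x| ≤ L * s) :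
    ‖dQuantization t a (𝓕 f : 𝓢(ℝ, ℂ)) (x + s) - dQuantization t a (𝓕 f : 𝓢(ℝ, ℂ)) x‖ ≤
      s * ((L + 1) * (3 * C) * (1 + x ^ 2)⁻¹) := by
  have hpeetre : ∀ y, x ≤ y → y ≤ x + s → C / (1 + y ^ 2) ≤ 3 * C * (1 + x ^ 2)⁻¹ := by
    intro y hy1 hy2
    rw [div_le_iff₀ (by positivity)]
    have : 1 + x ^ 2 ≤ 3 * (1 + y ^ 2) := by
      nlinarith [sq_nonneg (y + (y - x)), sq_nonneg (2 * y - x)]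
    calc C = C * ((1 + x ^ 2)⁻¹ * (1 + x ^ 2)) := by
          rw [inv_mul_cancel₀ (by positivity), mul_one]
      _ ≤ C * ((1 + x ^ 2)⁻¹ * (3 * (1 + y ^ 2))) := by gcongr
      _ = _ := by ring
  have hL0 : 0 ≤ L * s := (abs_nonneg _).trans hL
  have hi : ∀ κ, 0 < κ → Integrable fun ξ ↦ (dProfile κ (t * |ξ|) : ℂ) * (𝓕 f : 𝓢(ℝ, ℂ)) ξ :=
    fun κ hκ ↦ (𝓕 f).integrable.bdd_mul (measurable_ofReal_dProfile κ t).aestronglyMeasurable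
      (Filter.Eventually.of_forall fun ξ ↦ norm_ofReal_dProfile_le hκ (by positivity))
  have p1 : 0 < a x := hk₁.trans_le (ha1 x)
  have p2 : 0 < a (x + s) := hk₁.trans_le (ha1 _)
  have e1 : dQuantization t a (𝓕 f : 𝓢(ℝ, ℂ)) (x + s) -
      𝓕⁻ (fun ξ ↦ (dProfile (a x) (t * |ξ|) : ℂ) * (𝓕 f : 𝓢(ℝ, ℂ)) ξ) (x + s) =
      ((a x - a (x + s) : ℝ) : ℂ) * 𝓕⁻ (fun ξ ↦ (dProfile (a x) (t * |ξ|) *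
        dProfile (a (x + s)) (t * |ξ|) : ℂ) * (𝓕 f : 𝓢(ℝ, ℂ)) ξ) (x + s) := by
    unfold dQuantization
    simp only [fourierInv_apply_eq]
    rw [← integral_sub (integrable_cexp_mul (hi _ p2) _) (integrable_cexp_mul (hi _ p1) _),
      ← integral_const_mul]
    congr 1
    funext ξ
    rw [← mul_sub, ← sub_mul, ← Complex.ofReal_sub, dProfile_sub p1 p2 (by positivity)]
    push_cast
    ring
  have e2 : ‖𝓕⁻ (fun ξ ↦ (dProfile (a x) (t * |ξ|) : ℂ) * (𝓕 f : 𝓢(ℝ, ℂ)) ξ) (x + s) -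
      𝓕⁻ (fun ξ ↦ (dProfile (a x) (t * |ξ|) : ℂ) * (𝓕 f : 𝓢(ℝ, ℂ)) ξ) x‖ ≤
      3 * C * (1 + x ^ 2)⁻¹ * s := by
    have h := (convex_Icc x (x + s)).norm_image_sub_le_of_norm_hasDerivWithin_le
      (fun y _ ↦ (hasDerivAt_fourierInv_mul_fourier f (measurable_ofReal_dProfile (a x) t)
        (fun ξ ↦ norm_ofReal_dProfile_le p1 (by positivity)) y).hasDerivWithinAt)
      (fun y hy ↦ (h1 _ (ha1 x) (ha2 x) y).trans (hpeetre y hy.1 hy.2))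
      (Set.left_mem_Icc.2 (by linarith)) (Set.right_mem_Icc.2 (by linarith))
    rwa [add_sub_cancel_left, Real.norm_of_nonneg hs.le] at h
  have e3 : ‖dQuantization t a (𝓕 f : 𝓢(ℝ, ℂ)) (x + s) -
      𝓕⁻ (fun ξ ↦ (dProfile (a x) (t * |ξ|) : ℂ) * (𝓕 f : 𝓢(ℝ, ℂ)) ξ) (x + s)‖ ≤
      L * s * (3 * C * (1 + x ^ 2)⁻¹) := by
    rw [e1, norm_mul, Complex.norm_real, Real.norm_eq_abs, abs_sub_comm]
    gcongr
    exact (h2 _ _ (ha1 _) (ha2 _) (ha1 _) (ha2 _) _).trans (hpeetre _ (by linarith) le_rfl)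
  have e4 := norm_add_le (dQuantization t a (𝓕 f : 𝓢(ℝ, ℂ)) (x + s) -
      𝓕⁻ (fun ξ ↦ (dProfile (a x) (t * |ξ|) : ℂ) * (𝓕 f : 𝓢(ℝ, ℂ)) ξ) (x + s))
    (𝓕⁻ (fun ξ ↦ (dProfile (a x) (t * |ξ|) : ℂ) * (𝓕 f : 𝓢(ℝ, ℂ)) ξ) (x + s) -
      dQuantization t a (𝓕 f : 𝓢(ℝ, ℂ)) x)
  rw [sub_add_sub_cancel] at e4
  refine e4.trans ((add_le_add e3 e2).trans (le_of_eq ?_))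
  ring

/-- Quadratic decay together with translation increments of size s (1 + x²)⁻¹ puts u in H¹, and
weighted Cauchy–Schwarz makes 𝓕 u integrable. The statement is qualitative: the bounds used may
depend on t and f. -/
theorem integrable_fourier_dQuantization {a : ℝ → ℝ} {k₁ k₂ t L : ℝ} (f : 𝓢(ℝ, ℂ))
    (hk₁ : 0 < k₁) (ht : 0 < t) (ht1 : t ≤ 1) (ha : Measurable a) (ha1 : ∀ x, k₁ ≤ a x)
    (ha2 : ∀ x, a x ≤ k₂)
    (hL : ∀ s, 0 < s → s ≤ 1 → ∀ᵐ x, |a (x + s) - a x| ≤ L * s) :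
    Integrable (dQuantization t a (𝓕 f : 𝓢(ℝ, ℂ))) ∧
    MemLp (dQuantization t a (𝓕 f : 𝓢(ℝ, ℂ))) 2 volume ∧
    Integrable (𝓕 (dQuantization t a (𝓕 f : 𝓢(ℝ, ℂ)))) := by
  have hk₂ : 0 < k₂ := hk₁.trans_le ((ha1 0).trans (ha2 0))
  obtain ⟨C1, hC1, h1, h2⟩ := exists_norm_fourierInv_dProfile_le (𝓕 f) hk₁ hk₂ ht ht1
  obtain ⟨C2, hC2, h3, -⟩ := exists_norm_fourierInv_dProfile_le
    (𝓕 (SchwartzMap.derivCLM ℂ ℂ f)) hk₁ hk₂ ht ht1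
  obtain ⟨u, hu⟩ : ∃ u, u = dQuantization t a (𝓕 f : 𝓢(ℝ, ℂ)) := ⟨_, rfl⟩
  have hum : Measurable u := hu ▸ measurable_dQuantization ha (𝓕 f).continuous.measurable
  have hub : ∀ x, ‖u x‖ ≤ C1 * (1 + x ^ 2)⁻¹ := fun x ↦ by
    rw [← div_eq_mul_inv, hu]; exact h1 _ (ha1 x) (ha2 x) x
  have hu1 : Integrable u := (integrable_inv_one_add_sq.const_mul C1).mono'
    hum.aestronglyMeasurable (Filter.Eventually.of_forall hub)
  have hinv : ∀ x : ℝ, (1 + x ^ 2)⁻¹ ≤ 1 := fun x ↦ inv_le_one_of_one_le₀ (by nlinarith)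
  have hu2 : MemLp u 2 volume := memLp_two_of_integrable_of_bounded (G := C1) hu1 fun x ↦
    (hub x).trans (mul_le_of_le_one_right hC1 (hinv x))
  have hinvm : Measurable fun x : ℝ ↦ (1 + x ^ 2)⁻¹ := by fun_prop
  obtain ⟨D, hD⟩ : ∃ D, D = (L + 1) * (3 * (C1 + C2)) := ⟨_, rfl⟩
  obtain ⟨W, hW⟩ : ∃ W : ℝ → ℂ, W = fun x ↦ ((D * (1 + x ^ 2)⁻¹ : ℝ) : ℂ) := ⟨_, rfl⟩
  have hWi : MemLp W 2 volume := by
    rw [hW]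
    refine memLp_two_of_integrable_of_bounded (G := |D|)
      (integrable_inv_one_add_sq.const_mul D).ofReal fun x ↦ ?_
    rw [Complex.norm_real, norm_mul, Real.norm_eq_abs, Real.norm_of_nonneg (by positivity)]
    exact mul_le_of_le_one_right (abs_nonneg D) (hinv x)
  -- The difference quotient lemma carries a parameter, taken here in a one-point space with a Dirac
  -- mass.
  have hdiff : ∀ s : ℝ, 0 < s → s ≤ 1 →
      ∫⁻ _ : Unit, (∫⁻ ζ, ‖u (ζ + s) - u ζ‖ₑ ^ 2) ∂(Measure.dirac ()) ≤
        ENNReal.ofReal s ^ 2 * ∫⁻ x, ‖W x‖ₑ ^ 2 := by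
    intro s hs hs1
    rw [lintegral_dirac, ← lintegral_const_mul' _ _ (by finiteness)]
    apply lintegral_mono_ae
    filter_upwards [hL s hs hs1] with x hx
    rw [← mul_pow]
    refine pow_le_pow_left₀ zero_le ?_ 2
    have h4 := norm_dQuantization_translate_sub_le f hk₁ ht ha1 ha2 (add_nonneg hC1 hC2)
      (fun κ hκ hκ' y ↦ (h3 κ hκ hκ' y).trans (by gcongr; linarith))
      (fun κ κ' a1 a2 a3 a4 y ↦ (h2 κ κ' a1 a2 a3 a4 y).trans (by gcongr; linarith)) hs hs1 hx
    rw [← hu, ← hD] at h4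
    refine (enorm_le_of_norm_le h4).trans ?_
    rw [ENNReal.ofReal_mul hs.le, hW, ← ofReal_norm, Complex.norm_real]
    gcongr
    exact le_abs_self _
  have hWfin : ∫⁻ x, ‖W x‖ₑ ^ 2 ≠ ⊤ := by
    rw [lintegral_enorm_sq_eq hWi]; finiteness
  have h5 := lintegral_sq_mul_fourier_le (α := Unit) (u := fun _ ↦ u) (by fun_prop)
    (fun _ ↦ hu1) (fun _ ↦ hu2) hdiff
  rw [lintegral_dirac] at h5
  have hFm : Measurable (𝓕 u) := (continuous_fourier_of_integrable hu1).measurable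
  have h6 := lintegral_enorm_sq_le_weighted hFm
  have h7 : ∫⁻ y : ℝ, ENNReal.ofReal (1 + y ^ 2) * ‖𝓕 u y‖ₑ ^ 2 ≤
      (∫⁻ y, ‖𝓕 u y‖ₑ ^ 2) + ∫⁻ x, ‖W x‖ₑ ^ 2 := by
    refine le_trans ?_ (add_le_add_right h5 _)
    rw [← lintegral_add_left (by fun_prop)]
    refine lintegral_mono fun y ↦ ?_
    rw [← one_add_mul]
    refine mul_le_mul_left ?_ _
    rw [ENNReal.ofReal_add zero_le_one (by positivity), ENNReal.ofReal_one]
    refine add_le_add_right (ENNReal.ofReal_le_ofReal (sq_le_sq.2 ?_)) _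
    have : |y| ≤ |2 * Real.pi * y| := by
      rw [abs_mul, abs_of_pos Real.two_pi_pos]
      nlinarith [Real.pi_gt_three, abs_nonneg y]
    exact this
  rw [lintegral_enorm_fourier_sq hu1 hu2, lintegral_enorm_sq_eq hu2] at h7
  rw [← hu]
  refine ⟨hu1, hu2, hFm.aestronglyMeasurable, ?_⟩
  have h8 : (∫⁻ y, ‖𝓕 u y‖ₑ) ^ 2 ≠ ⊤ :=
    ne_top_of_le_ne_top (ENNReal.mul_ne_top (by finiteness)
      (ne_top_of_le_ne_top (ENNReal.add_ne_top.2 ⟨by finiteness, hWfin⟩) h7)) h6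
  rw [hasFiniteIntegral_iff_enorm, lt_top_iff_ne_top]
  intro h9
  rw [h9] at h8
  exact h8 (by simp)

/-! ### The symbol `p⁻¹` and its derivative in the coefficient -/

/-- The symbol `p⁻¹` as a function of the coefficient and of the modulus of the frequency. -/
def pInvProfile (κ l : ℝ) : ℝ := (1 + κ * l) ^ (-κ⁻¹)

/-- The derivative of `pInvProfile` in the coefficient. -/
def pInvProfileDeriv (κ l : ℝ) : ℝ :=
  pInvProfile κ l * (Real.log (1 + κ * l) / κ ^ 2 - l / (κ * (1 + κ * l)))

theorem hasDerivAt_pInvProfile_coeff {κ l : ℝ} (hκ : 0 < κ) (hl : 0 ≤ l) :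
    HasDerivAt (fun κ ↦ pInvProfile κ l) (pInvProfileDeriv κ l) κ := by
  have h0 : 0 < 1 + κ * l := by positivity
  have h1 : HasDerivAt (fun κ : ℝ ↦ 1 + κ * l) l κ := by
    simpa using ((hasDerivAt_id κ).mul_const l).const_add 1
  have h2 : HasDerivAt (fun κ : ℝ ↦ -κ⁻¹) (κ ^ 2)⁻¹ κ := by
    simpa using (hasDerivAt_inv hκ.ne').fun_neg
  refine (h1.rpow h2 h0).congr_deriv ?_
  unfold pInvProfileDeriv pInvProfile
  rw [Real.rpow_sub_one h0.ne']
  field_simp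
  ring

theorem hasDerivAt_pInvProfile {κ l : ℝ} (hκ : 0 < κ) (hl : 0 ≤ l) :
    HasDerivAt (fun l ↦ pInvProfile κ l) (-(1 + κ * l) ^ (-(κ⁻¹ + 1))) l := by
  have h0 : 0 < 1 + κ * l := by positivity
  have h1 : HasDerivAt (fun l : ℝ ↦ 1 + κ * l) κ l := by
    simpa using ((hasDerivAt_id l).const_mul κ).const_add 1
  refine (h1.rpow_const (p := -κ⁻¹) (Or.inl h0.ne')).congr_deriv ?_
  rw [neg_add', mul_neg, mul_inv_cancel₀ hκ.ne', neg_one_mul]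

theorem hasDerivAt_pInvProfileDeriv {κ l : ℝ} (hκ : 0 < κ) (hl : 0 ≤ l) :
    HasDerivAt (fun l ↦ pInvProfileDeriv κ l)
      (-((1 + κ * l) ^ (-(κ⁻¹ + 1)) * (Real.log (1 + κ * l) / κ ^ 2 -
        (κ⁻¹ + 1) * (l / (1 + κ * l))))) l := by
  have h0 : 0 < 1 + κ * l := by positivity
  have h1 : HasDerivAt (fun l : ℝ ↦ 1 + κ * l) κ l := by
    simpa using ((hasDerivAt_id l).const_mul κ).const_add 1
  have h2 := (h1.log h0.ne').div_const (κ ^ 2)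
  have h3 := (hasDerivAt_id l).fun_div (h1.const_mul κ) (by positivity)
  refine ((hasDerivAt_pInvProfile hκ hl).fun_mul (h2.fun_sub h3)).congr_deriv ?_
  have e : pInvProfile κ l = (1 + κ * l) ^ (-(κ⁻¹ + 1)) * (1 + κ * l) := by
    rw [pInvProfile, ← Real.rpow_add_one h0.ne']; congr 1; ring
  rw [e]
  simp only [id]
  field_simp
  ring

theorem one_add_mul_rpow_neg_le {m k₁ κ l : ℝ} (hm : 0 ≤ m) (hk₁ : 0 < k₁) (h1 : k₁ ≤ κ)
    (hl : 0 ≤ l) :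
    (1 + κ * l) ^ (-m) ≤ (min 1 k₁) ^ (-m) * (1 + l ^ 2) ^ (-m / 2) := by
  have hμ : 0 < min 1 k₁ := lt_min zero_lt_one hk₁
  have h2 : min 1 k₁ * (1 + l ^ 2) ^ (1 / 2 : ℝ) ≤ 1 + κ * l := by
    have h3 : (1 + l ^ 2) ^ (1 / 2 : ℝ) ≤ 1 + l := by
      rw [← Real.sqrt_eq_rpow]
      apply Real.sqrt_le_iff.2 ⟨by positivity, by nlinarith⟩
    calc _ ≤ min 1 k₁ * (1 + l) := by gcongr
      _ = min 1 k₁ + min 1 k₁ * l := by ring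
      _ ≤ 1 + κ * l := by
        gcongr
        · exact min_le_left _ _
        · exact (min_le_right _ _).trans h1
  have h4 := Real.rpow_le_rpow_of_nonpos (by positivity) h2 (neg_nonpos.2 hm)
  rw [Real.mul_rpow hμ.le (by positivity), ← Real.rpow_mul (by positivity)] at h4
  refine h4.trans (le_of_eq ?_)
  congr 2
  ring

/-- The l-derivative of the profile is a power with exponent -(1/κ + 1), and 1/κ + 1 ≥ 1 + 1/k₂ > m.
Differentiating in κ adds a logarithm, which is absorbed by the surplus δ = 1 + 1/k₂ - m; hence the
strict inequality. For the boundedness of the κ-derivative the whole power (1 + κl)^(-1/κ) is spent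
on the logarithm. -/
theorem exists_isSlowlyVarying_pInvProfile {m k₁ k₂ : ℝ} (hm : 0 ≤ m) (hk₁ : 0 < k₁)
    (hmk : m < 1 + k₂⁻¹) :
    ∃ K, 0 ≤ K ∧ ∀ κ, k₁ ≤ κ → κ ≤ k₂ →
      IsSlowlyVarying m K (fun ξ ↦ (pInvProfile κ |ξ| : ℂ)) ∧
      IsSlowlyVarying m K (fun ξ ↦ (pInvProfileDeriv κ |ξ| : ℂ)) := by
  by_cases hk : k₁ ≤ k₂
  swap
  · exact ⟨0, le_rfl, fun κ h1 h2 ↦ absurd (h1.trans h2) hk⟩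
  have hk₂ : 0 < k₂ := hk₁.trans_le hk
  obtain ⟨ρ, hρ⟩ : ∃ ρ, ρ = (min 1 k₁) ^ (-m) := ⟨_, rfl⟩
  have hρ0 : 0 < ρ := by
    have : 0 < min 1 k₁ := lt_min zero_lt_one hk₁
    rw [hρ]; positivity
  obtain ⟨δ, hδ⟩ : ∃ δ, δ = 1 + k₂⁻¹ - m := ⟨_, rfl⟩
  have hδ0 : 0 < δ := by linarith
  obtain ⟨A, hA⟩ : ∃ A, A = k₂ / k₁ ^ 2 + 1 / k₁ ^ 2 := ⟨_, rfl⟩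
  obtain ⟨D, hD⟩ : ∃ D, D = 1 / δ / k₁ ^ 2 + (k₁⁻¹ + 1) * (1 / k₁) := ⟨_, rfl⟩
  have hA0 : 0 < A := by rw [hA]; positivity
  have hD0 : 0 < D := by rw [hD]; positivity
  refine ⟨2 ^ (m / 2) * (1 + ρ + A + D * ρ), by positivity, fun κ h1 h2 ↦ ?_⟩
  have hκ : 0 < κ := hk₁.trans_le h1
  have hy : ∀ l, 0 ≤ l → 1 ≤ 1 + κ * l := fun l hl ↦ by
    have : 0 ≤ κ * l := by positivity
    linarith
  have hrat : ∀ l, 0 ≤ l → l / (1 + κ * l) ≤ 1 / k₁ := fun l hl ↦ by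
    have := hy l hl
    rw [div_le_div_iff₀ (by positivity) hk₁]
    nlinarith
  have hpow : ∀ l, 0 ≤ l → ∀ p, m ≤ p → (1 + κ * l) ^ (-p) ≤ ρ * (1 + l ^ 2) ^ (-m / 2) :=
    fun l hl p hp ↦ by
      rw [hρ]
      refine le_trans ?_ (one_add_mul_rpow_neg_le hm hk₁ h1 hl)
      exact Real.rpow_le_rpow_of_exponent_le (hy l hl) (by linarith)
  have hinv : k₂⁻¹ ≤ κ⁻¹ := inv_anti₀ hκ h2
  have hF1 : ∀ l, 0 ≤ l → pInvProfile κ l ≤ 1 := fun l hl ↦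
    Real.rpow_le_one_of_one_le_of_nonpos (hy l hl) (by simp [hκ.le])
  have hF0 : ∀ l, 0 ≤ l → 0 < pInvProfile κ l := fun l hl ↦
    Real.rpow_pos_of_pos (by linarith [hy l hl]) _
  constructor
  · refine isSlowlyVarying_of_hasDerivWithinAt hm
      (fun l hl ↦ (hasDerivAt_pInvProfile hκ hl).hasDerivWithinAt) (fun l hl ↦ ?_) fun l hl ↦ ?_
    · rw [abs_of_pos (hF0 l hl)]
      have : 0 ≤ D * ρ := by positivity
      linarith [hF1 l hl]
    · have h0 : 0 < 1 + κ * l := by linarith [hy l hl]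
      rw [abs_neg, abs_of_pos (by positivity)]
      refine (hpow l hl _ (by linarith)).trans ?_
      have : 0 ≤ D * ρ := by positivity
      gcongr
      linarith
  · refine isSlowlyVarying_of_hasDerivWithinAt hm
      (fun l hl ↦ (hasDerivAt_pInvProfileDeriv hκ hl).hasDerivWithinAt) (fun l hl ↦ ?_)
      fun l hl ↦ ?_
    · have h0 : 0 < 1 + κ * l := by linarith [hy l hl]
      have hlog0 : 0 ≤ Real.log (1 + κ * l) := Real.log_nonneg (hy l hl)
      have hlog : pInvProfile κ l * Real.log (1 + κ * l) ≤ k₂ := by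
        have h3 := Real.log_le_rpow_div h0.le (inv_pos.2 hκ)
        calc _ ≤ pInvProfile κ l * ((1 + κ * l) ^ κ⁻¹ / κ⁻¹) := by
              gcongr; exact (hF0 l hl).le
          _ = κ := by
              rw [pInvProfile, mul_div_assoc', ← Real.rpow_add h0]
              simp
          _ ≤ k₂ := h2
      have hA1 : |pInvProfileDeriv κ l| ≤ A := by
        have e : pInvProfileDeriv κ l = pInvProfile κ l * Real.log (1 + κ * l) / κ ^ 2 -
            pInvProfile κ l * (l / (1 + κ * l)) / κ := by
          unfold pInvProfileDeriv; field_simp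
        rw [e, hA]
        refine (abs_sub _ _).trans (add_le_add ?_ ?_)
        · rw [abs_of_nonneg (div_nonneg (mul_nonneg (hF0 l hl).le hlog0) (by positivity))]
          gcongr
        · rw [abs_of_nonneg (div_nonneg (mul_nonneg (hF0 l hl).le (by positivity)) hκ.le)]
          have hr := hrat l hl
          have hr0 : 0 ≤ l / (1 + κ * l) := by positivity
          generalize l / (1 + κ * l) = r at hr hr0 ⊢
          calc _ ≤ 1 * (1 / k₁) / k₁ := by
                gcongr
                exact hF1 l hl
            _ = _ := by field_simp
      have : 0 ≤ D * ρ := by positivity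
      linarith
    · have h0 : 0 < 1 + κ * l := by linarith [hy l hl]
      have hlog0 : 0 ≤ Real.log (1 + κ * l) := Real.log_nonneg (hy l hl)
      have hP : 0 < (1 + κ * l) ^ (-(κ⁻¹ + 1)) := by positivity
      have hlog : (1 + κ * l) ^ (-(κ⁻¹ + 1)) * Real.log (1 + κ * l) ≤
          1 / δ * (ρ * (1 + l ^ 2) ^ (-m / 2)) := by
        have h3 := Real.log_le_rpow_div h0.le hδ0
        calc _ ≤ (1 + κ * l) ^ (-(κ⁻¹ + 1)) * ((1 + κ * l) ^ δ / δ) := by gcongr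
          _ = 1 / δ * (1 + κ * l) ^ (-(κ⁻¹ + 1 - δ)) := by
              rw [mul_div_assoc', ← Real.rpow_add h0]
              rw [show -(κ⁻¹ + 1) + δ = -(κ⁻¹ + 1 - δ) by ring]
              ring
          _ ≤ _ := by
              gcongr
              exact hpow l hl _ (by linarith)
      have hP1 := hpow l hl (κ⁻¹ + 1) (by linarith)
      have hS : 0 ≤ (1 + l ^ 2) ^ (-m / 2) := by positivity
      have hD1 : |(1 + κ * l) ^ (-(κ⁻¹ + 1)) * (Real.log (1 + κ * l) / κ ^ 2 -
          (κ⁻¹ + 1) * (l / (1 + κ * l)))| ≤ D * (ρ * (1 + l ^ 2) ^ (-m / 2)) := by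
        have e : (1 + κ * l) ^ (-(κ⁻¹ + 1)) * (Real.log (1 + κ * l) / κ ^ 2 -
            (κ⁻¹ + 1) * (l / (1 + κ * l))) =
            (1 + κ * l) ^ (-(κ⁻¹ + 1)) * Real.log (1 + κ * l) / κ ^ 2 -
            (κ⁻¹ + 1) * (l / (1 + κ * l)) * (1 + κ * l) ^ (-(κ⁻¹ + 1)) := by ring
        rw [e, hD, add_mul (1 / δ / k₁ ^ 2)]
        refine (abs_sub _ _).trans (add_le_add ?_ ?_)
        · rw [abs_of_nonneg (by positivity), div_mul_eq_mul_div]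
          gcongr
        · rw [abs_of_nonneg (by positivity)]
          have hr := hrat l hl
          have hr0 : 0 ≤ l / (1 + κ * l) := by positivity
          generalize l / (1 + κ * l) = r at hr hr0 ⊢
          gcongr
      rw [abs_neg]
      refine hD1.trans ?_
      rw [← mul_assoc]
      gcongr
      linarith

/-! ### Superposition over the values of the coefficient -/

theorem norm_pInvProfile_le {κ l : ℝ} (hκ : 0 < κ) (hl : 0 ≤ l) :
    ‖(pInvProfile κ l : ℂ)‖ ≤ 1 := by
  have h0 : 0 ≤ κ * l := by positivity
  rw [Complex.norm_real, Real.norm_eq_abs, pInvProfile, abs_of_nonneg (by positivity)]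
  exact Real.rpow_le_one_of_one_le_of_nonpos (by linarith) (by simp [hκ.le])

theorem measurable_pInvProfile_prod {β : Type*} [MeasurableSpace β] {a b : β → ℝ}
    (ha : Measurable a) (hb : Measurable b) :
    Measurable fun p ↦ (pInvProfile (a p) (b p) : ℂ) := by
  unfold pInvProfile; fun_prop

theorem measurable_pInvProfileDeriv_prod {β : Type*} [MeasurableSpace β] {a b : β → ℝ}
    (ha : Measurable a) (hb : Measurable b) :
    Measurable fun p ↦ (pInvProfileDeriv (a p) (b p) : ℂ) := by
  unfold pInvProfileDeriv pInvProfile; fun_prop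

theorem continuousOn_pInvProfileDeriv_coeff {l : ℝ} (hl : 0 ≤ l) :
    ContinuousOn (fun κ ↦ pInvProfileDeriv κ l) (Set.Ioi 0) := by
  intro κ hκ
  have hκ0 : 0 < κ := hκ
  have h0 : 1 + κ * l ≠ 0 := by positivity
  refine ContinuousAt.continuousWithinAt ?_
  unfold pInvProfileDeriv
  refine ContinuousAt.mul (hasDerivAt_pInvProfile_coeff hκ0 hl).continuousAt ?_
  have h1 : κ ^ 2 ≠ 0 := by positivity
  have h2 : κ * (1 + κ * l) ≠ 0 := by positivity
  fun_prop (disch := assumption)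

/-- Fundamental theorem of calculus in the coefficient, then Fubini. Enlarging the integration to
all of [k₁, k₂] makes the right side independent of κ, so κ can afterwards be replaced by a(x). -/
theorem enorm_fourierInv_pInvProfile_le {k₁ k₂ κ t K : ℝ} (hk₁ : 0 < k₁) (h1 : k₁ ≤ κ)
    (h2 : κ ≤ k₂) (ht : 0 < t)
    (hK : ∀ κ, k₁ ≤ κ → κ ≤ k₂ → ∀ ξ : ℝ, ‖(pInvProfileDeriv κ |ξ| : ℂ)‖ ≤ K)
    {r : ℝ → ℂ} (hr : Integrable r) (x : ℝ) :
    ‖𝓕⁻ (fun ξ ↦ (pInvProfile κ (t * |ξ|) : ℂ) * r ξ) x‖ₑ ≤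
      ‖𝓕⁻ (fun ξ ↦ (pInvProfile k₁ (t * |ξ|) : ℂ) * r ξ) x‖ₑ +
      ∫⁻ κ in Set.Icc k₁ k₂, ‖𝓕⁻ (fun ξ ↦ (pInvProfileDeriv κ (t * |ξ|) : ℂ) * r ξ) x‖ₑ := by
  have hK' : ∀ κ, k₁ ≤ κ → κ ≤ k₂ → ∀ ξ : ℝ, ‖(pInvProfileDeriv κ (t * |ξ|) : ℂ)‖ ≤ K := by
    intro κ a1 a2 ξ
    have := hK κ a1 a2 (t * ξ)
    rwa [abs_mul, abs_of_pos ht] at this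
  have hi : ∀ κ, k₁ ≤ κ → Integrable fun ξ ↦ (pInvProfile κ (t * |ξ|) : ℂ) * r ξ := fun κ hκ ↦
    hr.bdd_mul (measurable_pInvProfile_prod (by fun_prop) (by fun_prop)).aestronglyMeasurable
      (Filter.Eventually.of_forall fun ξ ↦ norm_pInvProfile_le (hk₁.trans_le hκ) (by positivity))
  have hftc : ∀ ξ : ℝ, (pInvProfile κ (t * |ξ|) : ℂ) - (pInvProfile k₁ (t * |ξ|) : ℂ) =
      ∫ s in Set.Ioc k₁ κ, (pInvProfileDeriv s (t * |ξ|) : ℂ) := by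
    intro ξ
    have hl : 0 ≤ t * |ξ| := by positivity
    have hpos : ∀ s ∈ Set.uIcc k₁ κ, 0 < s := fun s hs ↦ by
      rw [Set.uIcc_of_le h1] at hs; exact hk₁.trans_le hs.1
    have h3 := intervalIntegral.integral_eq_sub_of_hasDerivAt
      (fun s hs ↦ hasDerivAt_pInvProfile_coeff (hpos s hs) hl)
      (((continuousOn_pInvProfileDeriv_coeff hl).mono hpos).intervalIntegrable)
    rw [← Complex.ofReal_sub, ← h3, intervalIntegral.integral_of_le h1]
    exact integral_ofReal.symm
  have hswap : 𝓕⁻ (fun ξ ↦ (pInvProfile κ (t * |ξ|) : ℂ) * r ξ) x =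
      𝓕⁻ (fun ξ ↦ (pInvProfile k₁ (t * |ξ|) : ℂ) * r ξ) x +
      ∫ s in Set.Ioc k₁ κ, 𝓕⁻ (fun ξ ↦ (pInvProfileDeriv s (t * |ξ|) : ℂ) * r ξ) x := by
    rw [← sub_eq_iff_eq_add']
    simp only [fourierInv_apply_eq]
    rw [← integral_sub (integrable_cexp_mul (hi κ h1) x) (integrable_cexp_mul (hi k₁ le_rfl) x),
      integral_integral_swap]
    · congr 1
      funext ξ
      rw [← mul_sub, ← sub_mul, hftc, ← integral_mul_const, ← integral_const_mul]
    · have hr2 : Integrable (fun p : ℝ × ℝ ↦ K * ‖r p.2‖)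
          ((volume.restrict (Set.Ioc k₁ κ)).prod volume) :=
        (hr.norm.const_mul K).comp_snd _
      refine hr2.mono' ?_ ?_
      · have c1 : Measurable fun p : ℝ × ℝ ↦ Complex.exp (2 * Real.pi * Complex.I * x * p.2) := by
          fun_prop
        have c2 : Measurable fun p : ℝ × ℝ ↦ (pInvProfileDeriv p.1 (t * |p.2|) : ℂ) :=
          measurable_pInvProfileDeriv_prod (by fun_prop) (by fun_prop)
        have c3 : AEStronglyMeasurable (fun p : ℝ × ℝ ↦ r p.2)
            ((volume.restrict (Set.Ioc k₁ κ)).prod volume) := hr.1.comp_snd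
        exact c1.aestronglyMeasurable.mul (c2.aestronglyMeasurable.mul c3)
      · have hae : ∀ᵐ p ∂((volume.restrict (Set.Ioc k₁ κ)).prod (volume : Measure ℝ)),
            p.1 ∈ Set.Ioc k₁ κ :=
          Measure.quasiMeasurePreserving_fst.ae (ae_restrict_mem measurableSet_Ioc)
        filter_upwards [hae] with p hp
        simp only [Function.uncurry]
        rw [norm_mul, norm_cexp_two_pi, one_mul, norm_mul]
        gcongr
        exact hK' _ hp.1.le (hp.2.trans h2) _
  rw [hswap]
  refine (enorm_add_le _ _).trans (add_le_add_right ((enorm_integral_le_lintegral _).trans ?_) _)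
  exact lintegral_mono_set fun s hs ↦ ⟨hs.1.le, hs.2.trans h2⟩

/-- Bounds for frozen coefficients imply the bound for the variable one. In the constant, the 2's
come from (b + c)² ≤ 2b² + 2c², one factor k₂ - k₁ from Cauchy–Schwarz in κ and the other from
integrating the frozen bound over κ. -/
theorem lintegral_fourierInv_pInvProfile_sq_le {k₁ k₂ t K : ℝ} (hk₁ : 0 < k₁) (hk : k₁ ≤ k₂)
    (ht : 0 < t)
    (hK : ∀ κ, k₁ ≤ κ → κ ≤ k₂ → ∀ ξ : ℝ, ‖(pInvProfileDeriv κ |ξ| : ℂ)‖ ≤ K)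
    {a : ℝ → ℝ} (ha1 : ∀ x, k₁ ≤ a x) (ha2 : ∀ x, a x ≤ k₂)
    {r : ℝ → ℝ → ℂ} (hrm : Measurable fun p : ℝ × ℝ ↦ r p.1 p.2) (hr : ∀ x, Integrable (r x))
    {M : ℝ≥0∞} (hM1 : ∫⁻ x, ‖𝓕⁻ (fun ξ ↦ (pInvProfile k₁ (t * |ξ|) : ℂ) * r x ξ) x‖ₑ ^ 2 ≤ M)
    (hM2 : ∀ κ, k₁ ≤ κ → κ ≤ k₂ →
      ∫⁻ x, ‖𝓕⁻ (fun ξ ↦ (pInvProfileDeriv κ (t * |ξ|) : ℂ) * r x ξ) x‖ₑ ^ 2 ≤ M) :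
    ∫⁻ x, ‖𝓕⁻ (fun ξ ↦ (pInvProfile (a x) (t * |ξ|) : ℂ) * r x ξ) x‖ₑ ^ 2 ≤
      ENNReal.ofReal (2 + 2 * (k₂ - k₁) ^ 2) * M := by
  obtain ⟨P, hP⟩ : ∃ P : ℝ → ℝ≥0∞,
      P = fun x ↦ ‖𝓕⁻ (fun ξ ↦ (pInvProfile k₁ (t * |ξ|) : ℂ) * r x ξ) x‖ₑ := ⟨_, rfl⟩
  obtain ⟨Q, hQ⟩ : ∃ Q : ℝ → ℝ → ℝ≥0∞,
      Q = fun x κ ↦ ‖𝓕⁻ (fun ξ ↦ (pInvProfileDeriv κ (t * |ξ|) : ℂ) * r x ξ) x‖ₑ := ⟨_, rfl⟩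
  have hPm : Measurable P := by
    have h1 : Measurable fun p : ℝ × ℝ ↦ (pInvProfile k₁ (t * |p.2|) : ℂ) * r p.1 p.2 :=
      (measurable_pInvProfile_prod (by fun_prop) (by fun_prop)).mul hrm
    have h2 := measurable_fourierInv_param
      (F := fun x ξ ↦ (pInvProfile k₁ (t * |ξ|) : ℂ) * r x ξ) h1
    have h3 : Measurable fun x : ℝ ↦ (x, x) := by fun_prop
    have h4 := (h2.comp h3).enorm
    simp only [Function.comp_def] at h4
    rw [hP]; exact h4
  have hQm : Measurable fun p : ℝ × ℝ ↦ Q p.1 p.2 := by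
    have h0 : Measurable fun q : (ℝ × ℝ) × ℝ ↦ r q.1.1 q.2 :=
      hrm.comp (by fun_prop : Measurable fun q : (ℝ × ℝ) × ℝ ↦ (q.1.1, q.2))
    have h1 : Measurable fun q : (ℝ × ℝ) × ℝ ↦
        (pInvProfileDeriv q.1.2 (t * |q.2|) : ℂ) * r q.1.1 q.2 :=
      (measurable_pInvProfileDeriv_prod (by fun_prop) (by fun_prop)).mul h0
    have h2 := measurable_fourierInv_param
      (F := fun (p : ℝ × ℝ) ξ ↦ (pInvProfileDeriv p.2 (t * |ξ|) : ℂ) * r p.1 ξ) h1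
    have h3 : Measurable fun p : ℝ × ℝ ↦ (p.1, p) := by fun_prop
    have h4 := (h2.comp h3).enorm
    simp only [Function.comp_def] at h4
    rw [hQ]; exact h4
  have hPM : ∫⁻ x, P x ^ 2 ≤ M := by rw [hP]; exact hM1
  have hQM : ∀ κ ∈ Set.Icc k₁ k₂, ∫⁻ x, Q x κ ^ 2 ≤ M := fun κ hκ ↦ by
    rw [hQ]; exact hM2 κ hκ.1 hκ.2
  have hpt : ∀ x, ‖𝓕⁻ (fun ξ ↦ (pInvProfile (a x) (t * |ξ|) : ℂ) * r x ξ) x‖ₑ ^ 2 ≤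
      2 * P x ^ 2 + 2 * (ENNReal.ofReal (k₂ - k₁) * ∫⁻ κ in Set.Icc k₁ k₂, Q x κ ^ 2) := by
    intro x
    have h1 := enorm_fourierInv_pInvProfile_le hk₁ (ha1 x) (ha2 x) ht hK (hr x) x
    have h2 := pow_le_pow_left₀ zero_le h1 2
    refine h2.trans ?_
    have h3 : ∀ b c : ℝ≥0∞, (b + c) ^ 2 ≤ 2 * b ^ 2 + 2 * c ^ 2 := fun b c ↦ by
      have h4 := ENNReal.rpow_add_le_mul_rpow_add_rpow b c (p := 2) (by norm_num)
      norm_num at h4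
      rwa [mul_add] at h4
    refine (h3 _ _).trans ?_
    have h5 : (∫⁻ κ in Set.Icc k₁ k₂, Q x κ) ^ 2 ≤
        ENNReal.ofReal (k₂ - k₁) * ∫⁻ κ in Set.Icc k₁ k₂, Q x κ ^ 2 := by
      have h6 := lintegral_mul_sq_le (μ := volume.restrict (Set.Icc k₁ k₂)) (f := fun _ ↦ 1)
        (g := Q x) aemeasurable_const (hQm.comp measurable_prodMk_left).aemeasurable
      simpa using h6
    rw [hP]
    rw [hQ] at h5 ⊢
    exact add_le_add_right (mul_le_mul_right h5 _) _
  refine (lintegral_mono hpt).trans ?_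
  have hQ2 : ∫⁻ x, (∫⁻ κ in Set.Icc k₁ k₂, Q x κ ^ 2) ≤ M * ENNReal.ofReal (k₂ - k₁) := by
    rw [lintegral_lintegral_swap (hQm.pow_const 2).aemeasurable]
    calc _ ≤ ∫⁻ κ in Set.Icc k₁ k₂, M :=
          setLIntegral_mono' measurableSet_Icc fun κ hκ ↦ hQM κ hκ
      _ = _ := by simp
  have hm1 : Measurable fun x ↦ ∫⁻ κ in Set.Icc k₁ k₂, Q x κ ^ 2 :=
    (hQm.pow_const 2).lintegral_prod_right'
  rw [lintegral_add_left (by fun_prop), lintegral_const_mul _ (by fun_prop),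
    lintegral_const_mul _ (by fun_prop), lintegral_const_mul _ hm1]
  have hd : 0 ≤ k₂ - k₁ := by linarith
  calc _ ≤ 2 * M + 2 * (ENNReal.ofReal (k₂ - k₁) * (M * ENNReal.ofReal (k₂ - k₁))) := by gcongr
    _ = _ := by
      rw [ENNReal.ofReal_add (by norm_num) (by positivity), ENNReal.ofReal_mul (by norm_num),
        ENNReal.ofReal_pow hd, ENNReal.ofReal_ofNat]
      ring

/-! ### The semicommutator for an admissible coefficient -/

/-- Coefficients with values in `[k₁, k₂]` that are Lipschitz continuous up to null sets and have
bounded commutators with slowly varying multipliers. -/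
structure IsAdmissible (m k₁ k₂ : ℝ) (a : ℝ → ℝ) : Prop where
  measurable : Measurable a
  le_apply : ∀ x, k₁ ≤ a x
  apply_le : ∀ x, a x ≤ k₂
  lipschitz : ∃ L : ℝ, ∀ s, 0 < s → s ≤ 1 → ∀ᵐ x, |a (x + s) - a x| ≤ L * s
  commutator : ∃ C, HasCommutatorBound m C (fun x ↦ (a x : ℂ))

theorem IsAdmissible.memLp {m k₁ k₂ : ℝ} {a : ℝ → ℝ} (ha : IsAdmissible m k₁ k₂ a)
    (hk₁ : 0 < k₁) : MemLp (fun x ↦ (a x : ℂ)) ∞ volume :=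
  memLp_top_of_measurable_bounded (K := k₂) (Complex.measurable_ofReal.comp ha.measurable)
    fun x ↦ by
      rw [Complex.norm_real, Real.norm_of_nonneg (hk₁.le.trans (ha.le_apply x))]
      exact ha.apply_le x

/-- The difference of the two terms in the semicommutator, as functions of the frequency. -/
def semicommutatorDensity (t : ℝ) (a : ℝ → ℝ) (g : ℝ → ℂ) (x ξ : ℝ) : ℂ :=
  𝓕 (dQuantization t a g) ξ - (dProfile (a x) (t * |ξ|) : ℂ) * g ξ

theorem measurable_dProfile_prod {β : Type*} [MeasurableSpace β] {a b : β → ℝ}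
    (ha : Measurable a) (hb : Measurable b) :
    Measurable fun p ↦ (dProfile (a p) (b p) : ℂ) := by
  unfold dProfile; fun_prop

/-- Normalizing at the upper bound k₂, h = a/k₂ - 1 lies between -(1 - k₁/k₂) and 0, so the series
contracts however much a oscillates, and k₂⁻¹ε/(1 + hε) is exactly the symbol d. Constants and
scalar factors do not harm commutators, so h inherits the bound for a. -/
theorem IsAdmissible.exists_resolventSolution {m k₁ k₂ : ℝ} {a : ℝ → ℝ} (hm : 0 ≤ m)
    (hk₁ : 0 < k₁) (ha : IsAdmissible m k₁ k₂ a) :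
    ∃ A, 0 ≤ A ∧ ∀ t, 0 < t → t ≤ 1 → ∃ B : LTwo →L[ℂ] LTwo,
      (∀ (g : ℝ → ℂ), Integrable g → ∀ hg : MemLp g 2 volume,
        B (𝓕⁻ (hg.toLp g)) =ᵐ[volume] dQuantization t a g) ∧
      ∀ (K : ℝ) (φ : ℝ → ℂ), IsSlowlyVarying m K φ → ∀ u,
      ‖fourierMul (fun ξ ↦ φ (t * ξ)) (B u) - B (fourierMul (fun ξ ↦ φ (t * ξ)) u)‖ ≤
        A * (K * t) * ‖fourierMul (sobolevWeight t (-m)) u‖ := by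
  have hk : k₁ ≤ k₂ := (ha.le_apply 0).trans (ha.apply_le 0)
  have hk₂ : 0 < k₂ := hk₁.trans_le hk
  obtain ⟨C, hC⟩ := ha.commutator
  have haL := ha.memLp hk₁
  obtain ⟨h, hh⟩ : ∃ h : ℝ → ℂ, h = fun x ↦ (-1 : ℂ) + (k₂ : ℂ)⁻¹ * (a x : ℂ) := ⟨_, rfl⟩
  have hhm : Measurable h := by
    have := ha.measurable
    rw [hh]; fun_prop
  have hhr : ∀ x, h x = ((a x / k₂ - 1 : ℝ) : ℂ) := fun x ↦ by
    rw [hh]; push_cast; ring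
  have hhq : ∀ x, ‖h x‖ ≤ 1 - k₁ / k₂ := fun x ↦ by
    rw [hhr, Complex.norm_real, Real.norm_eq_abs, abs_of_nonpos]
    · have : k₁ / k₂ ≤ a x / k₂ := by gcongr; exact ha.le_apply x
      linarith
    · rw [sub_nonpos, div_le_one hk₂]; exact ha.apply_le x
  have hq0 : 0 ≤ 1 - k₁ / k₂ := (norm_nonneg _).trans (hhq 0)
  have hq : 1 - k₁ / k₂ < 1 := by
    have : 0 < k₁ / k₂ := by positivity
    linarith
  have hhL := memLp_top_of_measurable_bounded hhm hhq
  have hhC : HasCommutatorBound m (‖(k₂ : ℂ)⁻¹‖ * C) h := by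
    rw [hh]
    exact (hC.const_mul haL _).const_add (haL.const_mul _) _
  obtain ⟨A, hA0, hA⟩ := exists_commutator_bound_of_isResolventSolution hm hq0 hq hhL
    (Filter.Eventually.of_forall hhq) hhC (k₂ : ℂ)⁻¹
  refine ⟨A, hA0, fun t ht ht1 ↦ ?_⟩
  obtain ⟨ε, hε⟩ : ∃ ε : ℝ → ℂ, ε = fun ξ ↦ (k₂ : ℂ) * (dProfile k₂ (t * |ξ|) : ℂ) := ⟨_, rfl⟩
  have hεm : Measurable ε := by
    rw [hε]; exact (measurable_ofReal_dProfile k₂ t).const_mul _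
  have hε1 : ∀ ξ, ‖ε ξ‖ ≤ 1 := fun ξ ↦ by
    rw [hε]
    have := norm_ofReal_dProfile_le (l := t * |ξ|) hk₂ (by positivity)
    rw [norm_mul, Complex.norm_real, Real.norm_of_nonneg hk₂.le]
    calc _ ≤ k₂ * k₂⁻¹ := by gcongr
      _ = 1 := mul_inv_cancel₀ hk₂.ne'
  obtain ⟨B, hB, hBt⟩ := exists_isResolventSolution (k₂ : ℂ)⁻¹ hhL hεm hε1 hq0 hq
    (Filter.Eventually.of_forall hhq)
  refine ⟨B, fun g hg1 hg ↦ ?_, hA t ht ht1 ε hεm hε1 B hB⟩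
  have h1 := isResolventSolution_fourierInv_ae hhm hεm hε1 hq hhq hBt hg1 hg
  have e : (fun x ↦ 𝓕⁻ (fun ξ ↦ (k₂ : ℂ)⁻¹ * ε ξ / (1 + h x * ε ξ) * g ξ) x) =
      dQuantization t a g := by
    funext x
    unfold dQuantization
    refine congrArg (fun G : ℝ → ℂ ↦ 𝓕⁻ G x) (funext fun ξ ↦ congrArg (· * g ξ) ?_)
    rw [hε, hhr]
    obtain ⟨l, hl⟩ : ∃ l, l = t * |ξ| := ⟨_, rfl⟩
    have hl0 : 0 ≤ l := by rw [hl]; positivity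
    simp only [← hl]
    have hax : 0 < a x := hk₁.trans_le (ha.le_apply x)
    have n1 : 1 + k₂ * l ≠ 0 := by positivity
    have n2 : 1 + a x * l ≠ 0 := by positivity
    have key : k₂⁻¹ * (k₂ * dProfile k₂ l) / (1 + (a x / k₂ - 1) * (k₂ * dProfile k₂ l)) =
        dProfile (a x) l := by
      have e1 : 1 + (a x / k₂ - 1) * (k₂ * dProfile k₂ l) = (1 + a x * l) / (1 + k₂ * l) := by
        unfold dProfile
        field_simp
        ring
      rw [e1]
      unfold dProfile
      field_simp
    rw [← key]
    push_cast
    ring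
  rw [e] at h1
  exact h1

/-- When the outer symbol is a multiplier φ, quantizing φ d is the same as applying B after φ(tD),
so the integral is the squared norm of the commutator of φ(tD) with B on f. Integrability of the
transform of d(x,tD)f allows φ(tD)Bf to be written as a Fourier integral. -/
theorem lintegral_fourierInv_semicommutatorDensity_le {m k₁ t K D : ℝ} {a : ℝ → ℝ}
    (hk₁ : 0 < k₁) (ha1 : ∀ x, k₁ ≤ a x) (f : 𝓢(ℝ, ℂ))
    (hu1 : Integrable (dQuantization t a (𝓕 f : 𝓢(ℝ, ℂ))))
    (hu2 : MemLp (dQuantization t a (𝓕 f : 𝓢(ℝ, ℂ))) 2 volume)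
    (hu3 : Integrable (𝓕 (dQuantization t a (𝓕 f : 𝓢(ℝ, ℂ))))) (ht : 0 < t)
    {B : LTwo →L[ℂ] LTwo}
    (hB : ∀ (g : ℝ → ℂ), Integrable g → ∀ hg : MemLp g 2 volume,
        B (𝓕⁻ (hg.toLp g)) =ᵐ[volume] dQuantization t a g)
    {φ : ℝ → ℂ} (hφ : IsSlowlyVarying m K φ)
    (hD : ‖fourierMul (fun ξ ↦ φ (t * ξ)) (B (f.toLp 2)) -
      B (fourierMul (fun ξ ↦ φ (t * ξ)) (f.toLp 2))‖ ≤ D) :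
    ∫⁻ x, ‖𝓕⁻ (fun ξ ↦ φ (t * ξ) * semicommutatorDensity t a (𝓕 f : 𝓢(ℝ, ℂ)) x ξ) x‖ₑ ^ 2 ≤
      ENNReal.ofReal D ^ 2 := by
  obtain ⟨g, hg⟩ : ∃ g : 𝓢(ℝ, ℂ), g = 𝓕 f := ⟨_, rfl⟩
  rw [← hg] at hu1 hu2 hu3 ⊢
  obtain ⟨u, hu⟩ : ∃ u, u = dQuantization t a g := ⟨_, rfl⟩
  rw [← hu] at hu1 hu2 hu3
  obtain ⟨Φ, hΦ⟩ : ∃ Φ : ℝ → ℂ, Φ = fun ξ ↦ φ (t * ξ) := ⟨_, rfl⟩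
  have hΦm : Measurable Φ := hΦ ▸ hφ.measurable.comp (measurable_const_mul t)
  have hΦb : ∀ ξ, ‖Φ ξ‖ ≤ K := fun ξ ↦ by rw [hΦ]; exact hφ.norm_le _
  have hΦL := memLp_top_of_measurable_bounded hΦm hΦb
  rw [← hΦ] at hD
  have hg2 : MemLp g 2 volume := g.memLp 2
  have hf : f.toLp 2 = (𝓕⁻ (hg2.toLp g) : LTwo) := by
    have e : hg2.toLp g = (𝓕 (f.toLp 2) : LTwo) := by
      subst hg
      exact (SchwartzMap.toLp_fourier_eq f).symm
    rw [e, FourierTransform.fourierInv_fourier_eq]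
  have h1 : B (f.toLp 2) =ᵐ[volume] u := by
    rw [hf, hu]; exact hB g g.integrable hg2
  have h2 : B (f.toLp 2) = hu2.toLp u := by
    apply Lp.ext
    filter_upwards [h1, hu2.coeFn_toLp] with x a1 a2
    rw [a1, a2]
  have h3 : (𝓕 (hu2.toLp u) : LTwo) =ᵐ[volume] 𝓕 u := fourier_toLp_ae hu1 hu2
  have h4 : MemLp (𝓕 u) 2 volume := (memLp_congr_ae h3).1 (Lp.memLp _)
  have h5 : B (f.toLp 2) = 𝓕⁻ (h4.toLp (𝓕 u)) := by
    have e : h4.toLp (𝓕 u) = (𝓕 (hu2.toLp u) : LTwo) := by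
      apply Lp.ext
      filter_upwards [h3, h4.coeFn_toLp] with x a1 a2
      rw [a1, a2]
    rw [e, FourierTransform.fourierInv_fourier_eq, h2]
  have h6 : fourierMul Φ (B (f.toLp 2)) =ᵐ[volume] 𝓕⁻ (fun ξ ↦ Φ ξ * 𝓕 u ξ) := by
    rw [h5]; exact fourierMul_fourierInv_toLp_ae hΦL hu3 h4
  have hΦg : Integrable fun ξ ↦ Φ ξ * g ξ :=
    g.integrable.bdd_mul hΦm.aestronglyMeasurable (Filter.Eventually.of_forall hΦb)
  have hΦu : Integrable fun ξ ↦ Φ ξ * 𝓕 u ξ :=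
    hu3.bdd_mul hΦm.aestronglyMeasurable (Filter.Eventually.of_forall hΦb)
  have h7 : B (fourierMul Φ (f.toLp 2)) =ᵐ[volume] dQuantization t a (fun ξ ↦ Φ ξ * g ξ) := by
    rw [hf, fourierMul_fourierInv_toLp hΦL hg2]
    exact hB _ hΦg _
  obtain ⟨X, hX⟩ : ∃ X : LTwo, X = fourierMul Φ (B (f.toLp 2)) := ⟨_, rfl⟩
  obtain ⟨Y, hY⟩ : ∃ Y : LTwo, Y = B (fourierMul Φ (f.toLp 2)) := ⟨_, rfl⟩
  rw [← hX] at h6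
  rw [← hY] at h7
  rw [← hX, ← hY] at hD
  have h8 : ((X - Y : LTwo) : ℝ → ℂ) =ᵐ[volume]
      fun x ↦ 𝓕⁻ (fun ξ ↦ Φ ξ * semicommutatorDensity t a g x ξ) x := by
    filter_upwards [h6, h7, Lp.coeFn_sub X Y] with x a1 a2 a3
    rw [a3, Pi.sub_apply, a1, a2]
    unfold dQuantization semicommutatorDensity
    rw [← hu]
    simp only [fourierInv_apply_eq]
    have hax := hk₁.trans_le (ha1 x)
    have hi : Integrable fun ξ ↦ (dProfile (a x) (t * |ξ|) : ℂ) * (Φ ξ * g ξ) :=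
      hΦg.bdd_mul (measurable_ofReal_dProfile (a x) t).aestronglyMeasurable
        (Filter.Eventually.of_forall fun ξ ↦ norm_ofReal_dProfile_le hax (by positivity))
    rw [← integral_sub (integrable_cexp_mul hΦu x) (integrable_cexp_mul hi x)]
    congr 1
    funext ξ
    ring
  have h9 : ∫⁻ x, ‖𝓕⁻ (fun ξ ↦ Φ ξ * semicommutatorDensity t a g x ξ) x‖ₑ ^ 2 =
      ‖X - Y‖ₑ ^ 2 := by
    rw [← lintegral_enorm_sq_coeFn]
    apply lintegral_congr_ae
    filter_upwards [h8] with x hx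
    rw [hx]
  rw [hΦ] at h9
  rw [h9]
  refine pow_le_pow_left₀ zero_le ?_ 2
  rw [← ofReal_norm]
  exact ENNReal.ofReal_le_ofReal hD

theorem semiclassicalOp_dSymbol_eq {t : ℝ} (ht : 0 < t) (a : ℝ → ℝ) (f : 𝓢(ℝ, ℂ)) :
    semiclassicalOp t (dSymbol a) f = dQuantization t a (𝓕 f : 𝓢(ℝ, ℂ)) := by
  funext x
  unfold semiclassicalOp dQuantization
  rw [fourierInv_apply_eq]
  congr 1
  funext ξ
  rw [SchwartzMap.fourier_coe, mul_assoc, dSymbol, dProfile, abs_mul, abs_of_pos ht]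

theorem pInvSymbol_eq {t : ℝ} (ht : 0 < t) {a : ℝ → ℝ} {x : ℝ} (hx : 0 < a x) (ξ : ℝ) :
    pInvSymbol a x (t * ξ) = (pInvProfile (a x) (t * |ξ|) : ℂ) := by
  rw [pInvSymbol, pSymbol, pInvProfile, ← Complex.ofReal_inv, abs_mul, abs_of_pos ht, one_div,
    ← Real.rpow_neg (by positivity)]

/-- Both terms carry the same outer symbol at x, so it factors out of a single Fourier integral. -/
theorem semicommutator_eq {t : ℝ} (ht : 0 < t) {a : ℝ → ℝ} (f : 𝓢(ℝ, ℂ)) {x : ℝ}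
    (hx : 0 < a x) (hu3 : Integrable (𝓕 (dQuantization t a (𝓕 f : 𝓢(ℝ, ℂ))))) :
    semicommutator t (pInvSymbol a) (dSymbol a) f x =
      𝓕⁻ (fun ξ ↦ (pInvProfile (a x) (t * |ξ|) : ℂ) *
        semicommutatorDensity t a (𝓕 f : 𝓢(ℝ, ℂ)) x ξ) x := by
  unfold semicommutator
  rw [semiclassicalOp_dSymbol_eq ht]
  unfold semiclassicalOp semicommutatorDensity
  rw [fourierInv_apply_eq]
  have hp : ∀ {g : ℝ → ℂ}, Integrable g →
      Integrable fun ξ ↦ (pInvProfile (a x) (t * |ξ|) : ℂ) * g ξ := fun hg ↦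
    hg.bdd_mul (measurable_pInvProfile_prod (by fun_prop) (by fun_prop)).aestronglyMeasurable
      (Filter.Eventually.of_forall fun ξ ↦ norm_pInvProfile_le hx (by positivity))
  have hd : Integrable fun ξ ↦ (dProfile (a x) (t * |ξ|) : ℂ) * (𝓕 f : 𝓢(ℝ, ℂ)) ξ :=
    (𝓕 f).integrable.bdd_mul (measurable_ofReal_dProfile (a x) t).aestronglyMeasurable
      (Filter.Eventually.of_forall fun ξ ↦ norm_ofReal_dProfile_le hx (by positivity))
  have e1 : ∀ ξ : ℝ, Complex.exp (2 * Real.pi * Complex.I * x * ξ) * pInvSymbol a x (t * ξ) *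
      𝓕 (dQuantization t a (𝓕 f : 𝓢(ℝ, ℂ))) ξ = Complex.exp (2 * Real.pi * Complex.I * x * ξ) *
      ((pInvProfile (a x) (t * |ξ|) : ℂ) * 𝓕 (dQuantization t a (𝓕 f : 𝓢(ℝ, ℂ))) ξ) := fun ξ ↦ by
    rw [pInvSymbol_eq ht hx, mul_assoc]
  have e2 : ∀ ξ : ℝ, Complex.exp (2 * Real.pi * Complex.I * x * ξ) *
      (pInvSymbol a x (t * ξ) * dSymbol a x (t * ξ)) * 𝓕 (f : ℝ → ℂ) ξ =
      Complex.exp (2 * Real.pi * Complex.I * x * ξ) *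
      ((pInvProfile (a x) (t * |ξ|) : ℂ) *
        ((dProfile (a x) (t * |ξ|) : ℂ) * (𝓕 f : 𝓢(ℝ, ℂ)) ξ)) := fun ξ ↦ by
    rw [pInvSymbol_eq ht hx, SchwartzMap.fourier_coe, dSymbol, dProfile, abs_mul, abs_of_pos ht]
    ring
  simp only [e1, e2]
  rw [← integral_sub (integrable_cexp_mul (hp hu3) x) (integrable_cexp_mul (hp hd) x)]
  congr 1
  funext ξ
  ring


/-- The constant K of slow variation is common to all frozen κ in [k₁, k₂] and to the κ-derivatives,
so the commutator bounds are uniform and can be superposed. -/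
theorem IsAdmissible.exists_semicommutator_bound {m k₁ k₂ : ℝ} {a : ℝ → ℝ} (hm : 0 ≤ m)
    (hk₁ : 0 < k₁) (hmk : m < 1 + k₂⁻¹) (ha : IsAdmissible m k₁ k₂ a) :
    ∃ C, 0 ≤ C ∧ ∀ t, 0 < t → t ≤ 1 → ∀ f : 𝓢(ℝ, ℂ),
      Integrable (semiclassicalOp t (dSymbol a) f) ∧
      Integrable (𝓕 (semiclassicalOp t (dSymbol a) f)) ∧
      ∃ v : LTwo, v =ᵐ[volume] semicommutator t (pInvSymbol a) (dSymbol a) f ∧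
        ‖v‖ ≤ C * t * ‖fourierMul (sobolevWeight t (-m)) (f.toLp 2)‖ := by
  have hk : k₁ ≤ k₂ := (ha.le_apply 0).trans (ha.apply_le 0)
  obtain ⟨A, hA0, hA⟩ := ha.exists_resolventSolution hm hk₁
  obtain ⟨K, hK0, hK⟩ := exists_isSlowlyVarying_pInvProfile hm hk₁ hmk
  obtain ⟨L, hL⟩ := ha.lipschitz
  obtain ⟨E, hE⟩ : ∃ E, E = 2 + 2 * (k₂ - k₁) ^ 2 := ⟨_, rfl⟩
  -- The superposition gives the factor √E; as E ≥ 1 it may be replaced by E.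
  have hE1 : 1 ≤ E := by nlinarith [sq_nonneg (k₂ - k₁)]
  refine ⟨E * (A * K), by positivity, fun t ht ht1 f ↦ ?_⟩
  obtain ⟨hu1, hu2, hu3⟩ := integrable_fourier_dQuantization f hk₁ ht ht1 ha.measurable
    ha.le_apply ha.apply_le hL
  obtain ⟨B, hB, hBc⟩ := hA t ht ht1
  rw [semiclassicalOp_dSymbol_eq ht]
  refine ⟨hu1, hu3, ?_⟩
  obtain ⟨N, hN⟩ : ∃ N, N = ‖fourierMul (sobolevWeight t (-m)) (f.toLp 2)‖ := ⟨_, rfl⟩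
  have hN0 : 0 ≤ N := hN ▸ norm_nonneg _
  have hS : semicommutator t (pInvSymbol a) (dSymbol a) f = fun x ↦
      𝓕⁻ (fun ξ ↦ (pInvProfile (a x) (t * |ξ|) : ℂ) *
        semicommutatorDensity t a (𝓕 f : 𝓢(ℝ, ℂ)) x ξ) x :=
    funext fun x ↦ semicommutator_eq ht f (hk₁.trans_le (ha.le_apply x)) hu3
  have hrm : Measurable fun p : ℝ × ℝ ↦ semicommutatorDensity t a (𝓕 f : 𝓢(ℝ, ℂ)) p.1 p.2 := by
    unfold semicommutatorDensity
    have c1 := (continuous_fourier_of_integrable hu1).measurable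
    have c2 : Measurable fun p : ℝ × ℝ ↦ (dProfile (a p.1) (t * |p.2|) : ℂ) :=
      measurable_dProfile_prod (ha.measurable.comp measurable_fst) (by fun_prop)
    have c3 := (𝓕 f : 𝓢(ℝ, ℂ)).continuous.measurable
    have c4 : Measurable fun p : ℝ × ℝ ↦ (𝓕 f : 𝓢(ℝ, ℂ)) p.2 := c3.comp measurable_snd
    have c5 : Measurable fun p : ℝ × ℝ ↦ 𝓕 (dQuantization t a (𝓕 f : 𝓢(ℝ, ℂ))) p.2 :=
      c1.comp measurable_snd
    exact c5.sub (c2.mul c4)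
  have hr : ∀ x, Integrable (semicommutatorDensity t a (𝓕 f : 𝓢(ℝ, ℂ)) x) := fun x ↦
    hu3.sub ((𝓕 f).integrable.bdd_mul (measurable_ofReal_dProfile (a x) t).aestronglyMeasurable
      (Filter.Eventually.of_forall fun ξ ↦
        norm_ofReal_dProfile_le (hk₁.trans_le (ha.le_apply x)) (by positivity)))
  have habs : ∀ ξ, |t * ξ| = t * |ξ| := fun ξ ↦ by rw [abs_mul, abs_of_pos ht]
  have hb1 : ∫⁻ x, ‖𝓕⁻ (fun ξ ↦ (pInvProfile k₁ (t * |ξ|) : ℂ) *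
      semicommutatorDensity t a (𝓕 f : 𝓢(ℝ, ℂ)) x ξ) x‖ₑ ^ 2 ≤
      ENNReal.ofReal (A * (K * t) * N) ^ 2 := by
    have hD := hBc _ _ (hK k₁ le_rfl hk).1 (f.toLp 2)
    rw [← hN] at hD
    have h := lintegral_fourierInv_semicommutatorDensity_le hk₁ ha.le_apply f hu1 hu2 hu3 ht hB
      (hK k₁ le_rfl hk).1 hD
    simpa only [habs] using h
  have hb2 : ∀ κ, k₁ ≤ κ → κ ≤ k₂ → ∫⁻ x, ‖𝓕⁻ (fun ξ ↦ (pInvProfileDeriv κ (t * |ξ|) : ℂ) *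
      semicommutatorDensity t a (𝓕 f : 𝓢(ℝ, ℂ)) x ξ) x‖ₑ ^ 2 ≤
      ENNReal.ofReal (A * (K * t) * N) ^ 2 := by
    intro κ h1 h2
    have hD := hBc _ _ (hK κ h1 h2).2 (f.toLp 2)
    rw [← hN] at hD
    have h := lintegral_fourierInv_semicommutatorDensity_le hk₁ ha.le_apply f hu1 hu2 hu3 ht hB
      (hK κ h1 h2).2 hD
    simpa only [habs] using h
  have hb := lintegral_fourierInv_pInvProfile_sq_le hk₁ hk ht
    (fun κ h1 h2 ξ ↦ (hK κ h1 h2).2.norm_le ξ) ha.le_apply ha.apply_le hrm hr hb1 hb2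
  have hSm : Measurable (semicommutator t (pInvSymbol a) (dSymbol a) f) := by
    rw [hS]
    have c2 : Measurable fun p : ℝ × ℝ ↦ (pInvProfile (a p.1) (t * |p.2|) : ℂ) :=
      measurable_pInvProfile_prod (ha.measurable.comp measurable_fst) (by fun_prop)
    have h2 := measurable_fourierInv_param (F := fun x ξ ↦ (pInvProfile (a x) (t * |ξ|) : ℂ) *
      semicommutatorDensity t a (𝓕 f : 𝓢(ℝ, ℂ)) x ξ) (c2.mul hrm)
    have h3 : Measurable fun x : ℝ ↦ (x, x) := by fun_prop
    have h4 := h2.comp h3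
    simp only [Function.comp_def] at h4
    exact h4
  have hb3 : ∫⁻ x, ‖semicommutator t (pInvSymbol a) (dSymbol a) f x‖ₑ ^ 2 ≤
      ENNReal.ofReal (E * (A * K) * t * N) ^ 2 := by
    rw [hS]
    refine hb.trans ?_
    rw [← hE]
    have e : E * (A * K) * t * N = E * (A * (K * t) * N) := by ring
    rw [e, ENNReal.ofReal_mul (p := E) (by positivity), mul_pow]
    have h1 : ENNReal.ofReal E ≤ ENNReal.ofReal E ^ 2 := by
      rw [← ENNReal.ofReal_pow (by positivity)]
      exact ENNReal.ofReal_le_ofReal (by nlinarith)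
    exact mul_le_mul_left h1 _
  have hSL : MemLp (semicommutator t (pInvSymbol a) (dSymbol a) f) 2 volume := by
    refine ⟨hSm.aestronglyMeasurable, ?_⟩
    rw [eLpNorm_lt_top_iff_lintegral_rpow_enorm_lt_top (by norm_num) (by norm_num)]
    refine lt_of_le_of_lt (le_trans (le_of_eq ?_) hb3) (by finiteness)
    simp
  refine ⟨hSL.toLp _, hSL.coeFn_toLp, ?_⟩
  rw [lintegral_enorm_sq_eq hSL] at hb3
  have h4 := (ENNReal.pow_le_pow_left_iff (by norm_num)).1 hb3
  rw [← ofReal_norm] at h4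
  rw [← hN]
  exact (ENNReal.ofReal_le_ofReal_iff (by positivity)).1 h4

/-! ### Extension to the semiclassical Sobolev space -/

/-- `f ↦ (1 + t² ξ²) ^ (s / 2) 𝓕 f` from Schwartz functions to `L²(ℝ)`. -/
def weightedFourierSchwartz (t s : ℝ) : 𝓢(ℝ, ℂ) →L[ℂ] LTwo :=
  SchwartzMap.toLpCLM ℂ ℂ 2 volume ∘L SchwartzMap.smulLeftCLM ℂ (sobolevWeight t s) ∘L
    FourierTransform.fourierCLM ℂ 𝓢(ℝ, ℂ)

theorem weightedFourierSchwartz_apply (t s : ℝ) (f : 𝓢(ℝ, ℂ)) : weightedFourierSchwartz t s f =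
    (SchwartzMap.smulLeftCLM ℂ (sobolevWeight t s) (𝓕 f)).toLp 2 := rfl

theorem toLpTwo_ofSchwartz (t s : ℝ) (f : 𝓢(ℝ, ℂ)) :
    SemiclassicalSobolev.toLpTwo t s (SemiclassicalSobolev.ofSchwartz t s f) =
      weightedFourierSchwartz t s f := by
  apply lpTwoToDistribution_injective
  rw [SemiclassicalSobolev.toLpTwo_spec, weightedFourierSchwartz_apply]
  have h := sobolevWeight_hasTemperateGrowth t s
  change weightedFourier t s (f : 𝓢'(ℝ, ℂ)) = Lp.toTemperedDistribution _
  rw [weightedFourier_apply, fourier_toTemperedDistributionCLM_eq,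
    Lp.toTemperedDistribution_toLp_eq]
  ext g
  rw [smulLeftCLM_apply_apply]
  refine (SchwartzMap.coe_apply _ _).trans (Eq.trans ?_ (SchwartzMap.coe_apply _ _).symm)
  congr 1
  funext x
  simp only [SchwartzMap.smulLeftCLM_apply_apply h, smul_eq_mul]
  ring

/-- The weight and the Fourier transform are invertible on Schwartz space, so the range contains
every Schwartz function. -/
theorem denseRange_weightedFourierSchwartz (t s : ℝ) :
    DenseRange (weightedFourierSchwartz t s) := by
  have h1 : DenseRange (SchwartzMap.toLpCLM ℝ ℂ 2 (volume : Measure ℝ)) :=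
    SchwartzMap.denseRange_toLpCLM ENNReal.ofNat_ne_top
  refine h1.mono ?_
  rintro _ ⟨g, rfl⟩
  refine ⟨𝓕⁻ (SchwartzMap.smulLeftCLM ℂ (sobolevWeight t (-s)) g), ?_⟩
  rw [weightedFourierSchwartz_apply, FourierTransform.fourier_fourierInv_eq,
    SchwartzMap.smulLeftCLM_smulLeftCLM_apply (sobolevWeight_hasTemperateGrowth t s)
      (sobolevWeight_hasTemperateGrowth t (-s)), sobolevWeight_mul_neg]
  simp

theorem norm_weightedFourierSchwartz {m : ℝ} (hm : 0 ≤ m) (t : ℝ) (f : 𝓢(ℝ, ℂ)) :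
    ‖weightedFourierSchwartz t (-m) f‖ = ‖fourierMul (sobolevWeight t (-m)) (f.toLp 2)‖ := by
  rw [norm_fourierMul_apply, weightedFourierSchwartz_apply]
  congr 1
  apply Lp.ext
  have e : (𝓕 (f.toLp 2) : LTwo) = (𝓕 f : 𝓢(ℝ, ℂ)).toLp 2 := SchwartzMap.toLp_fourier_eq f
  rw [e]
  filter_upwards [coeFn_mulOp (memLp_top_sobolevWeight hm t) ((𝓕 f : 𝓢(ℝ, ℂ)).toLp 2),
    (𝓕 f : 𝓢(ℝ, ℂ)).coeFn_toLp 2 volume, (SchwartzMap.smulLeftCLM ℂ (sobolevWeight t (-m))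
      (𝓕 f)).coeFn_toLp 2 volume] with x h1 h2 h3
  rw [h1, h2, h3, SchwartzMap.smulLeftCLM_apply_apply (sobolevWeight_hasTemperateGrowth t (-m)),
    smul_eq_mul]

/-- The isometry `toLpTwo` as a continuous linear map. -/
def toLpTwoCLM (t s : ℝ) : SemiclassicalSobolev t s →L[ℂ] LTwo :=
  (SemiclassicalSobolev.toLpTwo t s).mkContinuous 1 fun u ↦ by
    rw [one_mul, SemiclassicalSobolev.norm_eq]

/-- S is dominated by the L² norm of the weighted transform, so it factors through that map and
extends from its dense range to all of L²; composing with the isometry of H^{-m}_t into L² gives T.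
-/
theorem exists_extension {m C t : ℝ} (hm : 0 ≤ m) (hC : 0 ≤ C) (S : 𝓢(ℝ, ℂ) →ₗ[ℂ] LTwo)
    (hS : ∀ f : 𝓢(ℝ, ℂ), ‖S f‖ ≤ C * ‖fourierMul (sobolevWeight t (-m)) (f.toLp 2)‖) :
    ∃ T : SemiclassicalSobolev t (-m) →L[ℂ] Lp ℂ 2 (volume : Measure ℝ),
      (∀ f : 𝓢(ℝ, ℂ), T (SemiclassicalSobolev.ofSchwartz t (-m) f) = S f) ∧ ‖T‖ ≤ C := by
  obtain ⟨e, he⟩ : ∃ e : 𝓢(ℝ, ℂ) →ₗ[ℂ] LTwo,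
    e = (weightedFourierSchwartz t (-m)).toLinearMap := ⟨_, rfl⟩
  have hd : DenseRange e := by rw [he]; exact denseRange_weightedFourierSchwartz t (-m)
  have hS' : ∀ f, ‖S f‖ ≤ C * ‖e f‖ := fun f ↦ by
    have := hS f
    rw [← norm_weightedFourierSchwartz hm] at this
    rw [he]; exact this
  refine ⟨S.extendOfNorm e ∘L toLpTwoCLM t (-m), fun f ↦ ?_, ?_⟩
  · have h1 : toLpTwoCLM t (-m) (SemiclassicalSobolev.ofSchwartz t (-m) f) = e f := by
      rw [he]; exact toLpTwo_ofSchwartz t (-m) f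
    rw [ContinuousLinearMap.comp_apply, h1]
    exact LinearMap.extendOfNorm_eq hd ⟨C, hS'⟩ f
  · refine ContinuousLinearMap.opNorm_le_bound _ hC fun u ↦ ?_
    exact LinearMap.norm_extendOfNorm_apply_le hd C hS' _

/-! ### Linearity of the semicommutator and dependence on the coefficient -/

/-- The value at x involves the coefficient only at x, and the argument u only through its Fourier
transform, which ignores null sets. -/
theorem semiclassicalOp_congr_coeff {t : ℝ} {b b' : ℝ → ℝ → ℂ} {u u' : ℝ → ℂ} {x : ℝ}
    (hb : b x = b' x) (hu : u =ᵐ[volume] u') :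
    semiclassicalOp t b u x = semiclassicalOp t b' u' x := by
  have h : 𝓕 u = 𝓕 u' := by
    funext y
    rw [fourier_apply_eq, fourier_apply_eq]
    apply integral_congr_ae
    filter_upwards [hu] with z hz
    rw [hz]
  unfold semiclassicalOp
  rw [hb, h]

theorem dSymbol_congr {a c : ℝ → ℝ} {x : ℝ} (h : c x = a x) : dSymbol c x = dSymbol a x := by
  funext ξ; rw [dSymbol, dSymbol, h]

theorem pInvSymbol_congr {a c : ℝ → ℝ} {x : ℝ} (h : c x = a x) :
    pInvSymbol c x = pInvSymbol a x := by
  funext ξ; rw [pInvSymbol, pInvSymbol, pSymbol, pSymbol, h]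

theorem semiclassicalOp_dSymbol_congr {a c : ℝ → ℝ} (h : c =ᵐ[volume] a) (t : ℝ) (f : ℝ → ℂ) :
    semiclassicalOp t (dSymbol c) f =ᵐ[volume] semiclassicalOp t (dSymbol a) f := by
  filter_upwards [h] with x hx
  exact semiclassicalOp_congr_coeff (dSymbol_congr hx) Filter.EventuallyEq.rfl

theorem semicommutator_congr {a c : ℝ → ℝ} (h : c =ᵐ[volume] a) (t : ℝ) (f : ℝ → ℂ) :
    semicommutator t (pInvSymbol c) (dSymbol c) f =ᵐ[volume]
      semicommutator t (pInvSymbol a) (dSymbol a) f := by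
  filter_upwards [h] with x hx
  unfold semicommutator
  rw [semiclassicalOp_congr_coeff (pInvSymbol_congr hx) (semiclassicalOp_dSymbol_congr h t f),
    semiclassicalOp_congr_coeff (t := t) (u := f) (u' := f)
      (b := fun y ξ ↦ pInvSymbol c y ξ * dSymbol c y ξ)
      (b' := fun y ξ ↦ pInvSymbol a y ξ * dSymbol a y ξ) ?_ Filter.EventuallyEq.rfl]
  simp only [pInvSymbol_congr hx, dSymbol_congr hx]

theorem fourierInv_mul_linear {b g g' : ℝ → ℂ} (hg : Integrable fun ξ ↦ b ξ * g ξ)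
    (hg' : Integrable fun ξ ↦ b ξ * g' ξ) (z : ℂ) (x : ℝ) :
    𝓕⁻ (fun ξ ↦ b ξ * (z * g ξ + g' ξ)) x =
      z * 𝓕⁻ (fun ξ ↦ b ξ * g ξ) x + 𝓕⁻ (fun ξ ↦ b ξ * g' ξ) x := by
  simp only [fourierInv_apply_eq]
  rw [← integral_const_mul, ← integral_add ((integrable_cexp_mul hg x).const_mul z)
    (integrable_cexp_mul hg' x)]
  congr 1
  funext ξ
  ring

theorem semicommutator_linear {t k₁ : ℝ} (ht : 0 < t) (hk₁ : 0 < k₁) {a : ℝ → ℝ}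
    (ha : ∀ x, k₁ ≤ a x)
    (h1 : ∀ f : 𝓢(ℝ, ℂ), Integrable (semiclassicalOp t (dSymbol a) f))
    (h2 : ∀ f : 𝓢(ℝ, ℂ), Integrable (𝓕 (semiclassicalOp t (dSymbol a) f)))
    (z : ℂ) (f f' : 𝓢(ℝ, ℂ)) (x : ℝ) :
    semicommutator t (pInvSymbol a) (dSymbol a) (z • f + f' : 𝓢(ℝ, ℂ)) x =
      z * semicommutator t (pInvSymbol a) (dSymbol a) f x +
        semicommutator t (pInvSymbol a) (dSymbol a) f' x := by
  have hpos : ∀ x, 0 < a x := fun x ↦ hk₁.trans_le (ha x)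
  have hd : ∀ x, ∀ g : 𝓢(ℝ, ℂ), Integrable fun ξ ↦ (dProfile (a x) (t * |ξ|) : ℂ) * g ξ :=
    fun x g ↦ g.integrable.bdd_mul (measurable_ofReal_dProfile (a x) t).aestronglyMeasurable
      (Filter.Eventually.of_forall fun ξ ↦ norm_ofReal_dProfile_le (hpos x) (by positivity))
  have hp : ∀ x, ∀ {g : ℝ → ℂ}, Integrable g →
      Integrable fun ξ ↦ (pInvProfile (a x) (t * |ξ|) : ℂ) * g ξ := fun x _ hg ↦
    hg.bdd_mul (measurable_pInvProfile_prod (by fun_prop) (by fun_prop)).aestronglyMeasurable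
      (Filter.Eventually.of_forall fun ξ ↦ norm_pInvProfile_le (hpos x) (by positivity))
  simp only [semiclassicalOp_dSymbol_eq ht] at h1 h2
  have hF : ∀ ξ, (𝓕 (z • f + f') : 𝓢(ℝ, ℂ)) ξ =
      z * (𝓕 f : 𝓢(ℝ, ℂ)) ξ + (𝓕 f' : 𝓢(ℝ, ℂ)) ξ := fun ξ ↦ by
    rw [FourierTransform.fourier_add, FourierTransform.fourier_smul]
    rfl
  have hQ : dQuantization t a (𝓕 (z • f + f') : 𝓢(ℝ, ℂ)) = fun x ↦
      z * dQuantization t a (𝓕 f : 𝓢(ℝ, ℂ)) x + dQuantization t a (𝓕 f' : 𝓢(ℝ, ℂ)) x := by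
    funext x
    unfold dQuantization
    simp only [hF]
    exact fourierInv_mul_linear (hd x _) (hd x _) z x
  have hFQ : ∀ ξ, 𝓕 (dQuantization t a (𝓕 (z • f + f') : 𝓢(ℝ, ℂ))) ξ =
      z * 𝓕 (dQuantization t a (𝓕 f : 𝓢(ℝ, ℂ))) ξ +
        𝓕 (dQuantization t a (𝓕 f' : 𝓢(ℝ, ℂ))) ξ := by
    intro ξ
    rw [hQ]
    have := fourierInv_mul_linear (b := fun _ ↦ 1) (g := dQuantization t a (𝓕 f : 𝓢(ℝ, ℂ)))
      (g' := dQuantization t a (𝓕 f' : 𝓢(ℝ, ℂ))) (by simpa using h1 f) (by simpa using h1 f') z (-ξ)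
    simpa only [one_mul, Real.fourierInv_eq_fourier_neg, neg_neg] using this
  rw [semicommutator_eq ht _ (hpos x) (h2 _), semicommutator_eq ht _ (hpos x) (h2 _),
    semicommutator_eq ht _ (hpos x) (h2 _)]
  have hdens : ∀ g : 𝓢(ℝ, ℂ), Integrable (semicommutatorDensity t a (𝓕 g : 𝓢(ℝ, ℂ)) x) :=
    fun g ↦ (h2 g).sub (hd x _)
  rw [← fourierInv_mul_linear (hp x (hdens f)) (hp x (hdens f')) z x]
  refine congrArg (fun G : ℝ → ℂ ↦ 𝓕⁻ G x) (funext fun ξ ↦ congrArg (_ * ·) ?_)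
  unfold semicommutatorDensity
  rw [hFQ, hF]
  ring

theorem IsAdmissible.exists_operator {m k₁ k₂ : ℝ} {a c : ℝ → ℝ} (hm : 0 ≤ m)
    (hk₁ : 0 < k₁) (hmk : m < 1 + k₂⁻¹) (ha : IsAdmissible m k₁ k₂ a) (hac : c =ᵐ[volume] a) :
    ∃ C : ℝ, 0 < C ∧ ∀ t : ℝ, 0 < t → t ≤ 1 →
      (∀ f : 𝓢(ℝ, ℂ), Integrable (semiclassicalOp t (dSymbol c) f) ∧
        Integrable (𝓕 (semiclassicalOp t (dSymbol c) f))) ∧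
      ∃ T : SemiclassicalSobolev t (-m) →L[ℂ] Lp ℂ 2 (volume : Measure ℝ),
        (∀ f : 𝓢(ℝ, ℂ), T (SemiclassicalSobolev.ofSchwartz t (-m) f) =ᵐ[volume]
          fun x ↦ (t : ℂ)⁻¹ * semicommutator t (pInvSymbol c) (dSymbol c) f x) ∧
        ‖T‖ ≤ C := by
  obtain ⟨C, hC0, hC⟩ := ha.exists_semicommutator_bound hm hk₁ hmk
  refine ⟨C + 1, by linarith, fun t ht ht1 ↦ ⟨fun f ↦ ?_, ?_⟩⟩
  · obtain ⟨h1, h2, -⟩ := hC t ht ht1 f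
    have h3 := semiclassicalOp_dSymbol_congr hac t f
    refine ⟨h1.congr h3.symm, ?_⟩
    have h4 : 𝓕 (semiclassicalOp t (dSymbol c) f) = 𝓕 (semiclassicalOp t (dSymbol a) f) := by
      funext y
      rw [fourier_apply_eq, fourier_apply_eq]
      apply integral_congr_ae
      filter_upwards [h3] with z hz
      rw [hz]
    rwa [h4]
  have h1 := fun f ↦ (hC t ht ht1 f).1
  have h2 := fun f ↦ (hC t ht ht1 f).2.1
  choose v hv hvn using fun f ↦ (hC t ht ht1 f).2.2
  have hlin : ∀ (z : ℂ) (f f' : 𝓢(ℝ, ℂ)), v (z • f + f') = z • v f + v f' := by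
    intro z f f'
    apply Lp.ext
    filter_upwards [hv (z • f + f'), hv f, hv f', Lp.coeFn_add (z • v f) (v f'),
      Lp.coeFn_smul z (v f)] with x a1 a2 a3 a4 a5
    rw [a1, a4, Pi.add_apply, a5, Pi.smul_apply, a2, a3, smul_eq_mul]
    exact semicommutator_linear ht hk₁ ha.le_apply h1 h2 z f f' x
  have hv0 : v 0 = 0 := by
    have := hlin 1 0 0
    simpa using this
  obtain ⟨S, hS⟩ : ∃ S : 𝓢(ℝ, ℂ) →ₗ[ℂ] LTwo, ∀ f, S f = (t : ℂ)⁻¹ • v f :=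
    ⟨{ toFun := fun f ↦ (t : ℂ)⁻¹ • v f
       map_add' := fun f f' ↦ by
         have := hlin 1 f f'
         rw [one_smul, one_smul] at this
         rw [this, smul_add]
       map_smul' := fun z f ↦ by
         have := hlin z f 0
         rw [add_zero, hv0, add_zero] at this
         rw [this, smul_comm, RingHom.id_apply] }, fun f ↦ rfl⟩
  obtain ⟨T, hT, hTn⟩ := exists_extension (t := t) hm hC0 S fun f ↦ by
    rw [hS, norm_smul, norm_inv, Complex.norm_real, Real.norm_of_nonneg ht.le,
      inv_mul_le_iff₀ ht]
    refine (hvn f).trans (le_of_eq ?_)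
    ring
  refine ⟨T, fun f ↦ ?_, by linarith⟩
  rw [hT, hS]
  filter_upwards [Lp.coeFn_smul (t : ℂ)⁻¹ (v f), hv f, semicommutator_congr hac t f]
    with x a1 a2 a3
  rw [a1, Pi.smul_apply, a2, a3, smul_eq_mul]

/-! ### Representatives of the coefficient -/

/-- A measurable version is clamped between the infimum and the supremum of c, so that the bounds
hold at every point and not just almost everywhere. -/
theorem ConditionC1.exists_measurable_representative {c₁ c₂ : ℝ} {c : ℝ → ℝ}
    (h : ConditionC1 c₁ c₂ c) (hc : AEMeasurable c volume) :
    ∃ k₁ k₂ : ℝ, c₁ < k₁ ∧ k₂ < c₂ ∧ ∃ a : ℝ → ℝ, Measurable a ∧ (∀ x, k₁ ≤ a x) ∧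
      (∀ x, a x ≤ k₂) ∧ c =ᵐ[volume] a := by
  obtain ⟨hb, ha, h1, h2⟩ := h
  have l1 : ∀ x, (⨅ x, c x) ≤ c x := fun x ↦ ciInf_le hb x
  have l2 : ∀ x, c x ≤ ⨆ x, c x := fun x ↦ le_ciSup ha x
  refine ⟨_, _, h1, h2, fun x ↦ max (⨅ x, c x) (min (⨆ x, c x) (hc.mk c x)), ?_,
    fun x ↦ le_max_left _ _, fun x ↦ max_le ((l1 0).trans (l2 0)) (min_le_left _ _), ?_⟩
  · have := hc.measurable_mk
    fun_prop
  · filter_upwards [hc.ae_eq_mk] with x hx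
    rw [← hx, min_eq_right (l2 x), max_eq_right (l1 x)]

theorem ae_comp_add_right {p : ℝ → Prop} (h : ∀ᵐ x, p x) (s : ℝ) : ∀ᵐ x, p (x + s) :=
  (measurePreserving_add_right volume s).quasiMeasurePreserving.ae h

/-! ### Coefficients in fractional Sobolev spaces -/

theorem lpTwoToDistribution_mulOp {φ : ℝ → ℂ} (hφ : φ.HasTemperateGrowth)
    (hφL : MemLp φ ∞ volume) (u : LTwo) :
    lpTwoToDistribution (mulOp φ u) = smulLeftCLM ℂ φ (lpTwoToDistribution u) := by
  change Lp.toTemperedDistribution _ = smulLeftCLM ℂ φ (Lp.toTemperedDistribution _)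
  ext g
  rw [smulLeftCLM_apply_apply, Lp.toTemperedDistribution_apply, Lp.toTemperedDistribution_apply]
  apply integral_congr_ae
  filter_upwards [coeFn_mulOp hφL u] with x hx
  rw [hx, SchwartzMap.smulLeftCLM_apply_apply hφ, smul_eq_mul, smul_eq_mul, smul_eq_mul]
  ring

theorem MemSobolev.exists_fourier_eq_mulOp {s : ℝ} (hs : 0 ≤ s) {w : LTwo}
    (hw : MemSobolev s 2 (w : 𝓢'(ℝ, ℂ))) :
    ∃ u : LTwo, (𝓕 w : LTwo) = mulOp (sobolevWeight 1 (-s)) u := by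
  obtain ⟨u, hu⟩ := memSobolev_iff_exists_smulLeftCLM_fourier.1 hw
  refine ⟨u, ?_⟩
  have hW := sobolevWeight_hasTemperateGrowth 1 s
  have hW' := sobolevWeight_hasTemperateGrowth 1 (-s)
  have e : (fun x : ℝ ↦ (((1 + ‖x‖ ^ 2) ^ (s / 2) : ℝ) : ℂ)) = sobolevWeight 1 s := by
    funext x; simp [sobolevWeight]
  apply lpTwoToDistribution_injective
  rw [lpTwoToDistribution_mulOp hW' (memLp_top_sobolevWeight hs 1)]
  change Lp.toTemperedDistribution _ = smulLeftCLM ℂ _ (Lp.toTemperedDistribution _)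
  rw [← hu, Lp.fourier_toTemperedDistribution_eq]
  have e2 : (fun x : ℝ ↦ (((1 + ‖x‖ ^ 2) ^ (s / 2) : ℝ) : ℂ)).HasTemperateGrowth := by
    rw [e]; exact hW
  have h1 := smulLeftCLM_smulLeftCLM_apply e2 hW' (Lp.toTemperedDistribution (𝓕 w : LTwo))
  refine Eq.trans ?_ h1.symm
  rw [e, sobolevWeight_mul_neg]
  simp

theorem growthWeight_mul_sobolevWeight_le (m s ξ : ℝ) :
    growthWeight m ξ * ‖sobolevWeight 1 (-s) ξ‖ ≤ 2 * ‖sobolevWeight 1 (1 + m - s) ξ‖ := by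
  rw [norm_sobolevWeight, norm_sobolevWeight, growthWeight, one_mul]
  have h1 : 1 + |ξ| ≤ 2 * (1 + ξ ^ 2) ^ (1 / 2 : ℝ) := by
    rw [← Real.sqrt_eq_rpow]
    have a1 : 1 ≤ √(1 + ξ ^ 2) := Real.one_le_sqrt.2 (by nlinarith [sq_nonneg ξ])
    have a2 : |ξ| ≤ √(1 + ξ ^ 2) := by
      rw [← Real.sqrt_sq_eq_abs]; exact Real.sqrt_le_sqrt (by linarith)
    linarith
  calc _ ≤ 2 * (1 + ξ ^ 2) ^ (1 / 2 : ℝ) * (1 + ξ ^ 2) ^ (m / 2) * (1 + ξ ^ 2) ^ (-s / 2) := by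
        gcongr
    _ = _ := by
      rw [mul_assoc, mul_assoc, ← Real.rpow_add (by positivity), ← Real.rpow_add (by positivity)]
      congr 2
      ring

/-- The growth weight times the Bessel weight is O((1 + ξ²)^((1+m-s)/2)), which is square integrable
for s > m + 3/2; then pair with u in L². This is the origin of the lower bound on s in (C2'). -/
theorem integrable_growthWeight_mul_norm {m s : ℝ} (hm : 0 ≤ m) (hs : m + 3 / 2 < s) (u : LTwo) :
    Integrable fun ξ ↦ growthWeight m ξ * ‖(mulOp (sobolevWeight 1 (-s)) u) ξ‖ := by
  have h1 : MemLp (sobolevWeight 1 (1 + m - s)) 2 volume := by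
    rw [memLp_two_iff_integrable_sq_norm (measurable_sobolevWeight _ _).aestronglyMeasurable]
    have h2 := integrable_rpow_neg_one_add_norm_sq (E := ℝ) (μ := volume) (r := 2 * (s - 1 - m))
      (by rw [Module.finrank_self]; push_cast; linarith)
    refine h2.congr (Filter.Eventually.of_forall fun ξ ↦ ?_)
    simp only [norm_sobolevWeight, one_mul, Real.norm_eq_abs, sq_abs]
    rw [← Real.rpow_natCast ((1 + ξ ^ 2) ^ ((1 + m - s) / 2)) 2, ← Real.rpow_mul (by positivity)]
    congr 1
    push_cast
    ring
  have h3 : Integrable fun ξ ↦ sobolevWeight 1 (1 + m - s) ξ * u ξ :=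
    h1.integrable_mul (Lp.memLp u)
  refine (h3.norm.const_mul 2).mono' ?_ ?_
  · exact (measurable_growthWeight m).aestronglyMeasurable.mul (Lp.aestronglyMeasurable _).norm
  · filter_upwards [coeFn_mulOp (memLp_top_sobolevWeight (by linarith) 1) u] with ξ hξ
    have := growthWeight_pos m ξ
    rw [Real.norm_of_nonneg (by positivity), hξ, norm_mul, norm_mul, ← mul_assoc, ← mul_assoc]
    exact mul_le_mul_of_nonneg_right (growthWeight_mul_sobolevWeight_le m s ξ) (norm_nonneg _)

theorem norm_fourierInv_sub_le {m : ℝ} (hm : 0 ≤ m) {v : ℝ → ℂ} (hv : Integrable v)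
    (hvw : Integrable fun ζ ↦ growthWeight m ζ * ‖v ζ‖) {s : ℝ} (hs : 0 < s) (x : ℝ) :
    ‖𝓕⁻ v (x + s) - 𝓕⁻ v x‖ ≤ 2 * Real.pi * (∫ ζ, growthWeight m ζ * ‖v ζ‖) * s := by
  simp only [fourierInv_apply_eq]
  rw [← integral_sub (integrable_cexp_mul hv _) (integrable_cexp_mul hv _),
    mul_right_comm (2 * Real.pi), ← integral_const_mul (2 * Real.pi * s) (fun ζ ↦ growthWeight m ζ * ‖v ζ‖)]
  refine norm_integral_le_of_norm_le (hvw.const_mul _) (Filter.Eventually.of_forall fun ζ ↦ ?_)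
  have e : Complex.exp (2 * Real.pi * Complex.I * (x + s : ℝ) * ζ) * v ζ -
      Complex.exp (2 * Real.pi * Complex.I * x * ζ) * v ζ =
      Complex.exp (2 * Real.pi * Complex.I * x * ζ) *
        (Complex.exp (Complex.I * (2 * Real.pi * s * ζ : ℝ)) - 1) * v ζ := by
    rw [mul_sub, ← Complex.exp_add, sub_mul, mul_one]
    congr 3
    push_cast
    ring
  rw [e, norm_mul, norm_mul, norm_cexp_two_pi, one_mul]
  have h1 := Real.norm_exp_I_mul_ofReal_sub_one_le (x := 2 * Real.pi * s * ζ)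
  have h2 : |ζ| ≤ growthWeight m ζ := by
    unfold growthWeight
    have : 1 ≤ (1 + ζ ^ 2) ^ (m / 2) := Real.one_le_rpow (by nlinarith [sq_nonneg ζ]) (by positivity)
    nlinarith [abs_nonneg ζ]
  calc _ ≤ ‖2 * Real.pi * s * ζ‖ * ‖v ζ‖ := by gcongr
    _ = 2 * Real.pi * s * (|ζ| * ‖v ζ‖) := by
      rw [norm_mul, Real.norm_of_nonneg (by positivity), Real.norm_eq_abs]; ring
    _ ≤ _ := by gcongr

/-- Almost everywhere the coefficient is c₀ plus 𝓕⁻ v with v integrable against the growth weight.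
The constant commutes with multipliers, and the same weighted integral of v gives the Lipschitz
bound. -/
theorem ConditionC2'.exists_isAdmissible {c₁ c₂ : ℝ} (hc₁ : 0 < c₁) {c : ℝ → ℝ}
    (h1 : ConditionC1 c₁ c₂ c) (h : ConditionC2' c₁ c₂ c) :
    ∃ k₁ k₂ : ℝ, c₁ < k₁ ∧ k₂ < c₂ ∧ ∃ a, IsAdmissible c₁⁻¹ k₁ k₂ a ∧ c =ᵐ[volume] a := by
  obtain ⟨c₀, s, -, -, hs, -, ⟨hf, hS⟩, -⟩ := h
  have hm : 0 ≤ c₁⁻¹ := by positivity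
  have hcm : AEMeasurable c volume := by
    have h2 := (Complex.measurable_re.comp_aemeasurable hf.1.aemeasurable).add_const c₀
    refine h2.congr (Filter.Eventually.of_forall fun x ↦ ?_)
    simp
  obtain ⟨k₁, k₂, hk₁, hk₂, a, ha, ha1, ha2, hca⟩ := h1.exists_measurable_representative hcm
  obtain ⟨w, hw⟩ : ∃ w : LTwo, w = hf.toLp (fun x ↦ ((c x - c₀ : ℝ) : ℂ)) := ⟨_, rfl⟩
  rw [← hw] at hS
  obtain ⟨u, hu⟩ := MemSobolev.exists_fourier_eq_mulOp (by linarith) hS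
  obtain ⟨v, hv⟩ : ∃ v : LTwo, v = mulOp (sobolevWeight 1 (-s)) u := ⟨_, rfl⟩
  have hvw := integrable_growthWeight_mul_norm hm (by linarith : c₁⁻¹ + 3 / 2 < s) u
  rw [← hv] at hvw hu
  have hv1 : Integrable v := by
    refine hvw.mono' (Lp.aestronglyMeasurable v) (Filter.Eventually.of_forall fun ξ ↦ ?_)
    have : 1 ≤ growthWeight c₁⁻¹ ξ := by
      unfold growthWeight
      have : 1 ≤ (1 + ξ ^ 2) ^ (c₁⁻¹ / 2) :=
        Real.one_le_rpow (by nlinarith [sq_nonneg ξ]) (by positivity)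
      nlinarith [abs_nonneg ξ]
    exact le_mul_of_one_le_left (norm_nonneg _) this
  have hb : w =ᵐ[volume] 𝓕⁻ (v : ℝ → ℂ) := by
    have h2 := fourierInv_toLp_ae hv1 (Lp.memLp v)
    rw [Lp.toLp_coeFn, ← hu, FourierTransform.fourierInv_fourier_eq] at h2
    rw [← hu]; exact h2
  have hab : (fun x ↦ (a x : ℂ)) =ᵐ[volume] fun x ↦ (c₀ : ℂ) + 𝓕⁻ (v : ℝ → ℂ) x := by
    filter_upwards [hb, hf.coeFn_toLp, hca] with x a1 a2 a3
    rw [← a1, hw, a2, ← a3]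
    push_cast
    ring
  refine ⟨k₁, k₂, hk₁, hk₂, a, ⟨ha, ha1, ha2, ?_, ?_⟩, hca⟩
  · refine ⟨2 * Real.pi * ∫ ζ, growthWeight c₁⁻¹ ζ * ‖v ζ‖, fun r hr _ ↦ ?_⟩
    filter_upwards [hab, ae_comp_add_right hab r] with x a1 a2
    have h3 := norm_fourierInv_sub_le hm hv1 hvw hr x
    rwa [← add_sub_add_left_eq_sub _ _ (c₀ : ℂ), ← a1, ← a2, ← Complex.ofReal_sub,
      Complex.norm_real, Real.norm_eq_abs] at h3
  · exact ⟨_, ((hasCommutatorBound_fourierInv hm hv1 hvw).const_add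
      (memLp_top_fourierInv hv1) c₀).congr hab.symm⟩

/-! ### Coefficients with bounded weak derivatives -/

theorem contDiff_iteratedDeriv_top {ρ : ℝ → ℝ} (h : ContDiff ℝ ∞ ρ) (k : ℕ) :
    ContDiff ℝ ∞ (iteratedDeriv k ρ) := by
  induction k with
  | zero => simpa using h
  | succ k ih =>
    rw [iteratedDeriv_succ]
    exact (contDiff_infty_iff_deriv.1 ih).2

theorem hasCompactSupport_iteratedDeriv {ρ : ℝ → ℝ} (h : HasCompactSupport ρ) (k : ℕ) :
    HasCompactSupport (iteratedDeriv k ρ) := by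
  induction k with
  | zero => simpa using h
  | succ k ih =>
    rw [iteratedDeriv_succ]
    exact ih.deriv

open ContinuousLinearMap in
theorem iteratedDeriv_convolution_left {ρ : ℝ → ℝ} (h : ContDiff ℝ ∞ ρ) (hs : HasCompactSupport ρ)
    {f : ℝ → ℂ} (hf : LocallyIntegrable f volume) (k : ℕ) :
    iteratedDeriv k (convolution ρ f (lsmul ℝ ℝ) volume) =
      convolution (iteratedDeriv k ρ) f (lsmul ℝ ℝ) volume := by
  induction k with
  | zero => simp
  | succ k ih =>
    rw [iteratedDeriv_succ, ih, iteratedDeriv_succ]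
    funext x
    exact ((hasCompactSupport_iteratedDeriv hs k).hasDerivAt_convolution_left (lsmul ℝ ℝ)
      ((contDiff_iteratedDeriv_top h k).of_le (by exact_mod_cast le_top)) hf x).deriv

-- The derivatives fall on the mollifier; using ρ(x - ·) as test function in the weak formulation
-- transfers them to g. The sign of the reflection cancels the sign of the weak derivative.
open ContinuousLinearMap in
theorem norm_iteratedDeriv_convolution_le {ρ : ℝ → ℝ} (h : ContDiff ℝ ∞ ρ)
    (hs : HasCompactSupport ρ) {c g : ℝ → ℝ}
    (hc : LocallyIntegrable (fun x ↦ (c x : ℂ)) volume) {k : ℕ} (hg : HasWeakDerivOfOrder k c g)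
    {M : ℝ} (hM : ∀ᵐ x, |g x| ≤ M) (x : ℝ) :
    ‖iteratedDeriv k (convolution ρ (fun x ↦ (c x : ℂ)) (lsmul ℝ ℝ) volume) x‖ ≤
      M * ∫ y, |ρ y| := by
  rw [iteratedDeriv_convolution_left h hs hc, convolution_eq_swap]
  simp only [lsmul_apply]
  obtain ⟨φ, hφ⟩ : ∃ φ : ℝ → ℝ, φ = fun y ↦ ρ (x - y) := ⟨_, rfl⟩
  have hφd : ContDiff ℝ ∞ φ := hφ ▸ h.comp (contDiff_const.sub contDiff_id)
  have hφs : HasCompactSupport φ := by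
    rw [hφ]; exact hs.comp_homeomorph (Homeomorph.subLeft x)
  have e1 : ∀ y, iteratedDeriv k ρ (x - y) = (-1) ^ k * iteratedDeriv k φ y := fun y ↦ by
    rw [hφ, iteratedDeriv_comp_const_sub]
    simp only [smul_eq_mul]
    rw [← mul_assoc, ← mul_pow]
    simp
  have e2 : ∫ y, iteratedDeriv k ρ (x - y) • (c y : ℂ) = ((∫ y, g y * φ y : ℝ) : ℂ) := by
    have h1 := hg φ hφd hφs
    have h2 : ∀ y, iteratedDeriv k ρ (x - y) • (c y : ℂ) =
        (((-1) ^ k * (c y * iteratedDeriv k φ y) : ℝ) : ℂ) := fun y ↦ by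
      rw [e1, Complex.real_smul]; push_cast; ring
    simp only [h2]
    refine (integral_ofReal (𝕜 := ℂ) (μ := volume)
      (f := fun y ↦ (-1) ^ k * (c y * iteratedDeriv k φ y))).trans ?_
    rw [integral_const_mul, h1, ← mul_assoc, ← mul_pow]
    simp
  rw [e2, Complex.norm_real]
  have hφi : Integrable φ := hφd.continuous.integrable_of_hasCompactSupport hφs
  have e3 : ∫ y, |ρ y| = ∫ y, |φ y| := by
    rw [hφ]; exact (integral_sub_left_eq_self (fun y ↦ |ρ y|) volume x).symm
  rw [e3, ← integral_const_mul]
  refine norm_integral_le_of_norm_le (hφi.abs.const_mul M) ?_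
  filter_upwards [hM] with y hy
  rw [norm_mul]
  exact mul_le_mul_of_nonneg_right hy (norm_nonneg _)

/-- Dilations of one bump by n + 1 ≥ 1 only decrease the derivatives. -/
theorem exists_cutoff (N : ℕ) : ∃ (χ : ℕ → ℝ → ℝ) (X : ℝ),
    (∀ n, ContDiff ℝ ∞ (χ n)) ∧ (∀ n, HasCompactSupport (χ n)) ∧
    (∀ n, ∀ k ≤ N, ∀ x, ‖iteratedDeriv k (χ n) x‖ ≤ X) ∧
    ∀ x, ∀ᶠ n in Filter.atTop, χ n x = 1 := by
  obtain ⟨χ, hχ⟩ : ∃ χ : ContDiffBump (0 : ℝ), χ.rIn = 1 :=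
    ⟨⟨1, 2, by norm_num, by norm_num⟩, rfl⟩
  have hd : ContDiff ℝ ∞ χ := χ.contDiff
  have hs : HasCompactSupport χ := χ.hasCompactSupport
  have hb : ∀ k, ∃ B, ∀ x, ‖iteratedDeriv k χ x‖ ≤ B := fun k ↦
    (contDiff_iteratedDeriv_top hd k).continuous.bounded_above_of_compact_support
      (hasCompactSupport_iteratedDeriv hs k)
  choose B hB using hb
  have hB0 : ∀ k, 0 ≤ B k := fun k ↦ (norm_nonneg _).trans (hB k 0)
  refine ⟨fun n x ↦ χ (((n : ℝ) + 1)⁻¹ * x), ∑ k ∈ Finset.range (N + 1), B k,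
    fun n ↦ hd.comp (contDiff_const.mul contDiff_id), fun n ↦ ?_, fun n k hk x ↦ ?_, fun x ↦ ?_⟩
  · have h0 : ((n : ℝ) + 1)⁻¹ ≠ 0 := by positivity
    exact hs.comp_homeomorph (Homeomorph.mulLeft₀ _ h0)
  · rw [iteratedDeriv_comp_const_smul (hd.of_le (by exact_mod_cast le_top))]
    have h1 : ((n : ℝ) + 1)⁻¹ ^ k ≤ 1 := pow_le_one₀ (by positivity) (inv_le_one_of_one_le₀
      (by linarith [(Nat.cast_nonneg n : (0 : ℝ) ≤ n)]))
    rw [norm_smul, Real.norm_of_nonneg (by positivity)]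
    calc _ ≤ 1 * B k := by gcongr; exact hB k _
      _ = B k := one_mul _
      _ ≤ _ := Finset.single_le_sum (fun i _ ↦ hB0 i) (Finset.mem_range.2 (by omega))
  · filter_upwards [Filter.eventually_ge_atTop ⌈|x|⌉₊] with n hn
    apply χ.one_of_mem_closedBall
    rw [hχ, mem_closedBall_zero_iff, norm_mul, norm_inv, Real.norm_of_nonneg (by positivity),
      inv_mul_le_iff₀ (by positivity), mul_one, Real.norm_eq_abs]
    have := (Nat.le_ceil |x|).trans (Nat.cast_le.2 hn)
    linarith

theorem MemSobolevInfty.exists_bound {N : ℕ} {c : ℝ → ℝ} (h : MemSobolevInfty N c) :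
    ∃ M, ∀ k ≤ N, ∃ g : ℝ → ℝ, (∀ᵐ x, |g x| ≤ M) ∧ HasWeakDerivOfOrder k c g := by
  have h1 : ∀ k : ℕ, ∃ (g : ℝ → ℝ) (B : ℝ), 0 ≤ B ∧
      (k ≤ N → (∀ᵐ x, |g x| ≤ B) ∧ HasWeakDerivOfOrder k c g) := by
    intro k
    by_cases hk : k ≤ N
    · obtain ⟨g, hg, hw⟩ := h.2 k hk
      refine ⟨g, (eLpNorm g ∞ volume).toReal, ENNReal.toReal_nonneg, fun _ ↦ ⟨?_, hw⟩⟩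
      have h2 := ae_le_eLpNormEssSup (f := g) (μ := volume)
      filter_upwards [h2] with x hx
      rw [← eLpNorm_exponent_top] at hx
      have h3 := ENNReal.toReal_mono hg.2.ne hx
      rwa [toReal_enorm, Real.norm_eq_abs] at h3
    · exact ⟨0, 0, le_rfl, fun h ↦ absurd h hk⟩
  choose g B hB0 hgB using h1
  refine ⟨∑ k ∈ Finset.range (N + 1), B k, fun k hk ↦ ⟨g k, ?_, (hgB k hk).2⟩⟩
  filter_upwards [(hgB k hk).1] with x hx
  exact hx.trans (Finset.single_le_sum (fun i _ ↦ hB0 i) (Finset.mem_range.2 (by omega)))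

-- Mollify, then cut off. Mollifiers of mass one preserve the weak derivative bounds, and the
-- Leibniz rule with uniformly bounded cutoffs costs at most 2ᴺX. Convergence is only almost
-- everywhere, which is all that `HasCommutatorBound.of_tendsto` requires.
open ContinuousLinearMap in
theorem MemSobolevInfty.exists_schwartz_approximation {N : ℕ} {c : ℝ → ℝ}
    (h : MemSobolevInfty N c) : ∃ (b : ℕ → 𝓢(ℝ, ℂ)) (M : ℝ),
      (∀ n, ∀ k ≤ N, ∀ x, ‖iteratedDeriv k (b n) x‖ ≤ M) ∧
      ∀ᵐ x, Filter.Tendsto (fun n ↦ b n x) Filter.atTop (nhds (c x : ℂ)) := by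
  obtain ⟨M, hM⟩ := h.exists_bound
  obtain ⟨χ, X, hχd, hχs, hχb, hχ1⟩ := exists_cutoff N
  have hX : 0 ≤ X := (norm_nonneg _).trans (hχb 0 0 (Nat.zero_le _) 0)
  have hcL : LocallyIntegrable (fun x ↦ (c x : ℂ)) volume :=
    (h.1.ofReal (K := ℂ)).locallyIntegrable le_top
  obtain ⟨φ, hφ⟩ : ∃ φ : ℕ → ContDiffBump (0 : ℝ), ∀ n, (φ n).rIn = 1 / ((n : ℝ) + 1) ∧
      (φ n).rOut = 2 * (1 / ((n : ℝ) + 1)) :=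
    ⟨fun n ↦ ⟨1 / ((n : ℝ) + 1), 2 * (1 / ((n : ℝ) + 1)), by positivity, by
      have : 0 < 1 / ((n : ℝ) + 1) := by positivity
      linarith⟩, fun n ↦ ⟨rfl, rfl⟩⟩
  have hlim : ∀ᵐ x, Filter.Tendsto (fun n ↦ convolution ((φ n).normed volume)
      (fun x ↦ (c x : ℂ)) (lsmul ℝ ℝ) volume x) Filter.atTop (nhds (c x : ℂ)) := by
    -- A bounded ratio of outer to inner radius, here 2, is what gives convergence at Lebesgue
    -- points.
    apply ContDiffBump.ae_convolution_tendsto_right_of_locallyIntegrable (K := 2) _ _ hcL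
    · simp only [(hφ _).2]
      simpa using (tendsto_one_div_add_atTop_nhds_zero_nat (𝕜 := ℝ)).const_mul 2
    · refine Filter.Eventually.of_forall fun n ↦ ?_
      rw [(hφ n).1, (hφ n).2]
  obtain ⟨r, hr⟩ : ∃ r : ℕ → ℝ → ℂ, r = fun n ↦ convolution ((φ n).normed volume)
      (fun x ↦ (c x : ℂ)) (lsmul ℝ ℝ) volume := ⟨_, rfl⟩
  have hrd : ∀ n, ContDiff ℝ ∞ (r n) := fun n ↦ by
    rw [hr]
    exact (φ n).hasCompactSupport_normed.contDiff_convolution_left _ (φ n).contDiff_normed hcL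
  have hrb : ∀ n, ∀ k ≤ N, ∀ x, ‖iteratedDeriv k (r n) x‖ ≤ M := fun n k hk x ↦ by
    obtain ⟨g, hg, hw⟩ := hM k hk
    have h1 := norm_iteratedDeriv_convolution_le (ρ := (φ n).normed volume) (φ n).contDiff_normed
      (φ n).hasCompactSupport_normed hcL hw hg x
    have h2 : ∫ y, |(φ n).normed volume y| = 1 := by
      have h3 : ∀ y, |(φ n).normed volume y| = (φ n).normed volume y := fun y ↦
        abs_of_nonneg ((φ n).nonneg_normed (μ := volume) y)
      simp only [h3]
      exact (φ n).integral_normed (μ := volume)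
    rw [h2, mul_one] at h1
    rw [hr]; exact h1
  have hM0 : 0 ≤ M := (norm_nonneg _).trans (hrb 0 0 (Nat.zero_le _) 0)
  have hbd : ∀ n, ContDiff ℝ ∞ fun x ↦ χ n x • r n x := fun n ↦ (hχd n).smul (hrd n)
  have hbs : ∀ n, HasCompactSupport fun x ↦ χ n x • r n x := fun n ↦ (hχs n).smul_right
  refine ⟨fun n ↦ (hbs n).toSchwartzMap (hbd n), 2 ^ N * (X * M), fun n k hk x ↦ ?_, ?_⟩
  · change ‖iteratedDeriv k (fun x ↦ χ n x • r n x) x‖ ≤ _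
    rw [← norm_iteratedFDeriv_eq_norm_iteratedDeriv]
    refine (norm_iteratedFDeriv_smul_le (hχd n) (hrd n) x
      (by exact_mod_cast (le_top : (k : ℕ∞) ≤ ⊤))).trans ?_
    simp only [norm_iteratedFDeriv_eq_norm_iteratedDeriv]
    calc _ ≤ ∑ i ∈ Finset.range (k + 1), (k.choose i : ℝ) * (X * M) := by
          refine Finset.sum_le_sum fun i hi ↦ ?_
          rw [mul_assoc]
          have hi' := Finset.mem_range.1 hi
          gcongr
          · exact hχb n i (by omega) x
          · exact hrb n (k - i) (by omega) x
      _ = 2 ^ k * (X * M) := by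
          rw [← Finset.sum_mul]
          congr 1
          exact_mod_cast Nat.sum_range_choose k
      _ ≤ _ := by
          gcongr
          norm_num
  · filter_upwards [hlim] with x hx
    have h1 : (fun n ↦ r n x) =ᶠ[Filter.atTop] fun n ↦ χ n x • r n x := by
      filter_upwards [hχ1 x] with n hn
      rw [hn, one_smul]
    have h2 : Filter.Tendsto (fun n ↦ r n x) Filter.atTop (nhds (c x : ℂ)) := by
      rw [hr]; exact hx
    exact h2.congr' h1

/-- The Schwartz approximants share their derivative bounds, so both the Lipschitz constant and the
commutator constant pass to the limit. -/
theorem ConditionC2.exists_isAdmissible {c₁ c₂ : ℝ} (hc₁ : 0 < c₁) {c : ℝ → ℝ}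
    (h1 : ConditionC1 c₁ c₂ c) (h : ConditionC2 c₁ c) :
    ∃ k₁ k₂ : ℝ, c₁ < k₁ ∧ k₂ < c₂ ∧ ∃ a, IsAdmissible c₁⁻¹ k₁ k₂ a ∧ c =ᵐ[volume] a := by
  obtain ⟨N, hN, -, hS⟩ := h
  have hm : 0 ≤ c₁⁻¹ := by positivity
  have hN1 : 1 ≤ N := by
    have : (1 : ℝ) < N := by linarith
    exact_mod_cast this.le
  obtain ⟨k₁, k₂, hk₁, hk₂, a, ha, ha1, ha2, hca⟩ :=
    h1.exists_measurable_representative hS.1.1.aemeasurable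
  obtain ⟨b, M, hb, hlim⟩ := hS.exists_schwartz_approximation
  have hlim' : ∀ᵐ x, Filter.Tendsto (fun n ↦ b n x) Filter.atTop (nhds (a x : ℂ)) := by
    filter_upwards [hlim, hca] with x hx hx'
    rwa [← hx']
  refine ⟨k₁, k₂, hk₁, hk₂, a, ⟨ha, ha1, ha2, ⟨M, fun s hs _ ↦ ?_⟩, ?_⟩, hca⟩
  · filter_upwards [hlim', ae_comp_add_right hlim' s] with x hx hx'
    have h2 : ‖(a (x + s) : ℂ) - a x‖ ≤ M * s := by
      refine le_of_tendsto (hx'.sub hx).norm (Filter.Eventually.of_forall fun n ↦ ?_)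
      have h3 := Convex.norm_image_sub_le_of_norm_deriv_le (f := b n) (C := M)
        (fun y _ ↦ (b n).differentiableAt) (fun y _ ↦ by
          have := hb n 1 hN1 y
          rwa [iteratedDeriv_one] at this) convex_univ (Set.mem_univ x) (Set.mem_univ (x + s))
      rwa [add_sub_cancel_left, Real.norm_of_nonneg hs.le] at h3
    rwa [← Complex.ofReal_sub, Complex.norm_real, Real.norm_eq_abs] at h2
  · exact ⟨_, HasCommutatorBound.of_tendsto (b := fun n ↦ b n) (M := M)
      (fun n ↦ hasCommutatorBound_schwartz hm (by linarith) (b n) (hb n))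
      (fun n ↦ (b n).continuous.aestronglyMeasurable)
      (fun n x ↦ by simpa using hb n 0 (Nat.zero_le _) x) hlim'⟩

end

/-- Under (C1) and either (C2) or (C2'), the operator `t⁻¹ (p⁻¹(x,tD) d(x,tD) - (p⁻¹ d)(x,tD))`,
defined on Schwartz functions by absolutely convergent Fourier integrals, extends to a bounded
operator `H^{-m₁}_t(ℝ) → L²(ℝ)`, `m₁ = 1/c₁`, with norm bounded uniformly in `t ∈ (0, 1]`. -/
theorem mainTheorem4 (c₁ c₂ : ℝ) (hc₁ : 0 < c₁) (hc₁₂ : c₁ < c₂) (hc₂ : c₂ ≤ 2)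
    (hgap : c₁⁻¹ - c₂⁻¹ ≤ 1) (c : ℝ → ℝ) (hC1 : ConditionC1 c₁ c₂ c)
    (hC2 : ConditionC2 c₁ c ∨ ConditionC2' c₁ c₂ c) :
    ∃ C : ℝ, 0 < C ∧ ∀ t : ℝ, 0 < t → t ≤ 1 →
      (∀ f : 𝓢(ℝ, ℂ), Integrable (semiclassicalOp t (dSymbol c) f) ∧
        Integrable (𝓕 (semiclassicalOp t (dSymbol c) f))) ∧
      ∃ T : SemiclassicalSobolev t (-c₁⁻¹) →L[ℂ] Lp ℂ 2 (volume : Measure ℝ),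
        (∀ f : 𝓢(ℝ, ℂ), T (SemiclassicalSobolev.ofSchwartz t (-c₁⁻¹) f) =ᵐ[volume]
          fun x ↦ (t : ℂ)⁻¹ * semicommutator t (pInvSymbol c) (dSymbol c) f x) ∧
        ‖T‖ ≤ C := by
  obtain ⟨k₁, k₂, hk₁, hk₂, a, ha, hca⟩ := hC2.elim
    (ConditionC2.exists_isAdmissible hc₁ hC1) (ConditionC2'.exists_isAdmissible hc₁ hC1)
  have hk₁0 : 0 < k₁ := hc₁.trans hk₁
  have hk₂0 : 0 < k₂ := hk₁0.trans_le ((ha.le_apply 0).trans (ha.apply_le 0))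
  -- Since sup c < c₂ strictly, the gap condition 1/c₁ ≤ 1 + 1/c₂ becomes the strict inequality 1/c₁
  -- < 1 + 1/k₂ that absorbs the logarithm.
  have hinv : c₂⁻¹ < k₂⁻¹ := inv_strictAnti₀ hk₂0 hk₂
  exact ha.exists_operator (by positivity) hk₁0 (by linarith) hca
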